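/- **Model.** There are $N$ users and time slots $t=0,1,2,\dots$. Each user belongs to class $1$ or class $2$; a proportion $\gamma_k>0$ of the users is in class $k$, with $\gamma_1+\gamma_2=1$. Every user has an age in $\{1,2,3,\dots\}$. In each slot at most $M=\alpha N$ users may be scheduled, where $\alpha<1$ is fixed. A scheduled user of class $k$ is successful with probability $p_k$, independently over users and slots. A successful user goes to age $1$; every other user's age increases by $1$. Assume $0<p_2<p_1<1$ and $$\alpha>\frac{1}{1+(D-2)p_2},\qquad D=\frac{1}{p_1-p_2}\Big(\frac{p_1+p_2}{2}+\sqrt{2(p_1-p_2)+\tfrac{(p_1+p_2)^2}{4}}\Big).$$ **Whittle's index policy.** Put $W^k(i)=\frac{(i-1)p_k i}{2}+i$ for $i\ge 1$. In every slot, a Whittle index policy schedules $M$ users with the highest values of $W^{k}(\text{age})$, ties being broken arbitrarily (possibly at random and depending on the past and on $N$). Let $Z_i^{k,N}(t)$ be the number of users of class $k$ and age $i$ at time $t$, divided by $N$. **The vector $z^*$.** Let $u_k^n$ be the stationary law of the age of a class-$k$ user that is scheduled exactly at ages $\ge n$: $u_k^n(i)=\frac{p_k}{np_k+1-p_k}$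 for $1\le i\le n$ and $u_k^n(i)=(1-p_k)^{i-n}\frac{p_k}{np_k+1-p_k}$ for $i\ge n$. For real $W$ put $l_k^1(W)=1+\max\{i\ge1:W^k(i)\le W\}$ and $l_k^2(W)=1+\max\{i\ge1:W^k(i)<W\}$, with $\max\emptyset=0$. Then there is exactly one pair $(W^*,\theta)$ such that $W^*=W^m(i)$ for some class $m$ and some $i\ge 1$, $0<\theta\le1$, and, with $l_k^j=l_k^j(W^*)$, $$\theta\sum_{k}\gamma_k\sum_{i\ge l_k^1}u_k^{l_k^1}(i)+(1-\theta)\sum_k\gamma_k\sum_{i\ge l_k^2}u_k^{l_k^2}(i)=\alpha.$$ Put $z_i^{k,*}=\gamma_k\big(\theta u_k^{l_k^1}(i)+(1-\theta)u_k^{l_k^2}(i)\big)$ and $C^{RP}=\sum_{k=1}^2\sum_{i\ge1}i\,z_i^{k,*}$, which is finite. **Proposition.** Fix an initial proportion vector $x$, and let $N\to\infty$ along numbers of users for which $\alpha N$ and all $Nx_i^k$ are integers, with $\boldsymbol Z^N(0)=x$. 1. For each such $N$, $N\,C^{RP}$ is the optimal value of the relaxed problem: the minimum of $\limsup_{T}\frac1T\mathbb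 E\sum_{t<T}\sum_{\text{users}}\text{age}(t)$ over all causal (possibly randomised) policies whose expected number of scheduled users per slot has $\limsup$ time average at most $\alpha N$. The minimum is attained. 2. For every choice of Whittle index policies, whatever the tie-breaking, the time-averaged expected age per user $$a_{N,T}=\frac1T\,\mathbb E^{wi}\Big[\sum_{t=0}^{T-1}\sum_{k=1}^{2}\sum_{i\ge1}i\,Z_i^{k,N}(t)\,\Big|\,\boldsymbol Z^N(0)=x\Big]$$ satisfies: for every $\varepsilon>0$ there is $T_0$ such that for all $T\ge T_0$ one has $|a_{N,T}-C^{RP}|\le\varepsilon$ for all sufficiently large $N$. 3. If the ties between different pairs (class, age) are broken by a fixed priority order that does not depend on $N$ or $t$, then $\lim_{N\to\infty}a_{N,T}$ exists for every $T$, and $$\lim_{T\to\infty}\lim_{N\to\infty}a_{N,T}=\sum_{k=1}^2\sum_{i\ge1}i\,z_i^{k,*}=C^{RP}.$$ In this sense the Whittle index policy is asymptotically optimal. -/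

import Mathlib

noncomputable section

open Filter Topology

namespace AgeWhittle

/-! ### The network: ages, policies, and the law of the controlled process

The two user classes are indexed by `Fin 2`: index `0` is class 1 and index `1` is class 2. -/

/-- The ages of the `N` users. -/
abbrev Ages (N : ℕ) := Fin N → ℕ

/-- What is known when a scheduling decision is taken: the list of the past pairs
(ages, set of scheduled users), most recent first, together with the current ages. -/
abbrev History (N : ℕ) := List (Ages N × Finset (Fin N)) × Ages N

/-- A causal, possibly randomised, scheduling policy: a distribution over the sets of users to be
scheduled, given the history and the current ages. -/
abbrev Policy (N : ℕ) := History N → PMF (Finset (Fin N))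

lemma channel_sum_eq_one {N : ℕ} (q : Fin N → unitInterval) :
    ∑ c : Fin N → Bool, ∏ u, (if c u then ENNReal.ofReal (q u) else ENNReal.ofReal (1 - q u))
      = 1 := by
  classical
  have h := Finset.prod_univ_sum (fun _ : Fin N => (Finset.univ : Finset Bool))
    (fun u b => if b then ENNReal.ofReal (q u) else ENNReal.ofReal (1 - q u))
  rw [Fintype.piFinset_univ] at h
  rw [← h]
  refine Finset.prod_eq_one fun u _ => ?_
  rw [Fintype.sum_bool]
  simp only [if_true, Bool.false_eq_true, if_false]
  rw [← ENNReal.ofReal_add (q u).2.1 (sub_nonneg.2 (q u).2.2)]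
  simp

/-- The channel states of one time slot: independent, user `u` being without decoding error with
probability `q u`. -/
def channelLaw {N : ℕ} (q : Fin N → unitInterval) : PMF (Fin N → Bool) :=
  PMF.ofFintype
    (fun c => ∏ u, (if c u then ENNReal.ofReal (q u) else ENNReal.ofReal (1 - q u)))
    (channel_sum_eq_one q)

/-- One step of the ages: a scheduled user without decoding error goes to age `1`, every other
user grows older by `1`. -/
def nextAges {N : ℕ} (s : Ages N) (A : Finset (Fin N)) (c : Fin N → Bool) : Ages N :=
  fun u => if u ∈ A ∧ c u = true then 1 else s u + 1

/-- The law of the history at time `t` under the policy `π`, started from the ages `s₀`. -/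
def historyLaw {N : ℕ} (q : Fin N → unitInterval) (π : Policy N) (s₀ : Ages N) :
    ℕ → PMF (History N)
  | 0 => PMF.pure ([], s₀)
  | t + 1 => (historyLaw q π s₀ t).bind fun h =>
      (π h).bind fun A =>
        (channelLaw q).map fun c => ((h.2, A) :: h.1, nextAges h.2 A c)

/-- Expectation of a real function under a discrete distribution.  All the distributions to which
it is applied below have finite support. -/
def expect {β : Type} (μ : PMF β) (f : β → ℝ) : ℝ := ∑' b, (μ b).toReal * f b

/-! ### Whittle's index policy -/

/-- Whittle's index of age `i` for success probability `p`. -/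
def whittleIndex (p : ℝ) (i : ℕ) : ℝ := ((i : ℝ) - 1) * p * i / 2 + i

/-- `π` is a Whittle index policy: it schedules exactly `M` users, of highest index, ties being
broken in any way (possibly at random, and depending on the history). -/
def IsWhittlePolicy {N : ℕ} (p : Fin 2 → unitInterval) (cls : Fin N → Fin 2) (M : ℕ)
    (π : Policy N) : Prop :=
  ∀ (h : History N) (A : Finset (Fin N)), A ∈ (π h).support →
    A.card = M ∧ ∀ u ∈ A, ∀ v ∉ A,
      whittleIndex (p (cls v)) (h.2 v) ≤ whittleIndex (p (cls u)) (h.2 u)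

/-- `π` breaks the ties between different pairs (class, age) of equal index according to the
priority order `r`, where `r a b` means that the pair `b` is served before the pair `a`. -/
def BreaksTiesBy {N : ℕ} (p : Fin 2 → unitInterval) (cls : Fin N → Fin 2)
    (r : Fin 2 × ℕ → Fin 2 × ℕ → Prop) (π : Policy N) : Prop :=
  ∀ (h : History N) (A : Finset (Fin N)), A ∈ (π h).support →
    ∀ u ∈ A, ∀ v ∉ A,
      whittleIndex (p (cls v)) (h.2 v) = whittleIndex (p (cls u)) (h.2 u) →
        ¬ r (cls u, h.2 u) (cls v, h.2 v)

/-- The proportion, among all `N` users, of the users of class `k` and age `i`. -/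
def proportion {N : ℕ} (cls : Fin N → Fin 2) (s : Ages N) (k : Fin 2) (i : ℕ) : ℝ :=
  ((Finset.univ.filter fun u => cls u = k ∧ s u = i).card : ℝ) / N

/-- The expected age per user, averaged over the times `0, …, T - 1`. -/
def averageAge {N : ℕ} (p : Fin 2 → unitInterval) (cls : Fin N → Fin 2) (π : Policy N)
    (s₀ : Ages N) (T : ℕ) : ℝ :=
  (T : ℝ)⁻¹ * ∑ t ∈ Finset.range T,
    expect (historyLaw (fun u => p (cls u)) π s₀ t)
      fun h => ∑ k, ∑' i : ℕ, proportion cls h.2 k i * i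

/-! ### The relaxed problem -/

/-- The long-run expected total age of all users. -/
def longRunAge {N : ℕ} (q : Fin N → unitInterval) (π : Policy N) (s₀ : Ages N) : EReal :=
  limsup (fun T : ℕ => (((T : ℝ)⁻¹ * ∑ t ∈ Finset.range T,
    expect (historyLaw q π s₀ t) fun h => ∑ u, (h.2 u : ℝ) : ℝ) : EReal)) atTop

/-- The long-run expected number of scheduled users per time slot. -/
def longRunScheduled {N : ℕ} (q : Fin N → unitInterval) (π : Policy N) (s₀ : Ages N) : EReal :=
  limsup (fun T : ℕ => (((T : ℝ)⁻¹ * ∑ t ∈ Finset.range T,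
    expect (historyLaw q π s₀ t) fun h => expect (π h) fun A => (A.card : ℝ) : ℝ) : EReal)) atTop

/-- The costs of the policies that satisfy the relaxed constraint: at most `α N` users are
scheduled per slot on long-run average. -/
def relaxedCosts {N : ℕ} (q : Fin N → unitInterval) (s₀ : Ages N) (α : ℝ) : Set EReal :=
  {J | ∃ π : Policy N, longRunScheduled q π s₀ ≤ ((α * N : ℝ) : EReal) ∧ J = longRunAge q π s₀}

/-! ### The threshold vectors and the proportions `z*` -/

/-- The stationary distribution of the age of a user with success probability `p` that is
scheduled exactly when its age is at least `n` (`n ≥ 1`). -/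
def thresholdLaw (p : ℝ) (n i : ℕ) : ℝ :=
  if i = 0 then 0
  else if i ≤ n then p / (n * p + 1 - p)
  else (1 - p) ^ (i - n) * (p / (n * p + 1 - p))

/-- `thresholdLaw p n` solves the balance equations of that chain and has total mass one. -/
lemma thresholdLaw_stationary {p : ℝ} (hp : 0 < p) (hp1 : p ≤ 1) {n : ℕ} (hn : 1 ≤ n) :
    HasSum (thresholdLaw p n) 1 ∧
    HasSum (fun j => p * thresholdLaw p n (n + j)) (thresholdLaw p n 1) ∧
    (∀ i, 1 ≤ i → i < n → thresholdLaw p n (i + 1) = thresholdLaw p n i) ∧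
    (∀ i, n ≤ i → thresholdLaw p n (i + 1) = (1 - p) * thresholdLaw p n i) := by
  have hn' : (1 : ℝ) ≤ n := by exact_mod_cast hn
  have hd : 0 < n * p + 1 - p := by nlinarith
  have htail : ∀ j, thresholdLaw p n (n + j) = (1 - p) ^ j * (p / (n * p + 1 - p)) := by
    intro j
    unfold thresholdLaw
    rw [if_neg (by omega)]
    rcases Nat.eq_zero_or_pos j with rfl | hj
    · simp
    · rw [if_neg (by omega)]
      simp
  have hg : HasSum (fun j : ℕ => (1 - p) ^ j) p⁻¹ := by
    simpa using hasSum_geometric_of_lt_one (sub_nonneg.2 hp1) (by linarith : 1 - p < 1)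
  have ht : HasSum (fun j => thresholdLaw p n (n + j)) (1 / (n * p + 1 - p)) := by
    simp only [htail]
    have he : 1 / (n * p + 1 - p) = p⁻¹ * (p / (n * p + 1 - p)) := by
      rw [← mul_div_assoc, inv_mul_cancel₀ hp.ne']
    rw [he]
    exact hg.mul_right (p / (n * p + 1 - p))
  refine ⟨?_, ?_, ?_, ?_⟩
  · rw [← hasSum_nat_add_iff' n]
    have hs : ∑ i ∈ Finset.range n, thresholdLaw p n i
        = (n - 1 : ℝ) * (p / (n * p + 1 - p)) := by
      obtain ⟨m, rfl⟩ : ∃ m, n = m + 1 := ⟨n - 1, by omega⟩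
      rw [Finset.sum_range_succ']
      have h0 : thresholdLaw p (m + 1) 0 = 0 := by simp [thresholdLaw]
      rw [h0, add_zero, Finset.sum_congr rfl (g := fun _ => p / (((m + 1 : ℕ) : ℝ) * p + 1 - p))]
      · simp
      · intro i hi
        have : i < m := Finset.mem_range.1 hi
        unfold thresholdLaw
        rw [if_neg (by omega), if_pos (by omega)]
    rw [hs]
    have he : (1 : ℝ) - (n - 1 : ℝ) * (p / (n * p + 1 - p)) = 1 / (n * p + 1 - p) := by
      rw [eq_div_iff hd.ne', sub_mul, mul_assoc, div_mul_cancel₀ _ hd.ne']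
      ring
    rw [he]
    simpa [add_comm] using ht
  · have h1 : thresholdLaw p n 1 = p * (1 / (n * p + 1 - p)) := by
      unfold thresholdLaw
      rw [if_neg (by omega), if_pos hn]
      ring
    rw [h1]
    exact ht.mul_left p
  · intro i h1 h2
    unfold thresholdLaw
    rw [if_neg (by omega), if_pos (by omega), if_neg (by omega), if_pos (by omega)]
  · intro i hi
    obtain ⟨j, rfl⟩ := Nat.exists_eq_add_of_le hi
    rw [add_assoc, htail, htail, pow_succ]
    ring

/-- The largest age of index at most `W`, plus one (so `1` if there is no such age). -/
def upperThreshold (p W : ℝ) : ℕ := sSup {i : ℕ | 1 ≤ i ∧ whittleIndex p i ≤ W} + 1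

/-- The largest age of index less than `W`, plus one (so `1` if there is no such age). -/
def lowerThreshold (p W : ℝ) : ℕ := sSup {i : ℕ | 1 ≤ i ∧ whittleIndex p i < W} + 1

/-- The stationary scheduled proportion when class `k` uses the threshold `l k`. -/
def scheduledRate (p : Fin 2 → unitInterval) (γ : Fin 2 → ℝ) (l : Fin 2 → ℕ) : ℝ :=
  ∑ k, γ k * ∑' j : ℕ, thresholdLaw (p k) (l k) (l k + j)

/-- `W` is an index value and `θ ∈ (0, 1]` is the weight for which the mixture of the two threshold
vectors attached to `W` schedules the proportion `α` of the users. -/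
def IsRelaxedSolution (p : Fin 2 → unitInterval) (γ : Fin 2 → ℝ) (α W θ : ℝ) : Prop :=
  (∃ (m : Fin 2) (i : ℕ), 1 ≤ i ∧ W = whittleIndex (p m) i) ∧ 0 < θ ∧ θ ≤ 1 ∧
    θ * scheduledRate p γ (fun k => upperThreshold (p k) W)
      + (1 - θ) * scheduledRate p γ (fun k => lowerThreshold (p k) W) = α

/-- The proportions `z_i^{k,*}`. -/
def zStar (p : Fin 2 → unitInterval) (γ : Fin 2 → ℝ) (W θ : ℝ) (k : Fin 2) (i : ℕ) : ℝ :=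
  γ k * (θ * thresholdLaw (p k) (upperThreshold (p k) W) i
    + (1 - θ) * thresholdLaw (p k) (lowerThreshold (p k) W) i)

/-- The cost per user `∑ₖ ∑ᵢ i zᵢᵏ` of the proportions `z*`. -/
def zStarCost (p : Fin 2 → unitInterval) (γ : Fin 2 → ℝ) (W θ : ℝ) : ℝ :=
  ∑ k, ∑' i : ℕ, (i : ℝ) * zStar p γ W θ k i

/-- The constant `D` of the assumption on `α`, for `p₁ > p₂`. -/
def alternationBound (p₁ p₂ : ℝ) : ℝ :=
  1 / (p₁ - p₂) * ((p₁ + p₂) / 2 + √(2 * (p₁ - p₂) + (p₁ + p₂) ^ 2 / 4))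

end AgeWhittle

end

noncomputable section

open Filter Topology

namespace AgeWhittle

/-! ### Indices and thresholds -/

/-! The relaxed problem is solved by Lagrangian duality. With a price `W` per attempt it splits into
single-user problems, for which the thresholds `lowerThreshold` and `upperThreshold` are both
optimal, with average cost `gain` and relative value `relValue`. The losses `passiveGap` and
`activeGap` of suboptimal decisions are nonnegative, so telescoping the Bellman identity
`userValue_step` bounds the cost of every admissible policy below by `N (∑ γ_k gain_k - W α)`. By
`IsRelaxedSolution.zStarCost_eq` this equals `N` times the cost of `z*`, and a policy that
randomises at the marginal age attains it.

The same identity holds along fluid paths (`IsFluidPath.value_step`): the average cost of a path is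
the cost of `z*`, plus the average loss, plus boundary terms. Hence the path need not converge to
`z*`; it is enough that the losses vanish, i.e. that eventually almost nobody is scheduled below the
lower thresholds or idle from the upper thresholds on (`exists_time_nearOptimal`).

That is where the assumption on `α` is used. It yields an `m` with `m + 1 < D` such that the births
of `m` slots fill the `1 - α` idle places. For `L < D` every user older than `L`, of either class,
precedes every user of age at most `L`. So after `m` slots all idle users are at most `m` old, and
young users of whom none is scheduled are complete cohorts of births. Births are proportional to
scheduled masses, so the scheduled mass `x` of class 1 satisfies a closed recursion. If `W* = 1`,
comparing two consecutive slots suffices (`between_lines`). If `W* > 1`, newborns are eventually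
never scheduled and the idle mass of class 1 is a max-min over `L` of increasing functions of the
last `L` values of `x` (`IsDelaySystem`); each step keeps a fraction of the current value, so
oscillations contract to the equilibrium.

For finite `N` a trajectory satisfies the constraints of a fluid path exactly, and the balance
equations up to a noise of variance `O(1/N)`. Ties may make fluid paths non-unique, so the
comparison goes through compactness: for fixed `T` all paths with a small enough error cost almost
what some fluid path costs (`exists_approx_pathCost_near`). A total order on the ties makes the
fluid path unique, which gives the limit in `N`. -/

lemma whittleIndex_strictMono {p : ℝ} (hp : 0 ≤ p) : StrictMono (whittleIndex p) := by
  refine strictMono_nat_of_lt_succ fun i => ?_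
  unfold whittleIndex
  push_cast
  have : (0 : ℝ) ≤ i := Nat.cast_nonneg i
  nlinarith [mul_nonneg hp this]

@[simp] lemma whittleIndex_zero (p : ℝ) : whittleIndex p 0 = 0 := by simp [whittleIndex]

@[simp] lemma whittleIndex_one (p : ℝ) : whittleIndex p 1 = 1 := by simp [whittleIndex]

lemma le_whittleIndex {p : ℝ} (hp : 0 ≤ p) (i : ℕ) : (i : ℝ) ≤ whittleIndex p i := by
  rcases i with _ | i
  · simp
  · unfold whittleIndex
    push_cast
    have : (0 : ℝ) ≤ i := Nat.cast_nonneg i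
    nlinarith [mul_nonneg (mul_nonneg this hp) (by linarith : (0 : ℝ) ≤ i + 1)]

lemma whittleIndex_le_of_le {p₁ p₂ : ℝ} (h : p₂ ≤ p₁) (i : ℕ) :
    whittleIndex p₂ i ≤ whittleIndex p₁ i := by
  rcases i with _ | i
  · simp
  · unfold whittleIndex
    push_cast
    have : (0 : ℝ) ≤ i := Nat.cast_nonneg i
    nlinarith [mul_nonneg (mul_nonneg this (sub_nonneg.2 h)) (by linarith : (0 : ℝ) ≤ i + 1)]

lemma whittleIndex_lt_of_lt {p₁ p₂ : ℝ} (h : p₂ < p₁) {i : ℕ} (hi : 2 ≤ i) :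
    whittleIndex p₂ i < whittleIndex p₁ i := by
  unfold whittleIndex
  have : (2 : ℝ) ≤ i := by exact_mod_cast hi
  nlinarith [mul_pos (mul_pos (by linarith : (0 : ℝ) < i - 1) (sub_pos.2 h))
    (by linarith : (0 : ℝ) < i)]

/-- The quadratic governs the comparison of the classes: `2 (W²(i+1) - W¹(i)) = 2 + (p₁+p₂) i -
(p₁-p₂) i²`, and `D` is its positive root. -/
lemma alternationBound_root {p₁ p₂ : ℝ} (h : p₂ < p₁) :
    (p₁ - p₂) * alternationBound p₁ p₂ ^ 2 - (p₁ + p₂) * alternationBound p₁ p₂ - 2 = 0 := by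
  have hd : 0 < p₁ - p₂ := sub_pos.2 h
  have hs : √(2 * (p₁ - p₂) + (p₁ + p₂) ^ 2 / 4) ^ 2 = 2 * (p₁ - p₂) + (p₁ + p₂) ^ 2 / 4 :=
    Real.sq_sqrt (by positivity)
  unfold alternationBound
  set s := √(2 * (p₁ - p₂) + (p₁ + p₂) ^ 2 / 4)
  field_simp
  nlinarith

lemma alternationBound_pos {p₁ p₂ : ℝ} (h₂ : 0 < p₂) (h : p₂ < p₁) :
    0 < alternationBound p₁ p₂ := by
  have hd : 0 < p₁ - p₂ := sub_pos.2 h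
  have : 0 < p₁ + p₂ := by linarith
  unfold alternationBound
  positivity

/-- At `2` the quadratic of `alternationBound_root` equals `2p₁ - 6p₂ - 2 < 0`, so its positive root
lies beyond. This makes `D - 2` positive in the assumption on `α`. -/
lemma two_lt_alternationBound {p₁ p₂ : ℝ} (h₂ : 0 < p₂) (h : p₂ < p₁) (h₁ : p₁ < 1) :
    2 < alternationBound p₁ p₂ := by
  have hr := alternationBound_root h
  have hpos := alternationBound_pos h₂ h
  by_contra hle
  push Not at hle
  nlinarith [mul_nonneg hpos.le (sub_nonneg.2 hle)]

lemma whittleIndex_lt_succ_of_lt_alternationBound {p₁ p₂ : ℝ} (h : p₂ < p₁)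
    {i : ℕ} (hi : (i : ℝ) < alternationBound p₁ p₂) :
    whittleIndex p₁ i < whittleIndex p₂ (i + 1) := by
  have hr := alternationBound_root h
  have hi0 : (0 : ℝ) ≤ i := Nat.cast_nonneg i
  set D := alternationBound p₁ p₂
  -- The convex quadratic has negative value at `0` and vanishes at `D`, hence is negative on `[0,
  -- D)`.
  have key : (p₁ - p₂) * (i : ℝ) ^ 2 - (p₁ + p₂) * i - 2 < 0 := by
    have hD : (p₁ - p₂) * D - (p₁ + p₂) > 0 := by
      by_contra hle
      push Not at hle
      nlinarith
    by_contra hge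
    push Not at hge
    nlinarith [mul_nonneg hi0 (mul_pos (sub_pos.2 h) (sub_pos.2 hi)).le]
  unfold whittleIndex
  push_cast
  nlinarith

/-- Below the alternation bound the ages are served in decreasing order. -/
lemma whittleIndex_lt_of_age_lt {p : Fin 2 → ℝ} (h₂ : 0 < p 1) (h : p 1 < p 0) {L i j : ℕ}
    (hL : (L : ℝ) < alternationBound (p 0) (p 1)) (hi : i ≤ L) (hj : L < j) (k l : Fin 2) :
    whittleIndex (p k) i < whittleIndex (p l) j := by
  have h0 : (0 : ℝ) ≤ p 0 := by linarith
  calc whittleIndex (p k) i ≤ whittleIndex (p 0) i := by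
        fin_cases k
        · exact le_rfl
        · exact whittleIndex_le_of_le h.le i
    _ ≤ whittleIndex (p 0) L := (whittleIndex_strictMono h0).monotone hi
    _ < whittleIndex (p 1) (L + 1) := whittleIndex_lt_succ_of_lt_alternationBound h hL
    _ ≤ whittleIndex (p 1) j := (whittleIndex_strictMono h₂.le).monotone hj
    _ ≤ whittleIndex (p l) j := by
        fin_cases l
        · exact whittleIndex_le_of_le h.le j
        · exact le_rfl

/-- Replaces the definitions by suprema with an order characterisation. Age `0` is outside the set,
and an empty set has supremum `0`, so the hypothesis `f 0` is what makes the equivalence hold there.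
-/
lemma lt_sSup_add_one_iff {f : ℕ → Prop} (hb : BddAbove {i | 1 ≤ i ∧ f i})
    (hdown : ∀ i j, i ≤ j → f j → f i) (h0 : f 0) (i : ℕ) :
    i < sSup {i | 1 ≤ i ∧ f i} + 1 ↔ f i := by
  constructor
  · intro hi
    rcases Set.eq_empty_or_nonempty {i | 1 ≤ i ∧ f i} with he | hne
    · rw [he] at hi
      simp at hi
      exact hi ▸ h0
    · exact hdown _ _ (Nat.lt_succ_iff.1 hi) (Nat.sSup_mem hne hb).2
  · intro hi
    rcases Nat.eq_zero_or_pos i with rfl | hpos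
    · exact Nat.succ_pos _
    · exact Nat.lt_succ_of_le (le_csSup hb ⟨hpos, hi⟩)

lemma lt_upperThreshold_iff {p W : ℝ} (hp : 0 ≤ p) (hW : 0 ≤ W) (i : ℕ) :
    i < upperThreshold p W ↔ whittleIndex p i ≤ W := by
  refine lt_sSup_add_one_iff (f := fun i => whittleIndex p i ≤ W) ?_ ?_ (by simpa using hW) i
  · refine ⟨⌊W⌋₊, fun j hj => Nat.le_floor ((le_whittleIndex hp j).trans hj.2)⟩
  · exact fun i j hij hj => ((whittleIndex_strictMono hp).monotone hij).trans hj

lemma lt_lowerThreshold_iff {p W : ℝ} (hp : 0 ≤ p) (hW : 0 < W) (i : ℕ) :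
    i < lowerThreshold p W ↔ whittleIndex p i < W := by
  refine lt_sSup_add_one_iff (f := fun i => whittleIndex p i < W) ?_ ?_ (by simpa using hW) i
  · refine ⟨⌊W⌋₊, fun j hj => Nat.le_floor ((le_whittleIndex hp j).trans hj.2.le)⟩
  · exact fun i j hij hj => ((whittleIndex_strictMono hp).monotone hij).trans_lt hj

lemma one_le_upperThreshold (p W : ℝ) : 1 ≤ upperThreshold p W := Nat.le_add_left _ _

lemma one_le_lowerThreshold (p W : ℝ) : 1 ≤ lowerThreshold p W := Nat.le_add_left _ _

lemma lowerThreshold_le_upperThreshold {p W : ℝ} (hp : 0 ≤ p) (hW : 0 < W) :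
    lowerThreshold p W ≤ upperThreshold p W := by
  by_contra hlt
  push Not at hlt
  have h1 := (lt_lowerThreshold_iff hp hW _).1 hlt
  exact lt_irrefl _ ((lt_upperThreshold_iff hp hW.le _).2 h1.le)

/-- The two thresholds differ only if `W` is an index value of the class. -/
lemma upperThreshold_eq_or {p W : ℝ} (hp : 0 ≤ p) (hW : 0 < W) :
    upperThreshold p W = lowerThreshold p W ∨
      (upperThreshold p W = lowerThreshold p W + 1 ∧ whittleIndex p (lowerThreshold p W) = W) := by
  rcases (lowerThreshold_le_upperThreshold hp hW).eq_or_lt with h | h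
  · exact Or.inl h.symm
  · right
    have h1 : whittleIndex p (lowerThreshold p W) ≤ W := (lt_upperThreshold_iff hp hW.le _).1 h
    have h2 : W ≤ whittleIndex p (lowerThreshold p W) := by
      by_contra hlt
      push Not at hlt
      exact lt_irrefl _ ((lt_lowerThreshold_iff hp hW _).2 hlt)
    have h3 : ¬ lowerThreshold p W + 1 < upperThreshold p W := by
      rw [lt_upperThreshold_iff hp hW.le]
      have := whittleIndex_strictMono hp (Nat.lt_succ_self (lowerThreshold p W))
      rw [not_le]
      exact h2.trans_lt this
    exact ⟨by omega, le_antisymm h1 h2⟩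

lemma lowerThreshold_index_le {p W : ℝ} (hp : 0 ≤ p) (hW : 0 < W) :
    W ≤ whittleIndex p (lowerThreshold p W) := by
  by_contra hlt
  push Not at hlt
  exact lt_irrefl _ ((lt_lowerThreshold_iff hp hW _).2 hlt)

/-! ### The scheduled rate of a threshold policy -/

lemma tsum_thresholdLaw_tail {p : ℝ} (hp : 0 < p) (hp1 : p ≤ 1) {n : ℕ} (hn : 1 ≤ n) :
    ∑' j : ℕ, thresholdLaw p n (n + j) = 1 / (n * p + 1 - p) := by
  have h := (thresholdLaw_stationary hp hp1 hn).2.1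
  have h1 : thresholdLaw p n 1 = p * (1 / (n * p + 1 - p)) := by
    unfold thresholdLaw
    rw [if_neg (by omega), if_pos hn]
    ring
  rw [h1] at h
  have := h.mul_left p⁻¹
  simp only [← mul_assoc, inv_mul_cancel₀ hp.ne', one_mul] at this
  exact this.tsum_eq

/-- The stationary scheduled proportion of a user with threshold `n`. -/
def thresholdRate (p : ℝ) (n : ℕ) : ℝ := 1 / (n * p + 1 - p)

lemma thresholdRate_den_pos {p : ℝ} (hp : 0 < p) {n : ℕ} (hn : 1 ≤ n) :
    0 < (n : ℝ) * p + 1 - p := by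
  have : (1 : ℝ) ≤ n := by exact_mod_cast hn
  nlinarith

lemma thresholdRate_pos {p : ℝ} (hp : 0 < p) {n : ℕ} (hn : 1 ≤ n) : 0 < thresholdRate p n :=
  one_div_pos.2 (thresholdRate_den_pos hp hn)

lemma thresholdRate_anti {p : ℝ} (hp : 0 < p) {n m : ℕ} (hn : 1 ≤ n) (h : n ≤ m) :
    thresholdRate p m ≤ thresholdRate p n := by
  refine one_div_le_one_div_of_le (thresholdRate_den_pos hp hn) ?_
  have : (n : ℝ) ≤ m := by exact_mod_cast h
  nlinarith

lemma thresholdRate_lt {p : ℝ} (hp : 0 < p) {n m : ℕ} (hn : 1 ≤ n) (h : n < m) :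
    thresholdRate p m < thresholdRate p n := by
  refine one_div_lt_one_div_of_lt (thresholdRate_den_pos hp hn) ?_
  have : (n : ℝ) < m := by exact_mod_cast h
  nlinarith

lemma scheduledRate_eq {p : Fin 2 → unitInterval} (hp : ∀ k, 0 < (p k : ℝ)) (γ : Fin 2 → ℝ)
    {l : Fin 2 → ℕ} (hl : ∀ k, 1 ≤ l k) :
    scheduledRate p γ l = ∑ k, γ k * thresholdRate (p k) (l k) := by
  unfold scheduledRate thresholdRate
  exact Finset.sum_congr rfl fun k _ => by rw [tsum_thresholdLaw_tail (hp k) (p k).2.2 (hl k)]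

/-! ### Existence and uniqueness of the multiplier and of the mixture weight -/

section existence

variable {p : Fin 2 → unitInterval} {γ : Fin 2 → ℝ}

lemma scheduledRate_anti (hp : ∀ k, 0 < (p k : ℝ)) (hγ : ∀ k, 0 < γ k)
    {l l' : Fin 2 → ℕ} (hl : ∀ k, 1 ≤ l k) (h : ∀ k, l k ≤ l' k) :
    scheduledRate p γ l' ≤ scheduledRate p γ l := by
  rw [scheduledRate_eq hp γ hl, scheduledRate_eq hp γ fun k => (hl k).trans (h k)]
  exact Finset.sum_le_sum fun k _ =>
    mul_le_mul_of_nonneg_left (thresholdRate_anti (hp k) (hl k) (h k)) (hγ k).le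

lemma scheduledRate_lt (hp : ∀ k, 0 < (p k : ℝ)) (hγ : ∀ k, 0 < γ k)
    {l l' : Fin 2 → ℕ} (hl : ∀ k, 1 ≤ l k) (h : ∀ k, l k ≤ l' k) {m : Fin 2} (hm : l m < l' m) :
    scheduledRate p γ l' < scheduledRate p γ l := by
  rw [scheduledRate_eq hp γ hl, scheduledRate_eq hp γ fun k => (hl k).trans (h k)]
  exact Finset.sum_lt_sum (fun k _ =>
    mul_le_mul_of_nonneg_left (thresholdRate_anti (hp k) (hl k) (h k)) (hγ k).le)
    ⟨m, Finset.mem_univ _, mul_lt_mul_of_pos_left (thresholdRate_lt (hp m) (hl m) hm) (hγ m)⟩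

/-- The rate attached to the upper thresholds. -/
def upperRate (p : Fin 2 → unitInterval) (γ : Fin 2 → ℝ) (W : ℝ) : ℝ :=
  scheduledRate p γ (fun k => upperThreshold (p k) W)

/-- The rate attached to the lower thresholds. -/
def lowerRate (p : Fin 2 → unitInterval) (γ : Fin 2 → ℝ) (W : ℝ) : ℝ :=
  scheduledRate p γ (fun k => lowerThreshold (p k) W)

/-- The index values that occur. -/
def indexValues (p : Fin 2 → unitInterval) : Set ℝ :=
  {W | ∃ (m : Fin 2) (i : ℕ), 1 ≤ i ∧ W = whittleIndex (p m) i}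

lemma one_le_of_mem_indexValues {W : ℝ} (h : W ∈ indexValues p) : 1 ≤ W := by
  obtain ⟨m, i, hi, rfl⟩ := h
  have : (1 : ℝ) ≤ i := by exact_mod_cast hi
  exact this.trans (le_whittleIndex (p m).2.1 i)

lemma one_mem_indexValues (p : Fin 2 → unitInterval) : (1 : ℝ) ∈ indexValues p :=
  ⟨0, 1, le_rfl, by simp⟩

lemma finite_indexValues_le (p : Fin 2 → unitInterval) (V : ℝ) :
    (indexValues p ∩ Set.Iic V).Finite := by
  have : indexValues p ∩ Set.Iic V ⊆
      (fun q : Fin 2 × ℕ => whittleIndex (p q.1) q.2) '' (Set.univ ×ˢ Set.Iic ⌊V⌋₊) := by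
    rintro W ⟨⟨m, i, hi, rfl⟩, hV⟩
    exact ⟨(m, i), ⟨trivial, Nat.le_floor ((le_whittleIndex (p m).2.1 i).trans hV)⟩, rfl⟩
  exact ((Set.finite_univ.prod (Set.finite_Iic _)).image _).subset this

lemma upperRate_lt_lowerRate (hp : ∀ k, 0 < (p k : ℝ)) (hγ : ∀ k, 0 < γ k) {W : ℝ}
    (hW : W ∈ indexValues p) : upperRate p γ W < lowerRate p γ W := by
  have hW0 : 0 < W := zero_lt_one.trans_le (one_le_of_mem_indexValues hW)
  obtain ⟨m, i, hi, rfl⟩ := hW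
  refine scheduledRate_lt hp hγ (fun k => one_le_lowerThreshold _ _)
    (fun k => lowerThreshold_le_upperThreshold (hp k).le hW0) (m := m) ?_
  have h1 : i < upperThreshold (p m) (whittleIndex (p m) i) :=
    (lt_upperThreshold_iff (hp m).le hW0.le i).2 le_rfl
  have h2 : ¬ i < lowerThreshold (p m) (whittleIndex (p m) i) := by
    rw [lt_lowerThreshold_iff (hp m).le hW0]
    exact lt_irrefl _
  omega

/-- An age of index at most `V` has index less than `W`, so thresholds only increase from
`upperThreshold` at `V` to `lowerThreshold` at `W`. The intervals `[upperRate, lowerRate)` of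
distinct index values therefore do not overlap. -/
lemma lowerRate_le_upperRate_of_lt (hp : ∀ k, 0 < (p k : ℝ)) (hγ : ∀ k, 0 < γ k) {V W : ℝ}
    (hV : 0 < V) (h : V < W) : lowerRate p γ W ≤ upperRate p γ V := by
  refine scheduledRate_anti hp hγ (fun k => one_le_upperThreshold _ _) fun k => ?_
  by_contra hlt
  push Not at hlt
  have h1 := (lt_upperThreshold_iff (hp k).le hV.le _).1 hlt
  exact lt_irrefl _ ((lt_lowerThreshold_iff (hp k).le (hV.trans h) _).2 (h1.trans_lt h))

lemma lowerRate_one (hp : ∀ k, 0 < (p k : ℝ)) (hγs : γ 0 + γ 1 = 1) : lowerRate p γ 1 = 1 := by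
  have h : ∀ k, lowerThreshold (p k) 1 = 1 := fun k => by
    have h1 : ¬ 1 < lowerThreshold (p k) 1 := by
      rw [lt_lowerThreshold_iff (hp k).le one_pos]
      simp
    have := one_le_lowerThreshold (p k) 1
    omega
  unfold lowerRate
  rw [scheduledRate_eq hp γ fun k => (h k).ge]
  simp [h, thresholdRate, hγs]

lemma exists_upperRate_le (hp : ∀ k, 0 < (p k : ℝ)) (hγ : ∀ k, 0 < γ k)
    {α : ℝ} (hα : 0 < α) :
    ∃ W ∈ indexValues p, upperRate p γ W ≤ α := by
  have htend : Tendsto (fun n : ℕ => ∑ k, γ k * thresholdRate (p k) n) atTop (𝓝 0) := by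
    have : ∀ k, Tendsto (fun n : ℕ => γ k * thresholdRate (p k) n) atTop (𝓝 0) := fun k => by
      have h1 : Tendsto (fun n : ℕ => (n : ℝ) * p k + 1 - p k) atTop atTop := by
        have := (tendsto_natCast_atTop_atTop (R := ℝ)).atTop_mul_const (hp k)
        exact (tendsto_atTop_add_const_right _ (1 - (p k : ℝ)) this).congr fun n => by ring
      simpa [thresholdRate] using (tendsto_inv_atTop_zero.comp h1).const_mul (γ k)
    simpa using tendsto_finsetSum Finset.univ fun k _ => this k
  obtain ⟨n, hn, hle⟩ :=
    ((htend.eventually (gt_mem_nhds hα)).and (eventually_ge_atTop 1)).exists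
  -- The larger of the two indices of age `n` pushes the upper thresholds of both classes beyond
  -- `n`.
  obtain ⟨m, hm⟩ : ∃ m, ∀ k, whittleIndex (p k) n ≤ whittleIndex (p m) n := by
    obtain ⟨m, -, hm⟩ := Finset.exists_max_image Finset.univ
      (fun k => whittleIndex (p k) n) ⟨0, Finset.mem_univ _⟩
    exact ⟨m, fun k => hm k (Finset.mem_univ k)⟩
  have hmem : whittleIndex (p m) n ∈ indexValues p := ⟨m, n, hle, rfl⟩
  have hpos := zero_lt_one.trans_le (one_le_of_mem_indexValues hmem)
  refine ⟨_, hmem, ?_⟩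
  refine le_trans (scheduledRate_anti hp hγ (l := fun _ => n) (fun _ => hle) fun k => ?_) ?_
  · exact ((lt_upperThreshold_iff (hp k).le hpos.le n).2 (hm k)).le
  · rw [scheduledRate_eq hp γ fun _ => hle]
    exact hn.le

/-- The half-open range of `θ` corresponds to a half-open interval of rates: `θ = 1` gives the upper
rate, and `θ = 0`, which would give the lower rate, is excluded. -/
lemma isRelaxedSolution_rates (hp : ∀ k, 0 < (p k : ℝ)) (hγ : ∀ k, 0 < γ k) {α W θ : ℝ}
    (h : IsRelaxedSolution p γ α W θ) : upperRate p γ W ≤ α ∧ α < lowerRate p γ W := by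
  obtain ⟨hW, h0, h1, he⟩ := h
  have hlt := upperRate_lt_lowerRate (p := p) hp hγ hW
  change θ * upperRate p γ W + (1 - θ) * lowerRate p γ W = α at he
  constructor <;> nlinarith

/-- The relaxed problem has exactly one multiplier and mixture weight. -/
theorem existsUnique_isRelaxedSolution (hp : ∀ k, 0 < (p k : ℝ)) (hγ : ∀ k, 0 < γ k)
    (hγs : γ 0 + γ 1 = 1) {α : ℝ} (hα : 0 < α) (hα1 : α < 1) :
    ∃! q : ℝ × ℝ, IsRelaxedSolution p γ α q.1 q.2 := by
  obtain ⟨V, hV, hVα⟩ := exists_upperRate_le (p := p) hp hγ hα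
  -- The multiplier is the least index value whose upper rate is at most `α`; a finite set suffices
  -- because index values do not accumulate.
  let F := (finite_indexValues_le p V).toFinset.filter fun W => upperRate p γ W ≤ α
  have hFne : F.Nonempty := ⟨V, by simp [F, hV, hVα]⟩
  obtain ⟨W, hWF, hWmin⟩ := F.exists_min_image id hFne
  simp only [F, Finset.mem_filter, Set.Finite.mem_toFinset, Set.mem_inter_iff, Set.mem_Iic] at hWF
  obtain ⟨⟨hW, hWV⟩, hWα⟩ := hWF
  have hW1 := one_le_of_mem_indexValues hW
  have hmin : ∀ U ∈ indexValues p, U < W → α < upperRate p γ U := by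
    intro U hU hUW
    by_contra hle
    push Not at hle
    have := hWmin U (by simp [F, hU, hle, (hUW.trans_le hWV).le])
    exact absurd hUW (not_lt.2 this)
  have hlow : α < lowerRate p γ W := by
    rcases hW1.eq_or_lt with h1 | h1
    · rw [← h1, lowerRate_one hp hγs]
      exact hα1
    -- With `U` the index value preceding `W`, no index lies strictly between, so the lower
    -- thresholds at `W` are the upper thresholds at `U`; minimality of `W` then applies to `U`.
    · let G := (finite_indexValues_le p W).toFinset.filter fun U => U < W
      have hGne : G.Nonempty := ⟨1, by simp [G, one_mem_indexValues, h1, hW1]⟩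
      obtain ⟨U, hUG, hUmax⟩ := G.exists_max_image id hGne
      simp only [G, Finset.mem_filter, Set.Finite.mem_toFinset, Set.mem_inter_iff,
        Set.mem_Iic] at hUG
      obtain ⟨⟨hU, -⟩, hUW⟩ := hUG
      have hU0 : 0 < U := zero_lt_one.trans_le (one_le_of_mem_indexValues hU)
      have heq : ∀ k, upperThreshold (p k) U = lowerThreshold (p k) W := by
        intro k
        refine eq_of_forall_lt_iff fun i => ?_
        rw [lt_upperThreshold_iff (hp k).le hU0.le, lt_lowerThreshold_iff (hp k).le (hU0.trans hUW)]
        refine ⟨fun h => h.trans_lt hUW, fun h => ?_⟩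
        rcases Nat.eq_zero_or_pos i with rfl | hi
        · simpa using hU0.le
        · exact hUmax _ (by simp only [G, Finset.mem_filter, Set.Finite.mem_toFinset,
            Set.mem_inter_iff, Set.mem_Iic]; exact ⟨⟨⟨k, i, hi, rfl⟩, h.le⟩, h⟩)
      have : lowerRate p γ W = upperRate p γ U := by simp [lowerRate, upperRate, heq]
      rw [this]
      exact hmin U hU hUW
  have hlt := upperRate_lt_lowerRate (p := p) hp hγ hW
  have hd : 0 < lowerRate p γ W - upperRate p γ W := sub_pos.2 hlt
  refine ⟨(W, (lowerRate p γ W - α) / (lowerRate p γ W - upperRate p γ W)), ⟨hW, ?_, ?_, ?_⟩, ?_⟩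
  · exact div_pos (sub_pos.2 hlow) hd
  · rw [div_le_one hd]
    linarith
  · change _ * upperRate p γ W + (1 - _) * lowerRate p γ W = α
    field_simp
    ring
  · rintro ⟨W', θ'⟩ h'
    obtain ⟨hu, hl⟩ := isRelaxedSolution_rates hp hγ h'
    obtain ⟨hW', h0, h1, he⟩ := h'
    simp only at hW' h0 h1 he hu hl
    -- Below `W` the upper rate exceeds `α`; above `W` the lower rate is at most `upperRate p γ W ≤
    -- α`. Given `W`, the weight solves a linear equation.
    have hWW : W' = W := by
      rcases lt_trichotomy W' W with hlt' | heq | hlt'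
      · exact absurd (hmin W' hW' hlt') (not_lt.2 hu)
      · exact heq
      · have := lowerRate_le_upperRate_of_lt (p := p) hp hγ (zero_lt_one.trans_le hW1) hlt'
        linarith
    subst hWW
    change θ' * upperRate p γ W' + (1 - θ') * lowerRate p γ W' = α at he
    simp only [Prod.mk.injEq, true_and]
    rw [eq_div_iff hd.ne']
    linarith

end existence

/-! ### The value function of the single-user problem with price `W` per attempt -/

/-- The optimal average cost per slot. -/
def gain (p : ℝ) (n : ℕ) (W : ℝ) : ℝ :=
  (p * n * (n - 1) / 2 + n + W + (1 - p) / p) / (n * p + 1 - p)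

/-- The relative value function of the policy with threshold `n`, vanishing at age `1`. -/
def relValue (p : ℝ) (n : ℕ) (W : ℝ) (i : ℕ) : ℝ :=
  if i ≤ n then ((i : ℝ) - 1) * gain p n W - i * (i - 1) / 2
  else i / p + (W - gain p n W) / p + (1 - p) / p ^ 2

/-- The loss from not scheduling at age `i`. -/
def passiveGap (p : ℝ) (n : ℕ) (W : ℝ) (i : ℕ) : ℝ :=
  i + relValue p n W (i + 1) - gain p n W - relValue p n W i

/-- The loss from scheduling at age `i`. -/
def activeGap (p : ℝ) (n : ℕ) (W : ℝ) (i : ℕ) : ℝ :=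
  i + W + (1 - p) * relValue p n W (i + 1) - gain p n W - relValue p n W i

section value

variable {p W : ℝ} {n : ℕ}

lemma gain_mul (hp : 0 < p) (hn : 1 ≤ n) :
    gain p n W * (n * p + 1 - p) = p * n * (n - 1) / 2 + n + W + (1 - p) / p :=
  div_mul_cancel₀ _ (thresholdRate_den_pos hp hn).ne'

lemma relValue_of_le {i : ℕ} (h : i ≤ n) :
    relValue p n W i = ((i : ℝ) - 1) * gain p n W - i * (i - 1) / 2 := if_pos h

/-- The two branches of `relValue` agree at `i = n`: this is exactly the equation that determines
the gain. -/
lemma relValue_of_ge (hp : 0 < p) (hn : 1 ≤ n) {i : ℕ} (h : n ≤ i) :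
    relValue p n W i = i / p + (W - gain p n W) / p + (1 - p) / p ^ 2 := by
  rcases h.eq_or_lt with rfl | h
  · rw [relValue_of_le le_rfl]
    have := gain_mul (W := W) hp hn
    field_simp at this ⊢
    linarith
  · exact if_neg (by omega)

@[simp] lemma relValue_one (hn : 1 ≤ n) : relValue p n W 1 = 0 := by
  rw [relValue_of_le hn]; simp

/-- The index enters through this bound and `gain_le`. Staying idle at age `n` loses `n + 1 +
(1-p)/p - gain`, so the upper bound expresses that scheduling at `n` is optimal. The lower bound
makes the relative value increase up to age `n` with `p * relValue p n W n ≤ W`, so that waiting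
before `n` is optimal. -/
lemma gain_ge (hp : 0 < p) (hn : 1 ≤ n) (hW : whittleIndex p (n - 1) ≤ W) :
    n + (1 - p) / p ≤ gain p n W := by
  have hd := thresholdRate_den_pos hp hn
  obtain ⟨k, rfl⟩ : ∃ k, n = k + 1 := ⟨n - 1, by omega⟩
  simp only [Nat.add_sub_cancel, whittleIndex] at hW
  unfold gain
  rw [le_div_iff₀ hd]
  push_cast at *
  have h1 : ((k : ℝ) + 1 + (1 - p) / p) * ((k + 1) * p + 1 - p)
      = ((k : ℝ) + 1) * (k * p + 1) + (1 - p) * k + (1 - p) / p := by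
    field_simp
    ring
  rw [h1]
  nlinarith

lemma gain_le (hp : 0 < p) (hn : 1 ≤ n) (hW : W ≤ whittleIndex p n) :
    gain p n W ≤ n + 1 + (1 - p) / p := by
  have hd := thresholdRate_den_pos hp hn
  simp only [whittleIndex] at hW
  unfold gain
  rw [div_le_iff₀ hd]
  have h1 : ((n : ℝ) + 1 + (1 - p) / p) * (n * p + 1 - p)
      = ((n : ℝ) + 1) * (n * p + 1 - p) + (1 - p) * (n - 1) + (1 - p) / p := by
    field_simp
    ring
  rw [h1]
  nlinarith

lemma gain_eq_of_index_eq (hp : 0 < p) (hn : 1 ≤ n) (hW : whittleIndex p n = W) :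
    gain p n W = n + 1 + (1 - p) / p := by
  have hd := thresholdRate_den_pos hp hn
  simp only [whittleIndex] at hW
  unfold gain
  rw [div_eq_iff hd.ne', ← hW]
  field_simp
  ring

/-- When the price is the index of `n`, scheduling and waiting at age `n` are equally good, so the
thresholds `n` and `n + 1` have the same cost. -/
lemma gain_succ_of_index_eq (hp : 0 < p) (hn : 1 ≤ n) (hW : whittleIndex p n = W) :
    gain p (n + 1) W = gain p n W := by
  have hd := thresholdRate_den_pos hp (Nat.le_succ_of_le hn)
  rw [gain_eq_of_index_eq hp hn hW]
  simp only [whittleIndex] at hW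
  unfold gain
  rw [div_eq_iff hd.ne', ← hW]
  push_cast
  field_simp
  ring

lemma passiveGap_of_lt {i : ℕ} (h : i < n) : passiveGap p n W i = 0 := by
  unfold passiveGap
  rw [relValue_of_le h, relValue_of_le h.le]
  push_cast
  ring

lemma passiveGap_of_ge (hp : 0 < p) (hn : 1 ≤ n) {i : ℕ} (h : n ≤ i) :
    passiveGap p n W i = i + 1 + (1 - p) / p - gain p n W := by
  unfold passiveGap
  rw [relValue_of_ge hp hn h, relValue_of_ge hp hn (Nat.le_succ_of_le h)]
  push_cast
  field_simp
  ring

lemma activeGap_of_ge (hp : 0 < p) (hn : 1 ≤ n) {i : ℕ} (h : n ≤ i) : activeGap p n W i = 0 := by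
  unfold activeGap
  rw [relValue_of_ge hp hn h, relValue_of_ge hp hn (Nat.le_succ_of_le h)]
  push_cast
  field_simp
  ring

lemma activeGap_eq (i : ℕ) :
    activeGap p n W i = passiveGap p n W i + (W - p * relValue p n W (i + 1)) := by
  unfold activeGap passiveGap
  ring

lemma relValue_nonneg (hp : 0 < p) (hp1 : p ≤ 1) (hn : 1 ≤ n) (hW : whittleIndex p (n - 1) ≤ W)
    {i : ℕ} (hi : 1 ≤ i) : 0 ≤ relValue p n W i := by
  have hg := gain_ge hp hn hW
  have hq : 0 ≤ (1 - p) / p := div_nonneg (by linarith) hp.le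
  have small : ∀ j, 1 ≤ j → j ≤ n → 0 ≤ relValue p n W j := by
    intro j hj hjn
    rw [relValue_of_le hjn]
    have h1 : (1 : ℝ) ≤ j := by exact_mod_cast hj
    have h2 : (j : ℝ) ≤ n := by exact_mod_cast hjn
    nlinarith
  rcases le_total i n with h | h
  · exact small i hi h
  · have h1 := small n hn le_rfl
    rw [relValue_of_ge hp hn le_rfl] at h1
    rw [relValue_of_ge hp hn h]
    have : (n : ℝ) / p ≤ i / p := by
      have : (n : ℝ) ≤ i := by exact_mod_cast h
      gcongr
    linarith

/-- Below the threshold the loss is `W - p * relValue p n W (i + 1)`. The increments of the relative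
value there are `gain - i ≥ 0`, so it is largest at `n`, where `gain_ge` gives the bound. -/
lemma activeGap_nonneg (hp : 0 < p) (hp1 : p ≤ 1) (hn : 1 ≤ n)
    (hW : whittleIndex p (n - 1) ≤ W) (i : ℕ) : 0 ≤ activeGap p n W i := by
  rcases lt_or_ge i n with h | h
  · rw [activeGap_eq, passiveGap_of_lt h, zero_add]
    have hg := gain_ge hp hn hW
    have hq : 0 ≤ (1 - p) / p := div_nonneg (by linarith) hp.le
    have hmax : p * relValue p n W n ≤ W := by
      rw [relValue_of_ge hp hn le_rfl]
      have : p * ((n : ℝ) / p + (W - gain p n W) / p + (1 - p) / p ^ 2)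
          = n + W - gain p n W + (1 - p) / p := by
        field_simp
        ring
      rw [this]
      linarith
    have hmono : relValue p n W (i + 1) ≤ relValue p n W n := by
      rw [relValue_of_le h, relValue_of_le le_rfl]
      have h2 : (i : ℝ) + 1 ≤ n := by exact_mod_cast h
      push_cast
      nlinarith
    nlinarith
  · exact (activeGap_of_ge hp hn h).ge

lemma activeGap_le (hp : 0 < p) (hp1 : p ≤ 1) (hn : 1 ≤ n)
    (hW : whittleIndex p (n - 1) ≤ W) (hW0 : 0 ≤ W) (i : ℕ) : activeGap p n W i ≤ W := by
  rcases lt_or_ge i n with h | h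
  · rw [activeGap_eq, passiveGap_of_lt h, zero_add]
    have := relValue_nonneg hp hp1 hn hW (i := i + 1) (by omega)
    nlinarith
  · exact (activeGap_of_ge hp hn h).trans_le hW0

lemma passiveGap_nonneg (hp : 0 < p) (hn : 1 ≤ n) (hW : W ≤ whittleIndex p n) (i : ℕ) :
    0 ≤ passiveGap p n W i := by
  rcases lt_or_ge i n with h | h
  · exact (passiveGap_of_lt h).ge
  · rw [passiveGap_of_ge hp hn h]
    have hg := gain_le hp hn hW
    have : (n : ℝ) ≤ i := by exact_mod_cast h
    linarith

lemma passiveGap_le (hp : 0 < p) (hn : 1 ≤ n) (hW : whittleIndex p (n - 1) ≤ W)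
    (i : ℕ) : passiveGap p n W i ≤ i := by
  rcases lt_or_ge i n with h | h
  · exact (passiveGap_of_lt h).trans_le (Nat.cast_nonneg i)
  · rw [passiveGap_of_ge hp hn h]
    have hg := gain_ge hp hn hW
    have : (1 : ℝ) ≤ n := by exact_mod_cast hn
    linarith

/-- Linear growth bounds the relative value by a multiple of the age, which controls the boundary
terms of the telescoped Bellman identity. -/
lemma exists_relValue_le (p : ℝ) (n : ℕ) (W : ℝ) :
    ∃ c : ℝ, 0 ≤ c ∧ ∀ i : ℕ, 1 ≤ i → |relValue p n W i| ≤ c * i := by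
  set g := gain p n W
  refine ⟨(|g| + n) + (|1 / p| + |(W - g) / p + (1 - p) / p ^ 2|), by positivity, fun i hi => ?_⟩
  have h1 : (1 : ℝ) ≤ i := by exact_mod_cast hi
  have hB : 0 ≤ |1 / p| + |(W - g) / p + (1 - p) / p ^ 2| := by positivity
  have hA : 0 ≤ |g| + (n : ℝ) := by positivity
  unfold relValue
  split_ifs with h
  · have h2 : (i : ℝ) ≤ n := by exact_mod_cast h
    have e1 : |((i : ℝ) - 1) * g| ≤ i * |g| := by
      rw [abs_mul, abs_of_nonneg (by linarith : (0 : ℝ) ≤ i - 1)]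
      nlinarith [abs_nonneg g]
    have e2 : |(i : ℝ) * (i - 1) / 2| ≤ i * n := by
      rw [abs_of_nonneg (by nlinarith)]
      nlinarith
    calc |((i : ℝ) - 1) * g - i * (i - 1) / 2| ≤ i * |g| + i * n :=
          (abs_sub _ _).trans (add_le_add e1 e2)
      _ ≤ _ := by nlinarith
  · have e1 : |(i : ℝ) / p| = |1 / p| * i := by
      rw [div_eq_mul_one_div, abs_mul, abs_of_nonneg (by linarith : (0 : ℝ) ≤ i), mul_comm]
    calc |(i : ℝ) / p + (W - g) / p + (1 - p) / p ^ 2|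
        = |(i : ℝ) / p + ((W - g) / p + (1 - p) / p ^ 2)| := by rw [add_assoc]
      _ ≤ |1 / p| * i + |(W - g) / p + (1 - p) / p ^ 2| := by
          rw [← e1]
          exact abs_add_le _ _
      _ ≤ _ := by nlinarith [abs_nonneg ((W - g) / p + (1 - p) / p ^ 2)]

end value

/-! ### The mean age of a threshold policy -/

/-- The gain is the mean age plus the price times the rate of attempts, so the value does not depend
on `W`. A free `W` allows both thresholds of a mixture to be evaluated at a common price. -/
lemma hasSum_age_thresholdLaw {p : ℝ} (hp : 0 < p) (hp1 : p ≤ 1) {n : ℕ} (hn : 1 ≤ n) (W : ℝ) :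
    HasSum (fun i : ℕ => (i : ℝ) * thresholdLaw p n i)
      (gain p n W - W * thresholdRate p n) := by
  have hd := thresholdRate_den_pos hp hn
  have hnorm : ‖1 - p‖ < 1 := by
    rw [Real.norm_eq_abs, abs_lt]
    constructor <;> linarith
  have hg : HasSum (fun j : ℕ => (1 - p) ^ j) p⁻¹ := by
    simpa using hasSum_geometric_of_lt_one (sub_nonneg.2 hp1) (by linarith : 1 - p < 1)
  have hg2 := hasSum_coe_mul_geometric_of_norm_lt_one hnorm
  rw [sub_sub_cancel] at hg2
  rw [← hasSum_nat_add_iff' n]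
  have hs : ∑ i ∈ Finset.range n, (i : ℝ) * thresholdLaw p n i
      = (n * (n - 1) / 2) * (p / (n * p + 1 - p)) := by
    have : ∀ i ∈ Finset.range n, (i : ℝ) * thresholdLaw p n i
        = i * (p / (n * p + 1 - p)) := by
      intro i hi
      have hin : i < n := Finset.mem_range.1 hi
      unfold thresholdLaw
      split_ifs with h1 h2
      · simp [h1]
      · rfl
      · omega
    rw [Finset.sum_congr rfl this, ← Finset.sum_mul]
    congr 1
    have h2 := Finset.sum_range_id_mul_two n
    have h3 : (∑ i ∈ Finset.range n, (i : ℝ)) * 2 = n * (n - 1) := by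
      have : (((∑ i ∈ Finset.range n, i) * 2 : ℕ) : ℝ) = ((n * (n - 1) : ℕ) : ℝ) := by rw [h2]
      push_cast [Nat.cast_sub hn] at this
      exact this
    linarith
  rw [hs]
  have hterm : ∀ j : ℕ, ((j + n : ℕ) : ℝ) * thresholdLaw p n (j + n)
      = (p / (n * p + 1 - p)) * (n * (1 - p) ^ j + j * (1 - p) ^ j) := by
    intro j
    unfold thresholdLaw
    rw [if_neg (by omega)]
    split_ifs with h
    · obtain rfl : j = 0 := by omega
      simp
      ring
    · rw [Nat.add_sub_cancel]
      push_cast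
      ring
  simp only [hterm]
  have hsum := ((hg.mul_left (n : ℝ)).add hg2).mul_left (p / (n * p + 1 - p))
  have hval : gain p n W - W * thresholdRate p n - n * (n - 1) / 2 * (p / (n * p + 1 - p))
      = p / (n * p + 1 - p) * (n * p⁻¹ + (1 - p) / p ^ 2) := by
    unfold gain thresholdRate
    field_simp
    ring
  rw [hval]
  exact hsum

/-! ### The mixture of two thresholds and the dual value -/

section relaxedSolution

variable {p : Fin 2 → unitInterval} {γ : Fin 2 → ℝ} {α W θ : ℝ}

/-- The optimal average cost of a user of class `k` when attempts have price `W`. -/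
def classGain (p : Fin 2 → unitInterval) (W : ℝ) (k : Fin 2) : ℝ :=
  gain (p k) (lowerThreshold (p k) W) W

/-- The scheduled rate of a user of class `k` under the mixture of the two thresholds. -/
def mixedRate (p : Fin 2 → unitInterval) (W θ : ℝ) (k : Fin 2) : ℝ :=
  θ * thresholdRate (p k) (upperThreshold (p k) W)
    + (1 - θ) * thresholdRate (p k) (lowerThreshold (p k) W)

lemma IsRelaxedSolution.one_le (h : IsRelaxedSolution p γ α W θ) : 1 ≤ W :=
  one_le_of_mem_indexValues h.1

lemma IsRelaxedSolution.sum_mixedRate (h : IsRelaxedSolution p γ α W θ)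
    (hp : ∀ k, 0 < (p k : ℝ)) : ∑ k, γ k * mixedRate p W θ k = α := by
  rw [← h.2.2.2, scheduledRate_eq hp γ fun k => one_le_upperThreshold _ _,
    scheduledRate_eq hp γ fun k => one_le_lowerThreshold _ _]
  simp only [mixedRate, Fin.sum_univ_two]
  ring

/-- Either the thresholds coincide, or they are consecutive and `W` is the index of the lower one;
both are then optimal at the price `W`. -/
lemma gain_upperThreshold (hp : ∀ k, 0 < (p k : ℝ)) (hW : 1 ≤ W) (k : Fin 2) :
    gain (p k) (upperThreshold (p k) W) W = classGain p W k := by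
  rcases upperThreshold_eq_or (hp k).le (zero_lt_one.trans_le hW) with h | ⟨h, h'⟩
  · rw [h, classGain]
  · rw [h, classGain, gain_succ_of_index_eq (hp k) (one_le_lowerThreshold _ _) h']

lemma hasSum_age_zStar (hp : ∀ k, 0 < (p k : ℝ)) (hW : 1 ≤ W) (γ : Fin 2 → ℝ) (θ : ℝ)
    (k : Fin 2) :
    HasSum (fun i : ℕ => (i : ℝ) * zStar p γ W θ k i)
      (γ k * (classGain p W k - W * mixedRate p W θ k)) := by
  have h1 := hasSum_age_thresholdLaw (hp k) (p k).2.2 (one_le_upperThreshold (p k) W) W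
  have h2 := hasSum_age_thresholdLaw (hp k) (p k).2.2 (one_le_lowerThreshold (p k) W) W
  rw [gain_upperThreshold hp hW] at h1
  have h3 := ((h1.mul_left θ).add (h2.mul_left (1 - θ))).mul_left (γ k)
  have hval : γ k * (classGain p W k - W * mixedRate p W θ k)
      = γ k * (θ * (classGain p W k - W * thresholdRate (p k) (upperThreshold (p k) W))
        + (1 - θ) * (gain (p k) (lowerThreshold (p k) W) W
          - W * thresholdRate (p k) (lowerThreshold (p k) W))) := by
    unfold mixedRate classGain
    ring
  rw [hval]
  refine h3.congr_fun fun i => ?_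
  unfold zStar
  ring

/-- Absence of a duality gap: both thresholds have the gain of the class, and the mixture uses the
whole budget `α`. -/
lemma IsRelaxedSolution.zStarCost_eq (h : IsRelaxedSolution p γ α W θ)
    (hp : ∀ k, 0 < (p k : ℝ)) :
    zStarCost p γ W θ = ∑ k, γ k * classGain p W k - W * α := by
  unfold zStarCost
  rw [← h.sum_mixedRate hp, Finset.mul_sum, ← Finset.sum_sub_distrib]
  refine Finset.sum_congr rfl fun k _ => ?_
  rw [(hasSum_age_zStar hp h.one_le γ θ k).tsum_eq]
  ring

lemma mixedRate_bounds (hp : ∀ k, 0 < (p k : ℝ)) (hW : 1 ≤ W) (h0 : 0 ≤ θ) (h1 : θ ≤ 1)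
    (k : Fin 2) :
    thresholdRate (p k) (upperThreshold (p k) W) ≤ mixedRate p W θ k ∧
      mixedRate p W θ k ≤ thresholdRate (p k) (lowerThreshold (p k) W) := by
  have h := thresholdRate_anti (hp k) (one_le_lowerThreshold (p k) W)
    (lowerThreshold_le_upperThreshold (hp k).le (zero_lt_one.trans_le hW))
  unfold mixedRate
  constructor <;> nlinarith

lemma mixedRate_pos (hp : ∀ k, 0 < (p k : ℝ)) (hW : 1 ≤ W) (h0 : 0 ≤ θ) (h1 : θ ≤ 1)
    (k : Fin 2) : 0 < mixedRate p W θ k :=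
  (thresholdRate_pos (hp k) (one_le_upperThreshold _ _)).trans_le
    (mixedRate_bounds hp hW h0 h1 k).1

/-- The mass that a class leaves unscheduled lies between the births during `lowerThreshold - 1`
and during `upperThreshold - 1` slots. -/
lemma mixedRate_births (hp : ∀ k, 0 < (p k : ℝ)) (hW : 1 ≤ W) (h0 : 0 ≤ θ) (h1 : θ ≤ 1)
    (k : Fin 2) :
    ((lowerThreshold (p k) W : ℝ) - 1) * (p k * mixedRate p W θ k) ≤ 1 - mixedRate p W θ k ∧
      1 - mixedRate p W θ k ≤
        ((upperThreshold (p k) W : ℝ) - 1) * (p k * mixedRate p W θ k) := by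
  obtain ⟨hl, hu⟩ := mixedRate_bounds hp hW h0 h1 k
  have d1 := thresholdRate_den_pos (hp k) (one_le_lowerThreshold (p k) W)
  have d2 := thresholdRate_den_pos (hp k) (one_le_upperThreshold (p k) W)
  unfold thresholdRate at hl hu
  rw [le_div_iff₀ d1] at hu
  rw [div_le_iff₀ d2] at hl
  constructor <;> nlinarith

lemma lowerThreshold_sub_one_index_le (hp : ∀ k, 0 < (p k : ℝ)) (hW : 1 ≤ W) (k : Fin 2) :
    whittleIndex (p k) (lowerThreshold (p k) W - 1) ≤ W := by
  refine ((lt_lowerThreshold_iff (hp k).le (zero_lt_one.trans_le hW) _).1 ?_).le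
  have := one_le_lowerThreshold (p k) W
  omega

/-- The only age between the two thresholds is marginal and has index `W`, so idling there costs
nothing. Hence losses come only from idle users at ages from `upperThreshold` on and from users
scheduled below `lowerThreshold`. -/
lemma passiveGap_eq_zero (hp : ∀ k, 0 < (p k : ℝ)) (hW : 1 ≤ W) (k : Fin 2) {i : ℕ}
    (hi : i < upperThreshold (p k) W) :
    passiveGap (p k) (lowerThreshold (p k) W) W i = 0 := by
  rcases lt_or_ge i (lowerThreshold (p k) W) with h | h
  · exact passiveGap_of_lt h
  · rcases upperThreshold_eq_or (hp k).le (zero_lt_one.trans_le hW) with h2 | ⟨h2, h3⟩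
    · omega
    · obtain rfl : i = lowerThreshold (p k) W := by omega
      rw [passiveGap_of_ge (hp k) (one_le_lowerThreshold _ _) le_rfl,
        gain_eq_of_index_eq (hp k) (one_le_lowerThreshold _ _) h3]
      ring

end relaxedSolution

/-! ### Expectations under finitely supported distributions -/

section expectation

variable {β δ : Type}

lemma expect_eq_sum (μ : PMF β) (f : β → ℝ) {s : Finset β} (hs : ∀ b ∈ μ.support, b ∈ s) :
    expect μ f = ∑ b ∈ s, (μ b).toReal * f b := by
  refine tsum_eq_sum fun b hb => ?_
  have : μ b = 0 := by
    by_contra h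
    exact hb (hs b ((PMF.mem_support_iff _ _).2 h))
  simp [this]

lemma expect_congr {μ : PMF β} {f g : β → ℝ} (h : ∀ b ∈ μ.support, f b = g b) :
    expect μ f = expect μ g := by
  refine tsum_congr fun b => ?_
  by_cases hb : b ∈ μ.support
  · rw [h b hb]
  · rw [PMF.mem_support_iff, not_not] at hb
    simp [hb]

lemma sum_toReal_eq_one (μ : PMF β) {s : Finset β} (hs : ∀ b ∈ μ.support, b ∈ s) :
    ∑ b ∈ s, (μ b).toReal = 1 := by
  rw [← ENNReal.toReal_sum fun b _ => μ.apply_ne_top b]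
  have h := μ.tsum_coe
  rw [tsum_eq_sum (s := s)] at h
  · rw [h, ENNReal.toReal_one]
  · intro b hb
    by_contra hne
    exact hb (hs b ((PMF.mem_support_iff _ _).2 hne))

lemma expect_const {μ : PMF β} (hμ : μ.support.Finite) (c : ℝ) : expect μ (fun _ => c) = c := by
  have hs : ∀ b ∈ μ.support, b ∈ hμ.toFinset := fun b hb => hμ.mem_toFinset.2 hb
  rw [expect_eq_sum μ _ hs, ← Finset.sum_mul, sum_toReal_eq_one μ hs, one_mul]

lemma expect_add {μ : PMF β} (hμ : μ.support.Finite) (f g : β → ℝ) :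
    expect μ (fun b => f b + g b) = expect μ f + expect μ g := by
  have hs : ∀ b ∈ μ.support, b ∈ hμ.toFinset := fun b hb => hμ.mem_toFinset.2 hb
  simp only [expect_eq_sum μ _ hs, ← Finset.sum_add_distrib, mul_add]

lemma expect_const_mul (μ : PMF β) (c : ℝ) (f : β → ℝ) :
    expect μ (fun b => c * f b) = c * expect μ f := by
  unfold expect
  rw [← tsum_mul_left]
  exact tsum_congr fun b => by ring

lemma expect_sum {ι : Type} {μ : PMF β} (hμ : μ.support.Finite) (s : Finset ι)
    (f : ι → β → ℝ) : expect μ (fun b => ∑ i ∈ s, f i b) = ∑ i ∈ s, expect μ (f i) := by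
  have hs : ∀ b ∈ μ.support, b ∈ hμ.toFinset := fun b hb => hμ.mem_toFinset.2 hb
  simp only [expect_eq_sum μ _ hs, Finset.mul_sum]
  exact Finset.sum_comm

lemma expect_mono {μ : PMF β} (hμ : μ.support.Finite) {f g : β → ℝ}
    (h : ∀ b ∈ μ.support, f b ≤ g b) : expect μ f ≤ expect μ g := by
  have hs : ∀ b ∈ μ.support, b ∈ hμ.toFinset := fun b hb => hμ.mem_toFinset.2 hb
  rw [expect_eq_sum μ _ hs, expect_eq_sum μ _ hs]
  exact Finset.sum_le_sum fun b hb =>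
    mul_le_mul_of_nonneg_left (h b (hμ.mem_toFinset.1 hb)) ENNReal.toReal_nonneg

lemma expect_nonneg {μ : PMF β} (hμ : μ.support.Finite) {f : β → ℝ}
    (h : ∀ b ∈ μ.support, 0 ≤ f b) : 0 ≤ expect μ f := by
  rw [← expect_const hμ 0]
  exact expect_mono hμ h

lemma expect_pure (b : β) (f : β → ℝ) : expect (PMF.pure b) f = f b := by
  rw [expect_eq_sum (PMF.pure b) f (s := {b}) (by simp)]
  simp

lemma expect_bind {μ : PMF β} {κ : β → PMF δ} (hμ : μ.support.Finite)
    (hκ : ∀ b ∈ μ.support, (κ b).support.Finite) (f : δ → ℝ) :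
    expect (μ.bind κ) f = expect μ fun b => expect (κ b) f := by
  classical
  have hfin : (μ.bind κ).support.Finite := by
    rw [PMF.support_bind]
    exact hμ.biUnion hκ
  set s := hμ.toFinset
  set t := hfin.toFinset
  have hs : ∀ b ∈ μ.support, b ∈ s := fun b hb => hμ.mem_toFinset.2 hb
  have ht : ∀ b ∈ (μ.bind κ).support, b ∈ t := fun b hb => hfin.mem_toFinset.2 hb
  rw [expect_eq_sum _ _ ht, expect_eq_sum _ _ hs]
  have h1 : ∀ c, ((μ.bind κ) c).toReal = ∑ b ∈ s, (μ b).toReal * (κ b c).toReal := by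
    intro c
    rw [PMF.bind_apply, tsum_eq_sum (s := s), ENNReal.toReal_sum]
    · simp only [ENNReal.toReal_mul]
    · intro b _
      exact ENNReal.mul_ne_top (μ.apply_ne_top b) ((κ b).apply_ne_top c)
    · intro b hb
      have : μ b = 0 := by
        by_contra h
        exact hb (hs b ((PMF.mem_support_iff _ _).2 h))
      simp [this]
  have h2 : ∀ b ∈ s, expect (κ b) f = ∑ c ∈ t, (κ b c).toReal * f c := by
    intro b hb
    refine expect_eq_sum _ _ fun c hc => ht c ?_
    rw [PMF.mem_support_bind_iff]
    exact ⟨b, hμ.mem_toFinset.1 hb, hc⟩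
  have h3 : ∑ b ∈ s, (μ b).toReal * expect (κ b) f
      = ∑ b ∈ s, (μ b).toReal * ∑ c ∈ t, (κ b c).toReal * f c :=
    Finset.sum_congr rfl fun b hb => by rw [h2 b hb]
  rw [h3]
  simp only [h1, Finset.sum_mul, Finset.mul_sum]
  rw [Finset.sum_comm]
  simp only [mul_assoc]

lemma expect_map {μ : PMF β} (hμ : μ.support.Finite) (g : β → δ) (f : δ → ℝ) :
    expect (μ.map g) f = expect μ fun b => f (g b) := by
  change expect (μ.bind (PMF.pure ∘ g)) f = _
  rw [expect_bind hμ fun b _ => by simp]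
  simp only [Function.comp, expect_pure]

end expectation

/-! ### The channel -/

section channel

variable {N : ℕ} (q : Fin N → unitInterval)

lemma channelLaw_toReal (c : Fin N → Bool) :
    (channelLaw q c).toReal = ∏ u, (if c u then (q u : ℝ) else 1 - q u) := by
  unfold channelLaw
  rw [PMF.ofFintype_apply, ENNReal.toReal_prod]
  refine Finset.prod_congr rfl fun u _ => ?_
  split_ifs
  · exact ENNReal.toReal_ofReal (q u).2.1
  · exact ENNReal.toReal_ofReal (sub_nonneg.2 (q u).2.2)

lemma expect_channelLaw_prod (F : Fin N → Bool → ℝ) :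
    expect (channelLaw q) (fun c => ∏ u, F u (c u))
      = ∏ u, ((q u : ℝ) * F u true + (1 - q u) * F u false) := by
  classical
  rw [expect_eq_sum _ _ (s := Finset.univ) (by simp)]
  simp only [channelLaw_toReal, ← Finset.prod_mul_distrib]
  have h := Finset.prod_univ_sum (fun _ : Fin N => (Finset.univ : Finset Bool))
    (fun u b => (if b then (q u : ℝ) else 1 - q u) * F u b)
  rw [Fintype.piFinset_univ] at h
  rw [← h]
  refine Finset.prod_congr rfl fun u _ => ?_
  simp

lemma expect_channelLaw_single (u : Fin N) (G : Bool → ℝ) :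
    expect (channelLaw q) (fun c => G (c u)) = (q u : ℝ) * G true + (1 - q u) * G false := by
  classical
  have h := expect_channelLaw_prod q fun w b => if w = u then G b else 1
  have h1 : ∀ c : Fin N → Bool, ∏ w, (if w = u then G (c w) else 1) = G (c u) := fun c => by
    rw [Finset.prod_ite_eq' Finset.univ u fun w => G (c w)]
    simp
  have h2 : ∀ w, (q w : ℝ) * (if w = u then G true else 1)
      + (1 - q w) * (if w = u then G false else 1)
      = if w = u then (q w : ℝ) * G true + (1 - q w) * G false else 1 := by
    intro w
    split_ifs <;> ring
  simp only [h1, h2] at h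
  rw [h, Finset.prod_ite_eq' Finset.univ u]
  simp

lemma support_finite_of_fintype {β : Type} [Finite β] (μ : PMF β) : μ.support.Finite :=
  Set.toFinite _

/-- The centred success of user `u`. -/
def channelNoise (c : Fin N → Bool) (u : Fin N) : ℝ := (if c u then 1 else 0) - q u

lemma expect_channelNoise_mul (u v : Fin N) :
    expect (channelLaw q) (fun c => channelNoise q c u * channelNoise q c v)
      = if u = v then (q u : ℝ) * (1 - q u) else 0 := by
  classical
  split_ifs with huv
  · subst huv
    have := expect_channelLaw_single q u
      fun b => ((if b then (1 : ℝ) else 0) - q u) * ((if b then (1 : ℝ) else 0) - q u)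
    simp only [channelNoise]
    rw [this]
    simp
    ring
  · let X : Fin N → Bool → ℝ := fun w b => (if b then (1 : ℝ) else 0) - q w
    -- The test function is the centred success in the coordinates `u` and `v` and `1` elsewhere; by
    -- independence the covariance factors, and the factor of `u` has mean zero.
    have h := expect_channelLaw_prod q
      fun w b => (if w = u then X w b else 1) * (if w = v then X w b else 1)
    have h1 : ∀ c : Fin N → Bool,
        ∏ w, ((if w = u then X w (c w) else 1) * (if w = v then X w (c w) else 1))
          = channelNoise q c u * channelNoise q c v := fun c => by
      rw [Finset.prod_mul_distrib, Finset.prod_ite_eq' Finset.univ u,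
        Finset.prod_ite_eq' Finset.univ v]
      simp [X, channelNoise]
    simp only [h1] at h
    rw [h]
    refine Finset.prod_eq_zero (Finset.mem_univ u) ?_
    simp [huv, X]
    ring

/-- Uncorrelated terms, each of variance at most `1`. -/
lemma expect_sq_sum_channelNoise_le (B : Finset (Fin N)) :
    expect (channelLaw q) (fun c => (∑ u ∈ B, channelNoise q c u) ^ 2) ≤ N := by
  have h : ∀ c, (∑ u ∈ B, channelNoise q c u) ^ 2
      = ∑ u ∈ B, ∑ v ∈ B, channelNoise q c u * channelNoise q c v := fun c => by
    rw [sq, Finset.sum_mul_sum]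
  simp only [h]
  rw [expect_sum (support_finite_of_fintype _)]
  have h2 : ∀ u ∈ B, expect (channelLaw q)
      (fun c => ∑ v ∈ B, channelNoise q c u * channelNoise q c v) ≤ 1 := by
    intro u hu
    rw [expect_sum (support_finite_of_fintype _)]
    simp only [expect_channelNoise_mul]
    rw [Finset.sum_ite_eq B u, if_pos hu]
    nlinarith [(q u).2.1, (q u).2.2]
  refine (Finset.sum_le_sum h2).trans ?_
  simp only [Finset.sum_const, nsmul_eq_mul, mul_one]
  exact_mod_cast (Finset.card_le_univ B).trans (by simp)

end channel

/-! ### The controlled process -/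

section process

variable {N : ℕ} (q : Fin N → unitInterval) (π : Policy N) (s₀ : Ages N)

lemma historyLaw_support_finite (t : ℕ) : (historyLaw q π s₀ t).support.Finite := by
  induction t with
  | zero => simp [historyLaw]
  | succ t ih =>
    simp only [historyLaw, PMF.support_bind]
    refine ih.biUnion fun h _ => Set.Finite.biUnion (Set.toFinite _) fun A _ => ?_
    rw [PMF.support_map]
    exact (Set.toFinite _).image _

lemma expect_historyLaw_succ (t : ℕ) (F : History N → ℝ) :
    expect (historyLaw q π s₀ (t + 1)) F
      = expect (historyLaw q π s₀ t) fun h => expect (π h) fun A =>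
          expect (channelLaw q) fun c => F ((h.2, A) :: h.1, nextAges h.2 A c) := by
  have hfin : ∀ h : History N, ∀ A : Finset (Fin N), ((channelLaw q).map fun c =>
      (((h.2, A) :: h.1, nextAges h.2 A c) : History N)).support.Finite := fun h A => by
    rw [PMF.support_map]
    exact (Set.toFinite _).image _
  change expect (PMF.bind _ _) F = _
  rw [expect_bind (historyLaw_support_finite q π s₀ t) fun h _ => by
    rw [PMF.support_bind]
    exact Set.Finite.biUnion (Set.toFinite _) fun A _ => hfin h A]
  congr 1
  funext h
  rw [expect_bind (support_finite_of_fintype _) fun A _ => hfin h A]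
  congr 1
  funext A
  rw [expect_map (support_finite_of_fintype _)]

lemma mem_support_historyLaw_succ {t : ℕ} {h' : History N}
    (hh : h' ∈ (historyLaw q π s₀ (t + 1)).support) :
    ∃ h ∈ (historyLaw q π s₀ t).support, ∃ A ∈ (π h).support, ∃ c : Fin N → Bool,
      h' = ((h.2, A) :: h.1, nextAges h.2 A c) := by
  simp only [historyLaw, PMF.mem_support_bind_iff, PMF.mem_support_map_iff] at hh
  obtain ⟨h, hh, A, hA, c, -, rfl⟩ := hh
  exact ⟨h, hh, A, hA, c, rfl⟩

lemma one_le_age_of_mem_support (hs₀ : ∀ u, 1 ≤ s₀ u) {t : ℕ} {h : History N}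
    (hh : h ∈ (historyLaw q π s₀ t).support) (u : Fin N) : 1 ≤ h.2 u := by
  cases t with
  | zero =>
    simp only [historyLaw, PMF.support_pure, Set.mem_singleton_iff] at hh
    exact hh ▸ hs₀ u
  | succ t =>
    obtain ⟨h, -, A, -, c, rfl⟩ := mem_support_historyLaw_succ q π s₀ hh
    simp only [nextAges]
    split_ifs <;> omega

/-- One step of an additive functional of the ages. -/
lemma expect_channelLaw_additive (φ : Fin N → ℕ → ℝ) (s : Ages N) (A : Finset (Fin N)) :
    expect (channelLaw q) (fun c => ∑ u, φ u (nextAges s A c u))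
      = ∑ u, (if u ∈ A then (q u : ℝ) * φ u 1 + (1 - q u) * φ u (s u + 1)
          else φ u (s u + 1)) := by
  rw [expect_sum (support_finite_of_fintype _)]
  refine Finset.sum_congr rfl fun u _ => ?_
  unfold nextAges
  split_ifs with hu
  · have := expect_channelLaw_single q u fun b => φ u (if b = true then 1 else s u + 1)
    simpa [hu] using this
  · simp only [hu, false_and, if_false]
    exact expect_const (support_finite_of_fintype _) _

/-- The expectation of an additive functional of the ages at time `t`. -/
def additiveMean (φ : Fin N → ℕ → ℝ) (t : ℕ) : ℝ :=
  expect (historyLaw q π s₀ t) fun h => ∑ u, φ u (h.2 u)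

/-- The expectation, at time `t`, of a sum over the users of a function of the age and of the
decision. -/
def decisionMean (ψ : Fin N → ℕ → Prop → ℝ) (t : ℕ) : ℝ :=
  expect (historyLaw q π s₀ t) fun h => expect (π h) fun A => ∑ u, ψ u (h.2 u) (u ∈ A)

open Classical in
lemma additiveMean_succ (φ : Fin N → ℕ → ℝ) (t : ℕ) :
    additiveMean q π s₀ φ (t + 1) = decisionMean q π s₀
      (fun u i d => if d then (q u : ℝ) * φ u 1 + (1 - q u) * φ u (i + 1) else φ u (i + 1)) t := by
  unfold additiveMean decisionMean
  rw [expect_historyLaw_succ]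
  congr 1
  funext h
  congr 1
  funext A
  rw [expect_channelLaw_additive]
  exact Finset.sum_congr rfl fun u _ => by congr

lemma additiveMean_eq_decisionMean (φ : Fin N → ℕ → ℝ) (t : ℕ) :
    additiveMean q π s₀ φ t = decisionMean q π s₀ (fun u i _ => φ u i) t := by
  unfold additiveMean decisionMean
  congr 1
  funext h
  exact (expect_const (support_finite_of_fintype _) _).symm

lemma decisionMean_add (ψ ψ' : Fin N → ℕ → Prop → ℝ) (t : ℕ) :
    decisionMean q π s₀ (fun u i d => ψ u i d + ψ' u i d) t
      = decisionMean q π s₀ ψ t + decisionMean q π s₀ ψ' t := by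
  unfold decisionMean
  rw [← expect_add (historyLaw_support_finite q π s₀ t)]
  congr 1
  funext h
  rw [← expect_add (support_finite_of_fintype _)]
  simp only [Finset.sum_add_distrib]

lemma decisionMean_const_mul (c : ℝ) (ψ : Fin N → ℕ → Prop → ℝ) (t : ℕ) :
    decisionMean q π s₀ (fun u i d => c * ψ u i d) t = c * decisionMean q π s₀ ψ t := by
  unfold decisionMean
  simp only [← expect_const_mul, Finset.mul_sum]

lemma decisionMean_const (c : Fin N → ℝ) (t : ℕ) :
    decisionMean q π s₀ (fun u _ _ => c u) t = ∑ u, c u := by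
  unfold decisionMean
  simp only [expect_const (support_finite_of_fintype _)]
  exact expect_const (historyLaw_support_finite q π s₀ t) _

lemma decisionMean_congr (hs₀ : ∀ u, 1 ≤ s₀ u) {ψ ψ' : Fin N → ℕ → Prop → ℝ}
    (h : ∀ u i d, 1 ≤ i → ψ u i d = ψ' u i d) (t : ℕ) :
    decisionMean q π s₀ ψ t = decisionMean q π s₀ ψ' t := by
  refine expect_congr fun b hb => ?_
  congr 1
  funext A
  exact Finset.sum_congr rfl fun u _ => h u _ _ (one_le_age_of_mem_support q π s₀ hs₀ hb u)

lemma decisionMean_nonneg (hs₀ : ∀ u, 1 ≤ s₀ u) {ψ : Fin N → ℕ → Prop → ℝ}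
    (h : ∀ u i d, 1 ≤ i → 0 ≤ ψ u i d) (t : ℕ) : 0 ≤ decisionMean q π s₀ ψ t :=
  expect_nonneg (historyLaw_support_finite q π s₀ t) fun _ hb =>
    expect_nonneg (support_finite_of_fintype _) fun _ _ =>
      Finset.sum_nonneg fun u _ => h u _ _ (one_le_age_of_mem_support q π s₀ hs₀ hb u)

open Classical in
/-- The expected number of users scheduled at time `t`. -/
lemma scheduled_eq_decisionMean (t : ℕ) :
    (expect (historyLaw q π s₀ t) fun h => expect (π h) fun A => (A.card : ℝ))
      = decisionMean q π s₀ (fun _ _ d => if d then 1 else 0) t := by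
  unfold decisionMean
  congr 1
  funext h
  congr 1
  funext A
  have hA : (A.card : ℝ) = ∑ u, if u ∈ A then (1 : ℝ) else 0 := by
    rw [Finset.sum_ite_mem]
    simp
  rw [hA]
  refine Finset.sum_congr rfl fun u _ => ?_
  by_cases hu : u ∈ A <;> simp [hu]

end process

/-! ### The relaxed problem -/

/-! ### Time averages under a telescoping recursion -/

section averages

variable {e a H : ℕ → ℝ} {c W G r : ℝ}

lemma sum_range_eq_of_step {D : ℕ → ℝ} (hstep : ∀ t, H (t + 1) + e t + W * a t = G + H t + D t)
    (T : ℕ) : ∑ t ∈ Finset.range T, e t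
      = T * G + H 0 - H T - W * ∑ t ∈ Finset.range T, a t + ∑ t ∈ Finset.range T, D t := by
  induction T with
  | zero => simp
  | succ T ih =>
    simp only [Finset.sum_range_succ, ih]
    push_cast
    linarith [hstep T]

/-- A lower bound on the long-run cost from the dual inequality. -/
lemma le_limsup_average {D : ℕ → ℝ} (he : ∀ t, 0 ≤ e t) (hc : 0 ≤ c) (hH : ∀ t, H t ≤ c * e t)
    (hD : ∀ t, 0 ≤ D t) (hW : 0 ≤ W)
    (hstep : ∀ t, H (t + 1) + e t + W * a t = G + H t + D t)
    (ha : limsup (fun T : ℕ => (((T : ℝ)⁻¹ * ∑ t ∈ Finset.range T, a t : ℝ) : EReal)) atTop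
      ≤ (r : EReal)) :
    ((G - W * r : ℝ) : EReal)
      ≤ limsup (fun T : ℕ => (((T : ℝ)⁻¹ * ∑ t ∈ Finset.range T, e t : ℝ) : EReal)) atTop := by
  by_contra hlt
  push Not at hlt
  obtain ⟨b, hb1, hb2⟩ := EReal.lt_iff_exists_real_btwn.1 hlt
  rw [EReal.coe_lt_coe_iff] at hb2
  -- Half of the assumed deficit absorbs the error `W * d` in the asymptotic constraint; the other
  -- half remains as a linear drift.
  set κ := (G - W * r - b) / 2 with hκ
  have hκ0 : 0 < κ := by rw [hκ]; linarith
  set d := κ / (W + 1) with hd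
  have hd0 : 0 < d := by positivity
  have hWd : W * d ≤ κ := by
    rw [hd, ← mul_div_assoc, div_le_iff₀ (by linarith)]
    nlinarith
  have h1 := eventually_lt_of_limsup_lt hb1
  have h2 := eventually_lt_of_limsup_lt
    (lt_of_le_of_lt ha (EReal.coe_lt_coe_iff.2 (by linarith : r < r + d)))
  simp only [EReal.coe_lt_coe_iff] at h1 h2
  have hb0 : 0 ≤ b := by
    obtain ⟨T, hT⟩ := h1.exists
    exact le_trans (mul_nonneg (by positivity) (Finset.sum_nonneg fun t _ => he t)) hT.le
  obtain ⟨T₁, hT₁⟩ := eventually_atTop.1 (h1.and (h2.and (eventually_gt_atTop 0)))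
  have hS : ∀ T ≥ T₁, ∑ t ∈ Finset.range T, e t ≤ b * T := by
    intro T hT
    obtain ⟨h, -, hpos⟩ := hT₁ T hT
    have hpos' : (0 : ℝ) < T := by exact_mod_cast hpos
    rw [inv_mul_lt_iff₀ hpos'] at h
    linarith
  have hA : ∀ T ≥ T₁, ∑ t ∈ Finset.range T, a t ≤ (r + d) * T := by
    intro T hT
    obtain ⟨-, h, hpos⟩ := hT₁ T hT
    have hpos' : (0 : ℝ) < T := by exact_mod_cast hpos
    rw [inv_mul_lt_iff₀ hpos'] at h
    linarith
  -- The boundary term `H T` may be as large as `c * e T`, so it cannot be dropped. A deficit would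
  -- force it to grow linearly, hence also the cost `e T`, whose sums could then not stay below `b *
  -- T`.
  have hHT : ∀ T ≥ T₁, κ * T + H 0 ≤ c * e T := by
    intro T hT
    have hsum := sum_range_eq_of_step hstep T
    have hD' : 0 ≤ ∑ t ∈ Finset.range T, D t := Finset.sum_nonneg fun t _ => hD t
    have hT0 : (0 : ℝ) ≤ T := Nat.cast_nonneg T
    have h3 := mul_le_mul_of_nonneg_left (hA T hT) hW
    have h4 := hS T hT
    have h5 := mul_le_mul_of_nonneg_right hWd hT0
    have h6 : κ * T * 2 = (G - W * r - b) * T := by rw [hκ]; ring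
    refine le_trans ?_ (hH T)
    nlinarith
  obtain ⟨T₂, hT₂⟩ := exists_nat_ge ((c * (b + 1) - H 0) / κ)
  rw [div_le_iff₀ hκ0] at hT₂
  have hbig : ∀ T ≥ max T₁ T₂, b + 1 ≤ e T := by
    intro T hT
    have h3 := hHT T (le_trans (le_max_left _ _) hT)
    have h4 : (T₂ : ℝ) ≤ T := by exact_mod_cast le_trans (le_max_right _ _) hT
    by_contra hlt'
    push Not at hlt'
    -- For `c = 0` the drift bound is already contradictory, at `T + 1` because the inequality must
    -- be strict.
    rcases hc.eq_or_lt with hc0 | hc0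
    · rw [← hc0] at h3 hT₂
      have h5 := hHT (T + 1) (le_trans (le_trans (le_max_left _ _) hT) (Nat.le_succ T))
      rw [← hc0] at h5
      push_cast at h5
      nlinarith
    · nlinarith
  set T₃ := max T₁ T₂
  -- The sum up to `T₃ + T₄` is at least `T₄ (b + 1)` and at most `b (T₃ + T₄)`, which forces `T₄ ≤
  -- b T₃`.
  obtain ⟨T₄, hT₄⟩ := exists_nat_gt ((b + 1) * T₃)
  have hsum : ∑ t ∈ Finset.range (T₃ + T₄), e t ≥ T₄ * (b + 1) := by
    rw [Finset.sum_range_add]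
    have h3 : 0 ≤ ∑ t ∈ Finset.range T₃, e t := Finset.sum_nonneg fun t _ => he t
    have h4 : ∑ _t ∈ Finset.range T₄, (b + 1) ≤ ∑ t ∈ Finset.range T₄, e (T₃ + t) :=
      Finset.sum_le_sum fun t _ => hbig _ (Nat.le_add_right _ _)
    rw [Finset.sum_const, Finset.card_range, nsmul_eq_mul] at h4
    linarith
  have hle := hS (T₃ + T₄) (le_trans (le_max_left _ _) (Nat.le_add_right _ _))
  push_cast at hle
  nlinarith [(Nat.cast_nonneg T₃ : (0 : ℝ) ≤ T₃)]

/-- An upper bound on the long-run cost when the dual inequality is tight. -/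
lemma limsup_average_le (hH : ∀ t, 0 ≤ H t)
    (hstep : ∀ t, H (t + 1) + e t + W * a t = G + H t)
    (ha : Tendsto (fun T : ℕ => (T : ℝ)⁻¹ * ∑ t ∈ Finset.range T, a t) atTop (𝓝 r)) :
    limsup (fun T : ℕ => (((T : ℝ)⁻¹ * ∑ t ∈ Finset.range T, e t : ℝ) : EReal)) atTop
      ≤ ((G - W * r : ℝ) : EReal) := by
  have hlim : Tendsto (fun T : ℕ => G + (T : ℝ)⁻¹ * H 0
      - W * ((T : ℝ)⁻¹ * ∑ t ∈ Finset.range T, a t)) atTop (𝓝 (G + 0 * H 0 - W * r)) :=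
    ((tendsto_const_nhds.add (tendsto_inv_atTop_nhds_zero_nat.mul_const _)).sub
      (ha.const_mul W))
  rw [zero_mul, add_zero] at hlim
  have hlim' := (continuous_coe_real_ereal.tendsto _).comp hlim
  refine (limsup_le_limsup ?_).trans_eq hlim'.limsup_eq
  filter_upwards [eventually_gt_atTop 0] with T hT
  simp only [Function.comp, EReal.coe_le_coe_iff]
  have hT' : (0 : ℝ) < T := by exact_mod_cast hT
  have hsum := sum_range_eq_of_step (D := fun _ => 0) (by simpa using hstep) T
  rw [hsum]
  have h1 : (T : ℝ)⁻¹ * (T * G + H 0 - H T - W * ∑ t ∈ Finset.range T, a t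
      + ∑ _t ∈ Finset.range T, (0 : ℝ))
      = G + (T : ℝ)⁻¹ * H 0 - W * ((T : ℝ)⁻¹ * ∑ t ∈ Finset.range T, a t) - (T : ℝ)⁻¹ * H T := by
    field_simp
    simp
    ring
  rw [h1]
  have := mul_nonneg (inv_nonneg.2 hT'.le) (hH T)
  linarith

/-- Averages converge when they telescope up to a bounded term. -/
lemma tendsto_average_of_bounded {F : ℕ → ℝ} (hF : ∀ t, |F t| ≤ c)
    (hstep : ∀ t, F (t + 1) + a t = r + F t) :
    Tendsto (fun T : ℕ => (T : ℝ)⁻¹ * ∑ t ∈ Finset.range T, a t) atTop (𝓝 r) := by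
  have hsum : ∀ T : ℕ, ∑ t ∈ Finset.range T, a t = T * r + (F 0 - F T) := by
    intro T
    induction T with
    | zero => simp
    | succ T ih =>
      rw [Finset.sum_range_succ, ih]
      push_cast
      linarith [hstep T]
  have hz : Tendsto (fun T : ℕ => (T : ℝ)⁻¹ * (F 0 - F T)) atTop (𝓝 0) := by
    refine squeeze_zero_norm (a := fun T : ℕ => (T : ℝ)⁻¹ * (c + c)) (fun T => ?_) ?_
    · rw [norm_mul, Real.norm_eq_abs, abs_of_nonneg (by positivity : (0 : ℝ) ≤ (T : ℝ)⁻¹)]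
      exact mul_le_mul_of_nonneg_left ((abs_sub _ _).trans (add_le_add (hF 0) (hF T)))
        (by positivity)
    · simpa using tendsto_inv_atTop_nhds_zero_nat.mul_const (c + c)
  have := (tendsto_const_nhds (x := r)).add hz
  rw [add_zero] at this
  refine this.congr' ?_
  filter_upwards [eventually_gt_atTop 0] with T hT
  have hT' : (T : ℝ) ≠ 0 := by positivity
  rw [hsum]
  field_simp

end averages

/-! ### Lower bound and attainment in the relaxed problem -/

section relaxed

variable {N : ℕ} (p : Fin 2 → unitInterval) (cls : Fin N → Fin 2) (π : Policy N) (s₀ : Ages N)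

lemma sum_over_users {γ : Fin 2 → ℝ}
    (hcls : ∀ k, ((Finset.univ.filter fun u => cls u = k).card : ℝ) = γ k * N) (G : Fin 2 → ℝ) :
    ∑ u, G (cls u) = N * ∑ k, γ k * G k := by
  rw [← Finset.sum_fiberwise Finset.univ cls, Finset.mul_sum]
  refine Finset.sum_congr rfl fun k _ => ?_
  rw [Finset.sum_congr rfl (g := fun _ => G k) fun u hu => by rw [(Finset.mem_filter.1 hu).2],
    Finset.sum_const, nsmul_eq_mul, hcls]
  ring

/-- The relative value of user `u` at age `i`. -/
def userValue (W : ℝ) (u : Fin N) (i : ℕ) : ℝ :=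
  relValue (p (cls u)) (lowerThreshold (p (cls u)) W) W i

open Classical in
/-- The loss of a decision for user `u` at age `i`. -/
def userGap (W : ℝ) (u : Fin N) (i : ℕ) (d : Prop) : ℝ :=
  if d then activeGap (p (cls u)) (lowerThreshold (p (cls u)) W) W i
  else passiveGap (p (cls u)) (lowerThreshold (p (cls u)) W) W i

lemma userGap_nonneg (hp : ∀ k, 0 < (p k : ℝ)) {W : ℝ} (hW : 1 ≤ W) (u : Fin N) (i : ℕ)
    (d : Prop) : 0 ≤ userGap p cls W u i d := by
  unfold userGap
  split_ifs
  · exact activeGap_nonneg (hp _) (p _).2.2 (one_le_lowerThreshold _ _)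
      (lowerThreshold_sub_one_index_le hp hW _) i
  · exact passiveGap_nonneg (hp _) (one_le_lowerThreshold _ _)
      (lowerThreshold_index_le (hp _).le (zero_lt_one.trans_le hW)) i

open Classical in
-- The Bellman identity summed over the users. The gaps record by how much each decision misses
-- optimality, so it is an equality for every policy.
lemma userValue_step (hs₀ : ∀ u, 1 ≤ s₀ u) (W : ℝ) (t : ℕ) :
    additiveMean (fun u => p (cls u)) π s₀ (userValue p cls W) (t + 1)
      + additiveMean (fun u => p (cls u)) π s₀ (fun _ i => (i : ℝ)) t
      + W * decisionMean (fun u => p (cls u)) π s₀ (fun _ _ d => if d then 1 else 0) t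
    = ∑ u, classGain p W (cls u)
      + additiveMean (fun u => p (cls u)) π s₀ (userValue p cls W) t
      + decisionMean (fun u => p (cls u)) π s₀ (userGap p cls W) t := by
  rw [additiveMean_succ, additiveMean_eq_decisionMean, additiveMean_eq_decisionMean,
    ← decisionMean_const_mul, ← decisionMean_const (fun u => p (cls u)) π s₀ _ t,
    ← decisionMean_add, ← decisionMean_add, ← decisionMean_add, ← decisionMean_add]
  refine decisionMean_congr _ _ _ hs₀ (fun u i d _ => ?_) t
  have h1 : userValue p cls W u 1 = 0 := relValue_one (one_le_lowerThreshold _ _)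
  rw [h1]
  unfold userGap classGain userValue activeGap passiveGap
  split_ifs <;> ring

lemma longRunAge_eq (q : Fin N → unitInterval) : longRunAge q π s₀
    = limsup (fun T : ℕ => (((T : ℝ)⁻¹ * ∑ t ∈ Finset.range T,
      additiveMean q π s₀ (fun _ i => (i : ℝ)) t : ℝ) : EReal)) atTop := rfl

open Classical in
lemma longRunScheduled_eq (q : Fin N → unitInterval) : longRunScheduled q π s₀
    = limsup (fun T : ℕ => (((T : ℝ)⁻¹ * ∑ t ∈ Finset.range T,
      decisionMean q π s₀ (fun _ _ d => if d then 1 else 0) t : ℝ) : EReal)) atTop := by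
  unfold longRunScheduled
  simp only [scheduled_eq_decisionMean]

/-- Every policy that meets the relaxed constraint costs at least the dual value. -/
theorem le_longRunAge (hp : ∀ k, 0 < (p k : ℝ)) {W : ℝ} (hW : 1 ≤ W) (hs₀ : ∀ u, 1 ≤ s₀ u)
    {r : ℝ} (hr : longRunScheduled (fun u => p (cls u)) π s₀ ≤ (r : EReal)) :
    ((∑ u, classGain p W (cls u) - W * r : ℝ) : EReal)
      ≤ longRunAge (fun u => p (cls u)) π s₀ := by
  rw [longRunAge_eq]
  rw [longRunScheduled_eq] at hr
  choose c hc0 hc using fun k => exists_relValue_le (p k) (lowerThreshold (p k) W) W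
  refine le_limsup_average (c := c 0 + c 1)
    (H := additiveMean (fun u => p (cls u)) π s₀ (userValue p cls W)) (fun t => ?_)
    (add_nonneg (hc0 0) (hc0 1)) (fun t => ?_) (fun t => ?_) (by linarith)
    (userValue_step p cls π s₀ hs₀ W) hr
  · exact expect_nonneg (historyLaw_support_finite _ _ _ t) fun h _ =>
      Finset.sum_nonneg fun u _ => Nat.cast_nonneg _
  · unfold additiveMean
    rw [← expect_const_mul]
    refine expect_mono (historyLaw_support_finite _ _ _ t) fun h hh => ?_
    rw [Finset.mul_sum]
    refine Finset.sum_le_sum fun u _ => ?_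
    have h1 := one_le_age_of_mem_support _ _ _ hs₀ hh u
    refine (le_abs_self _).trans ((hc (cls u) _ h1).trans ?_)
    refine mul_le_mul_of_nonneg_right ?_ (Nat.cast_nonneg _)
    rcases cls u with ⟨_ | _ | k, hk⟩
    · simpa using hc0 1
    · simpa using hc0 0
    · omega
  · exact decisionMean_nonneg _ _ _ hs₀ (fun u i d _ => userGap_nonneg p cls hp hW u i d) t

/-! #### A randomised stationary policy that attains the dual value -/

/-- The probability of scheduling at the marginal age. -/
def marginalProb (p : Fin 2 → unitInterval) (W θ : ℝ) (k : Fin 2) : ℝ :=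
  (1 + p k * lowerThreshold (p k) W - 1 / mixedRate p W θ k) / p k

/-- The probability of scheduling a user of class `k` at age `i`. -/
def scheduleProb (p : Fin 2 → unitInterval) (W θ : ℝ) (k : Fin 2) (i : ℕ) : ℝ :=
  if i < lowerThreshold (p k) W then 0
  else if i = lowerThreshold (p k) W then marginalProb p W θ k else 1

variable {p} {W θ : ℝ}

/-- Scheduling with probability `β` at the lower threshold `l` gives a rate `r` with `1 / r = l p +
1 - p + p (1 - β)`, which is solved for `β`. That `β` lies in `[0, 1]` means that `r` lies between
the rates of the thresholds `l + 1` and `l`. -/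
lemma marginalProb_mem (hp : ∀ k, 0 < (p k : ℝ)) (hW : 1 ≤ W) (h0 : 0 ≤ θ) (h1 : θ ≤ 1)
    (k : Fin 2) : 0 ≤ marginalProb p W θ k ∧ marginalProb p W θ k ≤ 1 := by
  have hr := mixedRate_pos hp hW h0 h1 k
  obtain ⟨hl, hu⟩ := mixedRate_births hp hW h0 h1 k
  have hle : ((upperThreshold (p k) W : ℕ) : ℝ) ≤ lowerThreshold (p k) W + 1 := by
    rcases upperThreshold_eq_or (hp k).le (zero_lt_one.trans_le hW) with h | ⟨h, -⟩ <;>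
      rw [h] <;> push_cast <;> linarith
  have hpr : 0 < (p k : ℝ) * mixedRate p W θ k := mul_pos (hp k) hr
  unfold marginalProb
  constructor
  · refine div_nonneg ?_ (hp k).le
    rw [sub_nonneg, div_le_iff₀ hr]
    nlinarith
  · rw [div_le_one (hp k), sub_le_iff_le_add, ← sub_le_iff_le_add', le_div_iff₀ hr]
    nlinarith

lemma marginalProb_eq_one (hp : ∀ k, 0 < (p k : ℝ)) {k : Fin 2}
    (h : upperThreshold (p k) W = lowerThreshold (p k) W) : marginalProb p W θ k = 1 := by
  have hr : mixedRate p W θ k = thresholdRate (p k) (lowerThreshold (p k) W) := by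
    unfold mixedRate
    rw [h]
    ring
  unfold marginalProb
  rw [hr, thresholdRate, one_div_one_div, div_eq_one_iff_eq (hp k).ne']
  ring

lemma scheduleProb_mem (hp : ∀ k, 0 < (p k : ℝ)) (hW : 1 ≤ W) (h0 : 0 ≤ θ) (h1 : θ ≤ 1)
    (k : Fin 2) (i : ℕ) : scheduleProb p W θ k i ∈ unitInterval := by
  unfold scheduleProb
  split_ifs
  · exact unitInterval.zero_mem
  · exact marginalProb_mem hp hW h0 h1 k
  · exact unitInterval.one_mem

/-- Complementary slackness: the policy acts, or waits, with positive probability only where this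
costs nothing. -/
lemma scheduleProb_gap (hp : ∀ k, 0 < (p k : ℝ)) (hW : 1 ≤ W) (k : Fin 2) (i : ℕ) :
    scheduleProb p W θ k i * activeGap (p k) (lowerThreshold (p k) W) W i
      + (1 - scheduleProb p W θ k i) * passiveGap (p k) (lowerThreshold (p k) W) W i = 0 := by
  have hl := one_le_lowerThreshold (p k) W
  unfold scheduleProb
  split_ifs with h1 h2
  · rw [passiveGap_of_lt h1]
    ring
  · rw [activeGap_of_ge (hp k) hl h2.ge]
    rcases upperThreshold_eq_or (hp k).le (zero_lt_one.trans_le hW) with h | ⟨h, h'⟩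
    · rw [marginalProb_eq_one hp h]
      ring
    · rw [passiveGap_eq_zero hp hW k (by omega)]
      ring
  · rw [activeGap_of_ge (hp k) hl (not_lt.1 h1)]
    ring

/-- The relative value of the scheduled rate. -/
def rateValue (p : Fin 2 → unitInterval) (W θ : ℝ) (k : Fin 2) (i : ℕ) : ℝ :=
  if i ≤ lowerThreshold (p k) W then ((i : ℝ) - 1) * mixedRate p W θ k
  else (1 - mixedRate p W θ k) / p k

/-- The Poisson equation for the number of attempts. Its solution is bounded, so the long-run rate
follows by telescoping, without ergodic theory; the case `i = lowerThreshold` is the defining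
equation of `marginalProb`. -/
lemma rateValue_step (hp : ∀ k, 0 < (p k : ℝ)) (hW : 1 ≤ W) (h0 : 0 ≤ θ) (h1 : θ ≤ 1)
    (k : Fin 2) (i : ℕ) :
    scheduleProb p W θ k i
      * (p k * rateValue p W θ k 1 + (1 - p k) * rateValue p W θ k (i + 1) + 1)
      + (1 - scheduleProb p W θ k i) * rateValue p W θ k (i + 1)
      = mixedRate p W θ k + rateValue p W θ k i := by
  have hr := mixedRate_pos hp hW h0 h1 k
  have hpk := hp k
  have hone : rateValue p W θ k 1 = 0 := by
    unfold rateValue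
    rw [if_pos (one_le_lowerThreshold _ _)]
    simp
  rw [hone]
  unfold scheduleProb rateValue
  rcases lt_trichotomy i (lowerThreshold (p k) W) with h | h | h
  · rw [if_pos h, if_pos h.le, if_pos (Nat.succ_le_of_lt h)]
    push_cast
    ring
  · rw [if_neg h.not_lt, if_pos h, if_pos h.le, if_neg (by omega), h]
    unfold marginalProb
    field_simp
    ring
  · rw [if_neg h.not_gt, if_neg h.ne', if_neg h.not_ge, if_neg (by omega)]
    field_simp
    ring

lemma exists_rateValue_le (k : Fin 2) : ∃ c, ∀ i, |rateValue p W θ k i| ≤ c := by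
  refine ⟨(lowerThreshold (p k) W + 1) * |mixedRate p W θ k|
    + |(1 - mixedRate p W θ k) / p k|, fun i => ?_⟩
  unfold rateValue
  split_ifs with h
  · have h2 : (i : ℝ) ≤ lowerThreshold (p k) W := by exact_mod_cast h
    have h3 : |(i : ℝ) - 1| ≤ lowerThreshold (p k) W + 1 := by
      rw [abs_le]
      constructor <;> linarith [(Nat.cast_nonneg i : (0 : ℝ) ≤ i)]
    rw [abs_mul]
    have := mul_le_mul_of_nonneg_right h3 (abs_nonneg (mixedRate p W θ k))
    linarith [abs_nonneg ((1 - mixedRate p W θ k) / p k)]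
  · have : 0 ≤ ((lowerThreshold (p k) W : ℝ) + 1) * |mixedRate p W θ k| := by positivity
    linarith

/-- The stationary policy that schedules the users independently with the probabilities
`scheduleProb`. -/
def stationaryPolicy (σ : Fin N → ℕ → unitInterval) : Policy N := fun h =>
  (channelLaw fun u => σ u (h.2 u)).map fun c => Finset.univ.filter fun u => c u = true

lemma decisionMean_stationaryPolicy (q : Fin N → unitInterval) (σ : Fin N → ℕ → unitInterval)
    (ψ : Fin N → ℕ → Prop → ℝ) (t : ℕ) :
    decisionMean q (stationaryPolicy σ) s₀ ψ t
      = additiveMean q (stationaryPolicy σ) s₀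
        (fun u i => (σ u i : ℝ) * ψ u i True + (1 - σ u i) * ψ u i False) t := by
  unfold decisionMean additiveMean
  congr 1
  funext h
  conv_lhs => rw [stationaryPolicy]
  rw [expect_map (support_finite_of_fintype _), expect_sum (support_finite_of_fintype _)]
  refine Finset.sum_congr rfl fun u _ => ?_
  have := expect_channelLaw_single (fun u => σ u (h.2 u)) u fun b => ψ u (h.2 u) (b = true)
  simpa using this

/-- The dual value is attained. -/
theorem exists_policy_longRunAge_le (hp : ∀ k, 0 < (p k : ℝ)) (hW : 1 ≤ W) (h0 : 0 ≤ θ)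
    (h1 : θ ≤ 1) (hs₀ : ∀ u, 1 ≤ s₀ u) :
    ∃ π : Policy N,
      longRunScheduled (fun u => p (cls u)) π s₀
        = ((∑ u, mixedRate p W θ (cls u) : ℝ) : EReal) ∧
      longRunAge (fun u => p (cls u)) π s₀
        ≤ ((∑ u, classGain p W (cls u) - W * ∑ u, mixedRate p W θ (cls u) : ℝ) : EReal) := by
  classical
  let σ : Fin N → ℕ → unitInterval :=
    fun u i => ⟨scheduleProb p W θ (cls u) i, scheduleProb_mem hp hW h0 h1 _ i⟩
  have hrate : Tendsto (fun T : ℕ => (T : ℝ)⁻¹ * ∑ t ∈ Finset.range T,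
      decisionMean (fun u => p (cls u)) (stationaryPolicy σ) s₀
        (fun _ _ d => if d then 1 else 0) t) atTop (𝓝 (∑ u, mixedRate p W θ (cls u))) := by
    choose c hc using fun k => exists_rateValue_le (p := p) (W := W) (θ := θ) k
    refine tendsto_average_of_bounded (c := ∑ u, c (cls u))
      (F := additiveMean (fun u => p (cls u)) (stationaryPolicy σ) s₀
        fun u i => rateValue p W θ (cls u) i) (fun t => ?_) fun t => ?_
    · have hfin := historyLaw_support_finite (fun u => p (cls u)) (stationaryPolicy σ) s₀ t
      rw [abs_le]
      unfold additiveMean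
      constructor
      · rw [← expect_const hfin (-∑ u, c (cls u)), ← Finset.sum_neg_distrib]
        exact expect_mono hfin fun h _ => Finset.sum_le_sum fun u _ => (abs_le.1 (hc _ _)).1
      · refine le_trans (expect_mono hfin fun h _ =>
          Finset.sum_le_sum fun u _ => (abs_le.1 (hc _ _)).2) (expect_const hfin _).le
    · rw [additiveMean_succ, ← decisionMean_add, decisionMean_stationaryPolicy]
      rw [← decisionMean_const (fun u => p (cls u)) (stationaryPolicy σ) s₀ _ t,
        additiveMean_eq_decisionMean, additiveMean_eq_decisionMean, ← decisionMean_add]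
      refine decisionMean_congr _ _ _ hs₀ (fun u i d _ => ?_) t
      have := rateValue_step hp hW h0 h1 (cls u) i
      simp only [σ, if_true, if_false, add_zero]
      exact this
  refine ⟨stationaryPolicy σ, ?_, ?_⟩
  · rw [longRunScheduled_eq]
    exact ((continuous_coe_real_ereal.tendsto _).comp hrate).limsup_eq
  · rw [longRunAge_eq]
    refine limsup_average_le
      (H := additiveMean (fun u => p (cls u)) (stationaryPolicy σ) s₀ (userValue p cls W))
      (fun t => ?_) (fun t => ?_) hrate
    · refine expect_nonneg (historyLaw_support_finite _ _ _ t) fun h hh =>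
        Finset.sum_nonneg fun u _ => ?_
      exact relValue_nonneg (hp _) (p _).2.2 (one_le_lowerThreshold _ _)
        (lowerThreshold_sub_one_index_le hp hW _) (one_le_age_of_mem_support _ _ _ hs₀ hh u)
    · rw [userValue_step p cls _ s₀ hs₀ W t, decisionMean_stationaryPolicy,
        additiveMean_eq_decisionMean _ _ _ (fun u i => _ * _ + _)]
      rw [decisionMean_congr _ _ _ hs₀ (ψ' := fun _ _ _ => 0), decisionMean_const]
      · simp
      · intro u i d _
        have := scheduleProb_gap (θ := θ) hp hW (cls u) i
        simp only [σ, userGap, if_true, if_false]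
        exact this

/-- The value of the relaxed problem. -/
theorem isLeast_relaxedCosts {γ : Fin 2 → ℝ} {α : ℝ} (hp : ∀ k, 0 < (p k : ℝ))
    (h : IsRelaxedSolution p γ α W θ)
    (hcls : ∀ k, ((Finset.univ.filter fun u => cls u = k).card : ℝ) = γ k * N)
    (hs₀ : ∀ u, 1 ≤ s₀ u) :
    IsLeast (relaxedCosts (fun u => p (cls u)) s₀ α) ((N * zStarCost p γ W θ : ℝ) : EReal) := by
  have hval : N * zStarCost p γ W θ = ∑ u, classGain p W (cls u) - W * (α * N) := by
    rw [sum_over_users cls hcls, h.zStarCost_eq hp]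
    ring
  have hrate : ∑ u, mixedRate p W θ (cls u) = α * N := by
    rw [sum_over_users cls hcls, h.sum_mixedRate hp]
    ring
  rw [hval]
  constructor
  · obtain ⟨π, h1, h2⟩ := exists_policy_longRunAge_le cls s₀ hp h.one_le h.2.1.le h.2.2.1 hs₀
    rw [hrate] at h1 h2
    exact ⟨π, h1.le, le_antisymm (le_longRunAge p cls π s₀ hp h.one_le hs₀ h1.le) h2⟩
  · rintro J ⟨π, hπ, rfl⟩
    exact le_longRunAge p cls π s₀ hp h.one_le hs₀ hπ

end relaxed

/-! ### Fluid paths -/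

/-- `z k i` is the mass of class `k` and age `i`, and `a k i` the part of it that is scheduled: a
mass `α` is scheduled, and state `(k, i)` is not scheduled unless all the states above it in the
priority relation are scheduled completely.  The ages are below `S - 1`. -/
structure IsAllocation (γ : Fin 2 → ℝ) (α : ℝ) (prec : Fin 2 × ℕ → Fin 2 × ℕ → Prop) (S : ℕ)
    (z a : Fin 2 → ℕ → ℝ) : Prop where
  nonneg : ∀ k i, 0 ≤ a k i
  le : ∀ k i, a k i ≤ z k i
  zero : ∀ k, z k 0 = 0
  far : ∀ k i, S ≤ i + 1 → z k i = 0
  mass : ∀ k, ∑ i ∈ Finset.range S, z k i = γ k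
  sched : ∑ k, ∑ i ∈ Finset.range S, a k i = α
  prio : ∀ k i l j, prec (k, i) (l, j) → a k i * (z l j - a l j) = 0

/-- One time slot of the fluid dynamics. -/
structure IsStep (p γ : Fin 2 → ℝ) (S : ℕ) (z a z' : Fin 2 → ℕ → ℝ) : Prop where
  zero : ∀ k, z' k 0 = 0
  next : ∀ k i, 1 ≤ i → z' k (i + 1) = z k i - p k * a k i
  mass : ∀ k, ∑ i ∈ Finset.range S, z' k i = γ k

/-- A fluid path during the slots `0, …, T - 1`. -/
structure IsFluidPath (p γ : Fin 2 → ℝ) (α : ℝ) (prec : Fin 2 × ℕ → Fin 2 × ℕ → Prop) (S T : ℕ)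
    (z a : ℕ → Fin 2 → ℕ → ℝ) : Prop where
  alloc : ∀ t < T, IsAllocation γ α prec S (z t) (a t)
  step : ∀ t < T, IsStep p γ S (z t) (a t) (z (t + 1))

/-- The priority relation of the Whittle index. -/
def indexLess (p : Fin 2 → ℝ) (s s' : Fin 2 × ℕ) : Prop :=
  whittleIndex (p s.1) s.2 < whittleIndex (p s'.1) s'.2

lemma sum_range_eq_of_vanish {w : ℕ → ℝ} {n S : ℕ} (hn : ∀ i, n ≤ i → w i = 0)
    (hS : ∀ i, S ≤ i → w i = 0) : ∑ i ∈ Finset.range n, w i = ∑ i ∈ Finset.range S, w i := by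
  rcases le_total n S with h | h
  · exact Finset.sum_subset (Finset.range_mono h) fun i _ hi => hn i (by simpa using hi)
  · exact (Finset.sum_subset (Finset.range_mono h) fun i _ hi => hS i (by simpa using hi)).symm

lemma sum_range_le_of_vanish {w : ℕ → ℝ} {S : ℕ} (hw : ∀ i, 0 ≤ w i)
    (hS : ∀ i, S ≤ i → w i = 0) (n : ℕ) : ∑ i ∈ Finset.range n, w i ≤ ∑ i ∈ Finset.range S, w i := by
  rcases le_total n S with h | h
  · exact Finset.sum_le_sum_of_subset_of_nonneg (Finset.range_mono h) fun i _ _ => hw i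
  · exact (Finset.sum_subset (Finset.range_mono h) fun i _ hi => hS i (by simpa using hi)).ge

/-! ### One slot of the fluid dynamics -/

section allocation

variable {p γ : Fin 2 → ℝ} {α : ℝ} {prec : Fin 2 × ℕ → Fin 2 × ℕ → Prop} {S : ℕ}
  {z a z' a' : Fin 2 → ℕ → ℝ}

/-- The scheduled mass of class `k`. -/
def schedMass (S : ℕ) (a : Fin 2 → ℕ → ℝ) (k : Fin 2) : ℝ := ∑ i ∈ Finset.range S, a k i

/-- The unscheduled mass of class `k`. -/
def idleMass (S : ℕ) (z a : Fin 2 → ℕ → ℝ) (k : Fin 2) : ℝ := ∑ i ∈ Finset.range S, (z k i - a k i)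

namespace IsAllocation

lemma z_nonneg (h : IsAllocation γ α prec S z a) (k i) : 0 ≤ z k i := (h.nonneg k i).trans (h.le k i)

lemma idle_nonneg (h : IsAllocation γ α prec S z a) (k i) : 0 ≤ z k i - a k i :=
  sub_nonneg.2 (h.le k i)

lemma a_eq_zero (h : IsAllocation γ α prec S z a) {k i} (hz : z k i = 0) : a k i = 0 :=
  le_antisymm (hz ▸ h.le k i) (h.nonneg k i)

lemma z_far (h : IsAllocation γ α prec S z a) (k) {i} (hi : S ≤ i) : z k i = 0 :=
  h.far k i (hi.trans (Nat.le_succ i))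

lemma a_far (h : IsAllocation γ α prec S z a) (k) {i} (hi : S ≤ i) : a k i = 0 :=
  h.a_eq_zero (h.z_far k hi)

lemma idle_far (h : IsAllocation γ α prec S z a) (k) {i} (hi : S ≤ i) : z k i - a k i = 0 := by
  rw [h.z_far k hi, h.a_far k hi, sub_zero]

lemma idleMass_eq (h : IsAllocation γ α prec S z a) (k) :
    idleMass S z a k = γ k - schedMass S a k := by
  unfold idleMass schedMass
  rw [Finset.sum_sub_distrib, h.mass]

lemma schedMass_nonneg (h : IsAllocation γ α prec S z a) (k) : 0 ≤ schedMass S a k :=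
  Finset.sum_nonneg fun i _ => h.nonneg k i

lemma idleMass_nonneg (h : IsAllocation γ α prec S z a) (k) : 0 ≤ idleMass S z a k :=
  Finset.sum_nonneg fun i _ => h.idle_nonneg k i

lemma schedMass_add (h : IsAllocation γ α prec S z a) :
    schedMass S a 0 + schedMass S a 1 = α := by
  rw [← h.sched, Fin.sum_univ_two]
  rfl

lemma idleMass_add (h : IsAllocation γ α prec S z a) (hγ : γ 0 + γ 1 = 1) :
    idleMass S z a 0 + idleMass S z a 1 = 1 - α := by
  rw [h.idleMass_eq, h.idleMass_eq]
  linarith [h.schedMass_add]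

lemma partial_idle_le (h : IsAllocation γ α prec S z a) (k) (n : ℕ) :
    ∑ i ∈ Finset.range n, (z k i - a k i) ≤ idleMass S z a k :=
  sum_range_le_of_vanish (h.idle_nonneg k) (fun _ hi => h.idle_far k hi) n

lemma partial_idle_eq (h : IsAllocation γ α prec S z a) (k) {n : ℕ}
    (hn : ∀ i, n ≤ i → z k i - a k i = 0) :
    ∑ i ∈ Finset.range n, (z k i - a k i) = idleMass S z a k :=
  sum_range_eq_of_vanish hn fun _ hi => h.idle_far k hi

/-- Below the alternation bound, the young users are served after all the older ones. -/
lemma dichotomy (h : IsAllocation γ α (indexLess p) S z a) (h₂ : 0 < p 1) (hp : p 1 < p 0)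
    {L : ℕ} (hL : (L : ℝ) < alternationBound (p 0) (p 1)) :
    (∀ k i, i ≤ L → a k i = 0) ∨ (∀ k i, L < i → z k i - a k i = 0) := by
  by_contra hcon
  push Not at hcon
  obtain ⟨⟨k, i, hi, ha⟩, l, j, hj, hu⟩ := hcon
  exact mul_ne_zero ha hu (h.prio k i l j (whittleIndex_lt_of_age_lt h₂ hp hL hi hj k l))

end IsAllocation

namespace IsStep

/-- Reindexing by the ageing shift. Since `far` keeps the last age `S - 1` empty, no mass crosses
the truncation. -/
lemma sum_mul (hs : IsStep p γ S z a z') (h : IsAllocation γ α prec S z a) (hS : 2 ≤ S)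
    (k) (f : ℕ → ℝ) :
    ∑ i ∈ Finset.range S, z' k i * f i
      = z' k 1 * f 1 + ∑ i ∈ Finset.range S, (z k i - p k * a k i) * f (i + 1) := by
  obtain ⟨n, rfl⟩ : ∃ n, S = n + 2 := ⟨S - 2, by omega⟩
  rw [Finset.sum_range_succ', Finset.sum_range_succ', hs.zero]
  rw [Finset.sum_range_succ, Finset.sum_range_succ' _ n]
  have h0 : a k 0 = 0 := h.a_eq_zero (h.zero k)
  have h1 : z k (n + 1) = 0 := h.far k _ (by omega)
  have h2 : a k (n + 1) = 0 := h.a_eq_zero h1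
  rw [h.zero, h0, h1, h2]
  simp only [hs.next k _ (Nat.le_add_left 1 _)]
  ring

/-- Conservation of the mass of the class forces the newborns to be the successes, so `IsStep` does
not need to prescribe age one. -/
lemma birth (hs : IsStep p γ S z a z') (h : IsAllocation γ α prec S z a) (hS : 2 ≤ S) (k) :
    z' k 1 = p k * schedMass S a k := by
  have h1 := hs.sum_mul h hS k fun _ => 1
  simp only [mul_one, hs.mass, Finset.sum_sub_distrib, h.mass, ← Finset.mul_sum] at h1
  unfold schedMass
  linarith

lemma next_le (hs : IsStep p γ S z a z') (h : IsAllocation γ α prec S z a)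
    (hp : 0 ≤ p k) {i} (hi : 1 ≤ i) : z' k (i + 1) ≤ z k i := by
  rw [hs.next k i hi]
  linarith [mul_nonneg hp (h.nonneg k i)]

lemma idle_le_next (hs : IsStep p γ S z a z') (h : IsAllocation γ α prec S z a)
    (hp : p k ≤ 1) {i} (hi : 1 ≤ i) : z k i - a k i ≤ z' k (i + 1) := by
  rw [hs.next k i hi]
  nlinarith [h.nonneg k i]

lemma birth_sum_pos (hs : IsStep p γ S z a z') (h : IsAllocation γ α prec S z a) (hS : 2 ≤ S)
    (h₂ : 0 < p 1) (hp : p 1 < p 0) : p 1 * α ≤ z' 0 1 + z' 1 1 := by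
  rw [hs.birth h hS, hs.birth h hS]
  nlinarith [h.schedMass_add, h.schedMass_nonneg 0]

/-- If nobody of age one is scheduled, some users are scheduled that were not scheduled in the
slot before. -/
lemma exists_newly_scheduled (hs : IsStep p γ S z a z') (h : IsAllocation γ α prec S z a)
    (h' : IsAllocation γ α prec S z' a') (hS : 2 ≤ S) (hγ : γ 0 + γ 1 = 1) (hα : 0 < α)
    (h₂ : 0 < p 1) (hp : p 1 < p 0) (h₁ : p 0 ≤ 1) (hyoung : ∀ k, a' k 1 = 0) :
    ∃ k i, 1 ≤ i ∧ z k i - a k i ≠ 0 ∧ a' k (i + 1) ≠ 0 := by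
  by_contra hcon
  push Not at hcon
  have hp1 : ∀ k, p k ≤ 1 := fun k => by
    fin_cases k
    · exact h₁
    · exact (hp.trans_le h₁).le
  -- Otherwise the idle mass of each class would stay idle and be joined by all the newborns,
  -- whereas the total idle mass is always `1 - α` and births are at least `p₂ α > 0`.
  have key : ∀ k, z' k 1 + idleMass S z a k ≤ idleMass S z' a' k := by
    intro k
    refine le_trans ?_ (h'.partial_idle_le k (S + 1))
    obtain ⟨n, rfl⟩ : ∃ n, S = n + 1 := ⟨S - 1, by omega⟩
    have h0 : idleMass (n + 1) z a k = ∑ i ∈ Finset.range n, (z k (i + 1) - a k (i + 1)) := by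
      unfold idleMass
      rw [Finset.sum_range_succ', h.zero, h.a_eq_zero (h.zero k)]
      ring
    rw [h0, Finset.sum_range_succ', Finset.sum_range_succ', h'.zero, h'.a_eq_zero (h'.zero k),
      hyoung k]
    have : ∑ i ∈ Finset.range n, (z k (i + 1) - a k (i + 1))
        ≤ ∑ i ∈ Finset.range n, (z' k (i + 1 + 1) - a' k (i + 1 + 1)) := by
      refine Finset.sum_le_sum fun i _ => ?_
      by_cases hu : z k (i + 1) - a k (i + 1) = 0
      · rw [hu]
        exact h'.idle_nonneg k _
      · rw [hcon k (i + 1) (Nat.le_add_left 1 i) hu, sub_zero]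
        exact hs.idle_le_next h (hp1 k) (Nat.le_add_left 1 i)
    linarith
  have hb := hs.birth_sum_pos h hS h₂ hp
  have := h.idleMass_add hγ
  have := h'.idleMass_add hγ
  nlinarith [key 0, key 1, mul_pos h₂ hα]

end IsStep

end allocation

/-! ### Cohorts and idle masses along a fluid path -/

section path

variable {p γ : Fin 2 → ℝ} {α : ℝ} {S T : ℕ} {z a : ℕ → Fin 2 → ℕ → ℝ}

/-- The standing assumptions on the parameters; during `m` slots enough users are born to fill the
unscheduled places. -/
structure FluidParams (p γ : Fin 2 → ℝ) (α : ℝ) (m : ℕ) : Prop where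
  p₂_pos : 0 < p 1
  p_lt : p 1 < p 0
  p₁_lt : p 0 < 1
  γ_pos : ∀ k, 0 < γ k
  γ_sum : γ 0 + γ 1 = 1
  α_pos : 0 < α
  α_lt : α < 1
  m_pos : 1 ≤ m
  m_lt : (m : ℝ) + 1 < alternationBound (p 0) (p 1)
  m_ge : 1 - α ≤ m * (p 1 * α)

namespace FluidParams

variable {m : ℕ}

lemma p_pos (P : FluidParams p γ α m) (k : Fin 2) : 0 < p k := by
  fin_cases k
  · exact P.p₂_pos.trans P.p_lt
  · exact P.p₂_pos

lemma p_lt_one (P : FluidParams p γ α m) (k : Fin 2) : p k < 1 := by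
  fin_cases k
  · exact P.p₁_lt
  · exact P.p_lt.trans P.p₁_lt

lemma cast_lt (P : FluidParams p γ α m) {L : ℕ} (hL : L ≤ m + 1) :
    (L : ℝ) < alternationBound (p 0) (p 1) := by
  have : (L : ℝ) ≤ m + 1 := by exact_mod_cast hL
  exact this.trans_lt P.m_lt

end FluidParams

namespace IsFluidPath

variable {m : ℕ}

lemma birth (h : IsFluidPath p γ α (indexLess p) S T z a) (hS : 2 ≤ S) {t : ℕ} (ht : t < T) (k) :
    z (t + 1) k 1 = p k * schedMass S (a t) k := (h.step t ht).birth (h.alloc t ht) hS k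

/-- A cohort never exceeds its size at birth. -/
lemma cohort_le (h : IsFluidPath p γ α (indexLess p) S T z a) (P : FluidParams p γ α m) (k)
    (j : ℕ) : ∀ t, t < T → j ≤ t → z t k (j + 1) ≤ z (t - j) k 1 := by
  induction j with
  | zero => intro t _ _; simp
  | succ j ih =>
    intro t ht hj
    obtain ⟨t, rfl⟩ : ∃ s, t = s + 1 := ⟨t - 1, by omega⟩
    have h1 := (h.step t (by omega)).next_le (h.alloc t (by omega)) (P.p_pos k).le
      (Nat.le_add_left 1 j)
    rw [Nat.add_sub_add_right]
    exact h1.trans (ih t (by omega) (by omega))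

/-- The users of age at most `L`, all of them unscheduled, have never been scheduled. -/
lemma cohort_eq (h : IsFluidPath p γ α (indexLess p) S T z a) (P : FluidParams p γ α m)
    (hS : 2 ≤ S) (L : ℕ) (hLm : L ≤ m + 1) : ∀ t, t < T → (∀ k i, i ≤ L → a t k i = 0) →
    ∀ k j, j < L → j ≤ t → z t k (j + 1) = z (t - j) k 1 := by
  induction L with
  | zero => intro t _ _ k j hj; omega
  | succ L ih =>
    intro t ht hy k j hj hjt
    rcases Nat.eq_zero_or_pos j with rfl | hj0
    · simp
    · obtain ⟨j, rfl⟩ : ∃ i, j = i + 1 := ⟨j - 1, by omega⟩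
      obtain ⟨t, rfl⟩ : ∃ s, t = s + 1 := ⟨t - 1, by omega⟩
      have hA := h.alloc t (by omega)
      -- Someone idle in the slot before is now scheduled, hence was already older than `L` while
      -- idle. The dichotomy in that slot then leaves nobody of age at most `L` scheduled, and the
      -- induction goes back one slot.
      obtain ⟨l, i, hi, hu, ha⟩ := (h.step t (by omega)).exists_newly_scheduled hA
        (h.alloc (t + 1) ht) hS P.γ_sum P.α_pos P.p₂_pos P.p_lt P.p₁_lt.le
        fun k => hy k 1 (by omega)
      have hiL : L < i := by
        by_contra hle
        exact ha (hy l (i + 1) (by omega))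
      have hyt : ∀ k i, i ≤ L → a t k i = 0 := by
        rcases hA.dichotomy P.p₂_pos P.p_lt (P.cast_lt (by omega : L ≤ m + 1)) with h1 | h1
        · exact h1
        · exact absurd (h1 l i hiL) hu
      rw [Nat.add_sub_add_right, (h.step t (by omega)).next k (j + 1) (by omega),
        hyt k (j + 1) (by omega), mul_zero, sub_zero]
      exact ih (by omega) t (by omega) hyt k j (by omega) (by omega)

/-- The mass of the users of age at most `L`. -/
lemma young_mass_ge (h : IsFluidPath p γ α (indexLess p) S T z a) (P : FluidParams p γ α m)
    (hS : 2 ≤ S) (L : ℕ) (hL : L ≤ m) : ∀ t, t < T → L ≤ t →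
    min (L * (p 1 * α)) (1 - α) ≤ ∑ k, ∑ i ∈ Finset.range (L + 1), z t k i := by
  induction L with
  | zero =>
    intro t ht _
    refine (min_le_left _ _).trans ?_
    simp [(h.alloc t ht).zero]
  | succ L ih =>
    intro t ht hLt
    obtain ⟨t, rfl⟩ : ∃ s, t = s + 1 := ⟨t - 1, by omega⟩
    have hA := h.alloc t (by omega)
    have hs := h.step t (by omega)
    have hb := hs.birth_sum_pos hA hS P.p₂_pos P.p_lt
    have hge : ∀ k, z (t + 1) k 1 + ∑ i ∈ Finset.range (L + 1), (z t k i - a t k i)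
        ≤ ∑ i ∈ Finset.range (L + 1 + 1), z (t + 1) k i := by
      intro k
      rw [Finset.sum_range_succ', Finset.sum_range_succ', hs.zero, Finset.sum_range_succ',
        hA.zero, hA.a_eq_zero (hA.zero k)]
      have : ∑ i ∈ Finset.range L, (z t k (i + 1) - a t k (i + 1))
          ≤ ∑ i ∈ Finset.range L, z (t + 1) k (i + 1 + 1) :=
        Finset.sum_le_sum fun i _ => hs.idle_le_next hA (P.p_lt_one k).le (Nat.le_add_left 1 i)
      linarith
    simp only [Fin.sum_univ_two]
    have hpα : 0 < p 1 * α := mul_pos P.p₂_pos P.α_pos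
    -- Either nobody of age at most `L` is scheduled and a slot of births, at least `p₂ α`, is
    -- added; or the whole idle mass `1 - α` has age at most `L` and survives into the next slot.
    rcases hA.dichotomy P.p₂_pos P.p_lt (P.cast_lt (by omega : L ≤ m + 1)) with h1 | h1
    · have h2 := ih (by omega) t (by omega) (by omega)
      have h3 : ∀ k, ∑ i ∈ Finset.range (L + 1), (z t k i - a t k i)
          = ∑ i ∈ Finset.range (L + 1), z t k i := fun k =>
        Finset.sum_congr rfl fun i hi => by
          rw [h1 k i (Nat.lt_succ_iff.1 (Finset.mem_range.1 hi)), sub_zero]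
      have hg0 := hge 0
      have hg1 := hge 1
      rw [h3] at hg0 hg1
      simp only [Fin.sum_univ_two] at h2
      have h4 : min (((L + 1 : ℕ) : ℝ) * (p 1 * α)) (1 - α)
          ≤ min (L * (p 1 * α)) (1 - α) + p 1 * α := by
        rw [min_add]
        push_cast
        refine min_le_min (by linarith) (by linarith)
      linarith
    · have h3 : ∀ k, ∑ i ∈ Finset.range (L + 1), (z t k i - a t k i) = idleMass S (z t) (a t) k :=
        fun k => hA.partial_idle_eq k fun i hi => h1 k i hi
      have hg0 := hge 0
      have hg1 := hge 1
      rw [h3] at hg0 hg1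
      have := hA.idleMass_add P.γ_sum
      exact (min_le_right _ _).trans (by linarith)

/-- After `m` slots all the unscheduled users have age at most `m`. -/
lemma idle_young (h : IsFluidPath p γ α (indexLess p) S T z a) (P : FluidParams p γ α m)
    (hS : 2 ≤ S) {t : ℕ} (ht : t < T) (hmt : m ≤ t) (k) {i} (hi : m < i) :
    z t k i - a t k i = 0 := by
  have hA := h.alloc t ht
  rcases hA.dichotomy P.p₂_pos P.p_lt (P.cast_lt (Nat.le_succ m)) with h1 | h1
  · have hY := h.young_mass_ge P hS m le_rfl t ht hmt
    rw [min_eq_right P.m_ge, Fin.sum_univ_two] at hY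
    have h3 : ∀ k, ∑ i ∈ Finset.range (m + 1), (z t k i - a t k i)
        = ∑ i ∈ Finset.range (m + 1), z t k i := fun k =>
      Finset.sum_congr rfl fun i hi => by
        rw [h1 k i (Nat.lt_succ_iff.1 (Finset.mem_range.1 hi)), sub_zero]
    have hle : ∀ k, ∑ i ∈ Finset.range (i + 1), (z t k i - a t k i) ≤ idleMass S (z t) (a t) k :=
      fun k => hA.partial_idle_le k _
    have hsplit : ∀ k, ∑ i ∈ Finset.range (m + 1), (z t k i - a t k i) + (z t k i - a t k i)
        ≤ ∑ i ∈ Finset.range (i + 1), (z t k i - a t k i) := by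
      intro k
      rw [Finset.sum_range_succ _ i]
      exact add_le_add (Finset.sum_le_sum_of_subset_of_nonneg
        (Finset.range_mono hi) fun i _ _ => hA.idle_nonneg k i) le_rfl
    have hsum := hA.idleMass_add P.γ_sum
    have h0 := (hsplit 0).trans (hle 0)
    have h1' := (hsplit 1).trans (hle 1)
    rw [h3] at h0 h1'
    have hz : z t 0 i - a t 0 i = 0 ∧ z t 1 i - a t 1 i = 0 := by
      have n0 := hA.idle_nonneg 0 i
      have n1 := hA.idle_nonneg 1 i
      constructor <;> linarith
    fin_cases k
    · exact hz.1
    · exact hz.2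
  · exact h1 k i hi

/-- The births of the last `L` slots. -/
def recent (S : ℕ) (a : ℕ → Fin 2 → ℕ → ℝ) (k : Fin 2) (t L : ℕ) : ℝ :=
  ∑ j ∈ Finset.range L, schedMass S (a (t - 1 - j)) k

lemma young_mass_le (h : IsFluidPath p γ α (indexLess p) S T z a) (P : FluidParams p γ α m)
    (hS : 2 ≤ S) {t : ℕ} (ht : t < T) {L : ℕ} (hL : L ≤ t) (k) :
    ∑ i ∈ Finset.range (L + 1), z t k i ≤ p k * recent S a k t L := by
  rw [Finset.sum_range_succ', (h.alloc t ht).zero, add_zero, recent, Finset.mul_sum]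
  refine Finset.sum_le_sum fun j hj => ?_
  have hj' := Finset.mem_range.1 hj
  refine (h.cohort_le P k j t ht (by omega)).trans ?_
  rw [← h.birth hS (by omega : t - 1 - j < T), show t - 1 - j + 1 = t - j by omega]

/-- Either no user older than `L` is unscheduled, or the users of age at most `L` are the births of
the last `L` slots and are all unscheduled. -/
lemma dichotomy_births (h : IsFluidPath p γ α (indexLess p) S T z a) (P : FluidParams p γ α m)
    (hS : 2 ≤ S) {t : ℕ} (ht : t < T) {L : ℕ} (hLm : L ≤ m) (hL : L ≤ t) :
    (∀ k i, L < i → z t k i - a t k i = 0) ∨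
      ((∀ k i, i ≤ L → a t k i = 0) ∧
        ∀ k, ∑ i ∈ Finset.range (L + 1), (z t k i - a t k i) = p k * recent S a k t L) := by
  rcases (h.alloc t ht).dichotomy P.p₂_pos P.p_lt (P.cast_lt (by omega : L ≤ m + 1)) with h1 | h1
  · refine Or.inr ⟨h1, fun k => ?_⟩
    rw [Finset.sum_range_succ', (h.alloc t ht).zero, h1 k 0 (Nat.zero_le _), sub_zero, add_zero,
      recent, Finset.mul_sum]
    refine Finset.sum_congr rfl fun j hj => ?_
    have hj' := Finset.mem_range.1 hj
    rw [h1 k (j + 1) hj', sub_zero, h.cohort_eq P hS L (by omega) t ht h1 k j hj' (by omega),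
      ← h.birth hS (by omega : t - 1 - j < T), show t - 1 - j + 1 = t - j by omega]
  · exact Or.inl h1

/-- The idle mass of class `1` is at least the births of `L` slots, or that of class `2` is at most
the births of `L` slots. -/
lemma idle_alternative (h : IsFluidPath p γ α (indexLess p) S T z a) (P : FluidParams p γ α m)
    (hS : 2 ≤ S) {t : ℕ} (ht : t < T) (hmt : m ≤ t) {L : ℕ} (hL : L ≤ t) :
    p 0 * recent S a 0 t L ≤ idleMass S (z t) (a t) 0 ∨
      idleMass S (z t) (a t) 1 ≤ p 1 * recent S a 1 t L := by
  have hA := h.alloc t ht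
  have main : (∀ k i, L < i → z t k i - a t k i = 0) →
      idleMass S (z t) (a t) 1 ≤ p 1 * recent S a 1 t L := by
    intro h1
    rw [← hA.partial_idle_eq 1 (n := L + 1) fun i hi => h1 1 i hi]
    refine le_trans (Finset.sum_le_sum fun i _ => ?_) (h.young_mass_le P hS ht hL 1)
    linarith [hA.nonneg 1 i]
  rcases le_total L m with hLm | hLm
  · rcases h.dichotomy_births P hS ht hLm hL with h1 | ⟨-, h1⟩
    · exact Or.inr (main h1)
    · left
      rw [← h1 0]
      exact hA.partial_idle_le 0 _
  · exact Or.inr (main fun k i hi => h.idle_young P hS ht hmt k (by omega))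

/-- When the users of age one are not scheduled, an idle user of class `1` and age `L` has behind it
all the births of class `2` of the last `L` slots. -/
lemma cohort_eq_of_idle (h : IsFluidPath p γ α (indexLess p) S T z a) (P : FluidParams p γ α m)
    (hS : 2 ≤ S) {τ : ℕ} (hτ : ∀ t, τ ≤ t → t < T → ∀ k, a t k 1 = 0) (L : ℕ) (hL : L + 1 ≤ m) :
    ∀ t, t < T → τ + L ≤ t → z t 0 (L + 1) - a t 0 (L + 1) ≠ 0 →
      ∀ j, j ≤ L → a t 1 (j + 1) = 0 ∧ z t 1 (j + 1) = z (t - j) 1 1 := by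
  induction L with
  | zero =>
    intro t ht hτt _ j hj
    obtain rfl : j = 0 := by omega
    exact ⟨hτ t hτt ht 1, by simp⟩
  | succ L ih =>
    intro t ht hτt hu j hj
    obtain ⟨t, rfl⟩ : ∃ s, t = s + 1 := ⟨t - 1, by omega⟩
    have hA := h.alloc t (by omega)
    have hA' := h.alloc (t + 1) ht
    have hs := h.step t (by omega)
    -- The idleness is traced one slot back. A newly scheduled user has index at least that of the
    -- idle class-1 user: at the same age it belongs to class 1 and was itself idle; at a greater
    -- age its former idleness shows that nobody of age at most `L + 1` was scheduled.
    have hidle : z t 0 (L + 1) - a t 0 (L + 1) ≠ 0 := by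
      obtain ⟨l, i, hi, hui, hai⟩ := hs.exists_newly_scheduled hA hA' hS P.γ_sum P.α_pos
        P.p₂_pos P.p_lt P.p₁_lt.le fun k => hτ (t + 1) (by omega) ht k
      have hnot : ¬ whittleIndex (p l) (i + 1) < whittleIndex (p 0) (L + 1 + 1) := fun hlt =>
        mul_ne_zero hai hu (hA'.prio l (i + 1) 0 (L + 1 + 1) hlt)
      rcases lt_trichotomy i (L + 1) with hlt | rfl | hgt
      · exact absurd (whittleIndex_lt_of_age_lt P.p₂_pos P.p_lt
          (P.cast_lt (by omega : L + 1 ≤ m + 1)) (by omega) (by omega) l 0) hnot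
      · fin_cases l
        · exact hui
        · exact absurd (whittleIndex_lt_of_lt P.p_lt (by omega)) hnot
      · rcases hA.dichotomy P.p₂_pos P.p_lt (P.cast_lt (by omega : L + 1 ≤ m + 1)) with h1 | h1
        · have h2 := hs.next_le hA (P.p_pos 0).le (Nat.le_add_left 1 L)
          have h3 := hA'.idle_nonneg 0 (L + 1 + 1)
          have h4 : 0 < z (t + 1) 0 (L + 1 + 1) - a (t + 1) 0 (L + 1 + 1) :=
            lt_of_le_of_ne h3 (Ne.symm hu)
          rw [h1 0 (L + 1) le_rfl, sub_zero]
          have h5 := hA'.nonneg 0 (L + 1 + 1)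
          exact ne_of_gt (by linarith)
        · exact absurd (h1 l i hgt) hui
    -- At equal age class 2 has the strictly smaller index only from age `2` on. At age `1` the
    -- classes tie, which is why newborns are assumed unscheduled.
    have hlow : whittleIndex (p 1) (j + 1) < whittleIndex (p 0) (L + 1 + 1) := by
      rcases hj.lt_or_eq with hj' | rfl
      · exact whittleIndex_lt_of_age_lt P.p₂_pos P.p_lt
          (P.cast_lt (by omega : L + 1 ≤ m + 1)) (by omega) (by omega) 1 0
      · exact whittleIndex_lt_of_lt P.p_lt (by omega)
    have ha : a (t + 1) 1 (j + 1) = 0 := by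
      have := hA'.prio 1 (j + 1) 0 (L + 1 + 1) hlow
      exact (mul_eq_zero.1 this).resolve_right hu
    refine ⟨ha, ?_⟩
    rcases Nat.eq_zero_or_pos j with rfl | hj0
    · simp
    · obtain ⟨j, rfl⟩ : ∃ i, j = i + 1 := ⟨j - 1, by omega⟩
      obtain ⟨h1, h2⟩ := ih (by omega) t (by omega) (by omega) hidle j (by omega)
      rw [hs.next 1 (j + 1) (by omega), h1, mul_zero, sub_zero, h2, Nat.add_sub_add_right]

/-- When the users of age one are not scheduled, the idle masses are cut at a common number of
slots. -/
lemma exists_idle_cut (h : IsFluidPath p γ α (indexLess p) S T z a) (P : FluidParams p γ α m)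
    (hS : 2 ≤ S) {τ : ℕ} (hτ : ∀ t, τ ≤ t → t < T → ∀ k, a t k 1 = 0) {t : ℕ} (ht : t < T)
    (hmt : τ + m ≤ t) :
    ∃ L ≤ m, idleMass S (z t) (a t) 0 ≤ p 0 * recent S a 0 t L ∧
      p 1 * recent S a 1 t L ≤ idleMass S (z t) (a t) 1 := by
  classical
  have hA := h.alloc t ht
  by_cases hex : ∃ i, z t 0 i - a t 0 i ≠ 0
  · obtain ⟨i₀, hi₀⟩ := hex
    have hbd : ∀ i, z t 0 i - a t 0 i ≠ 0 → i ≤ m := fun i hi => by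
      by_contra hgt
      exact hi (h.idle_young P hS ht (by omega) 0 (by omega))
    -- The cut is the greatest age of an idle user of class 1. Beyond it class 1 has no idle mass,
    -- and up to it class 2 is entirely idle; without idle mass in class 1 the cut is `0`.
    let L := Nat.findGreatest (fun i => z t 0 i - a t 0 i ≠ 0) m
    have hLP : z t 0 L - a t 0 L ≠ 0 :=
      Nat.findGreatest_spec (P := fun i => z t 0 i - a t 0 i ≠ 0) (hbd i₀ hi₀) hi₀
    have hLm : L ≤ m := Nat.findGreatest_le m
    have hL0 : L ≠ 0 := fun h0 => hLP (by
      rw [h0, hA.zero, hA.a_eq_zero (hA.zero 0), sub_zero])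
    have hbeyond : ∀ i, L + 1 ≤ i → z t 0 i - a t 0 i = 0 := by
      intro i hi
      by_contra hne
      have : i ≤ L := Nat.le_findGreatest (hbd i hne) hne
      omega
    refine ⟨L, hLm, ?_, ?_⟩
    · rw [← hA.partial_idle_eq 0 hbeyond]
      refine le_trans (Finset.sum_le_sum fun i _ => ?_)
        (h.young_mass_le P hS ht (by omega : L ≤ t) 0)
      linarith [hA.nonneg 0 i]
    · refine le_trans ?_ (hA.partial_idle_le 1 (L + 1))
      rw [Finset.sum_range_succ', hA.zero, hA.a_eq_zero (hA.zero 1), sub_zero, add_zero, recent,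
        Finset.mul_sum]
      refine (Finset.sum_congr rfl fun j hj => ?_).le
      have hj' := Finset.mem_range.1 hj
      obtain ⟨l, hl⟩ : ∃ l, L = l + 1 := ⟨L - 1, by omega⟩
      rw [hl] at hLP
      obtain ⟨h1, h2⟩ := h.cohort_eq_of_idle P hS hτ l (by omega) t ht (by omega) hLP j (by omega)
      rw [h1, h2, sub_zero, ← h.birth hS (by omega : t - 1 - j < T),
        show t - 1 - j + 1 = t - j by omega]
  · push Not at hex
    refine ⟨0, Nat.zero_le m, ?_, ?_⟩
    · simp [recent, idleMass, hex]
    · simpa [recent] using hA.idleMass_nonneg 1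

/-- The users of age one are either all idle, or are the only idle ones. -/
lemma age_one_alternative (h : IsFluidPath p γ α (indexLess p) S T z a) (P : FluidParams p γ α m)
    (hS : 2 ≤ S) {t : ℕ} (ht : t + 1 < T) :
    (∀ k, schedMass S (a (t + 1)) k ≤ γ k - p k * schedMass S (a t) k) ∨
      (∀ k, γ k - p k * schedMass S (a t) k ≤ schedMass S (a (t + 1)) k) := by
  have hA := h.alloc (t + 1) ht
  have hm := P.m_pos
  have h01 : ∀ k, ∑ i ∈ Finset.range 2, (z (t + 1) k i - a (t + 1) k i)
      = z (t + 1) k 1 - a (t + 1) k 1 := fun k => by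
    simp [Finset.sum_range_succ, hA.zero, hA.a_eq_zero (hA.zero k)]
  rcases hA.dichotomy P.p₂_pos P.p_lt (P.cast_lt (by omega : 1 ≤ m + 1)) with h1 | h1
  · left
    intro k
    have h2 := hA.partial_idle_le k 2
    rw [h01, h1 k 1 le_rfl, hA.idleMass_eq, h.birth hS (by omega)] at h2
    linarith
  · right
    intro k
    have h2 := hA.partial_idle_eq k (n := 2) fun i hi => h1 k i hi
    rw [h01, hA.idleMass_eq, h.birth hS (by omega)] at h2
    linarith [hA.nonneg k 1]

end IsFluidPath

end path

/-! ### Convergence of the scheduled mass -/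

/-! ### Sequences that move between two decreasing lines -/

section lines

/-- A sequence each of whose steps lies between two decreasing lines enters a neighbourhood of the
invariant interval of the pair of lines. -/
lemma between_lines {p₁ p₂ σ : ℝ} (h₂ : 0 < p₂) (h : p₂ < p₁) (h₁ : p₁ < 1) (hσ : 0 ≤ σ) {T : ℕ}
    {d : ℕ → ℝ} (hd0 : |d 0| ≤ 1)
    (hd : ∀ t, t + 1 < T → (-(p₁ * d t) ≤ d (t + 1) ∧ d (t + 1) ≤ (1 + p₂) * σ - p₂ * d t) ∨
      (d (t + 1) ≤ -(p₁ * d t) ∧ (1 + p₂) * σ - p₂ * d t ≤ d (t + 1))) :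
    ∃ c > 0, c = (1 - p₁ ^ 2) * (1 + p₂) / (1 - p₁ * p₂) ∧
      ∀ t < T, c * σ - p₁ ^ t ≤ (1 + p₂) * σ + (p₁ - p₂) * d t := by
  have hden : 0 < 1 - p₁ * p₂ := by nlinarith
  -- The interval `[-Aσ, (1 + C)σ]` is invariant because the steeper line sends its right end to its
  -- left end, `A = p₁ (1 + C)`, and the flatter one its left end to its right end, `C = p₂ (1 +
  -- A)`. The overshoot shrinks by the factor `p₁` in each step.
  set C := p₂ * (1 + p₁) / (1 - p₁ * p₂) with hC
  set A := p₁ * (1 + p₂) / (1 - p₁ * p₂) with hA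
  have hC0 : 0 ≤ C := by rw [hC]; exact div_nonneg (by nlinarith) hden.le
  have hA0 : 0 ≤ A := by rw [hA]; exact div_nonneg (by nlinarith) hden.le
  have hAC : A = p₁ * (1 + C) := by rw [hA, hC]; field_simp; ring
  have hCA : C = p₂ * (1 + A) := by
    rw [hA, hC, one_add_div hden.ne', ← mul_div_assoc]
    congr 1
    ring
  have hinv : ∀ t < T, -(A * σ) - p₁ ^ t ≤ d t ∧ d t ≤ (1 + C) * σ + p₁ ^ t := by
    intro t
    induction t with
    | zero =>
      intro _
      have h3 := abs_le.1 hd0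
      have h4 := mul_nonneg hA0 hσ
      have h5 := mul_nonneg (by linarith : 0 ≤ 1 + C) hσ
      simp only [pow_zero]
      constructor <;> linarith [h3.1, h3.2]
    | succ t ih =>
      intro ht
      obtain ⟨hlo, hhi⟩ := ih (by omega)
      have hκ : 0 < p₁ ^ t := pow_pos (h₂.trans h) t
      rw [pow_succ]
      set κ := p₁ ^ t
      have b1 : -(A * σ) - κ * p₁ ≤ -(p₁ * d t) := by
        have : p₁ * d t ≤ p₁ * ((1 + C) * σ + κ) :=
          mul_le_mul_of_nonneg_left hhi (h₂.trans h).le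
        rw [hAC]
        linarith
      have b2 : -(A * σ) - κ * p₁ ≤ (1 + p₂) * σ - p₂ * d t := by
        have h6 : p₂ * d t ≤ p₂ * ((1 + C) * σ + κ) := mul_le_mul_of_nonneg_left hhi h₂.le
        have h7 : p₂ * C ≤ 1 + A := by
          rw [hCA]
          have : p₂ * p₂ ≤ 1 := by nlinarith
          nlinarith
        nlinarith [mul_nonneg (sub_nonneg.2 h7) hσ, mul_nonneg hκ.le (sub_nonneg.2 h.le)]
      have b3 : (1 + p₂) * σ - p₂ * d t ≤ (1 + C) * σ + κ * p₁ := by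
        have h6 : p₂ * (-(A * σ) - κ) ≤ p₂ * d t := mul_le_mul_of_nonneg_left hlo h₂.le
        have h8 : C * σ = p₂ * (1 + A) * σ := by rw [← hCA]
        nlinarith [mul_nonneg hκ.le (sub_nonneg.2 h.le)]
      have b4 : -(p₁ * d t) ≤ (1 + C) * σ + κ * p₁ := by
        have h6 : p₁ * (-(A * σ) - κ) ≤ p₁ * d t :=
          mul_le_mul_of_nonneg_left hlo (h₂.trans h).le
        have h8 : p₁ * A ≤ 1 + C := by
          rw [hAC]
          have : p₁ * p₁ ≤ 1 := by nlinarith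
          nlinarith
        nlinarith [mul_nonneg (sub_nonneg.2 h8) hσ]
      rcases hd t ht with ⟨h3, h4⟩ | ⟨h3, h4⟩
      · exact ⟨b1.trans h3, h4.trans b3⟩
      · exact ⟨b2.trans h4, h3.trans b4⟩
  refine ⟨(1 - p₁ ^ 2) * (1 + p₂) / (1 - p₁ * p₂), ?_, rfl, fun t ht => ?_⟩
  · exact div_pos (mul_pos (by nlinarith) (by linarith)) hden
  · have hc : (1 - p₁ ^ 2) * (1 + p₂) / (1 - p₁ * p₂) = 1 + p₂ - (p₁ - p₂) * A := by
      rw [hA]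
      field_simp
      ring
    rw [hc]
    have h3 := mul_le_mul_of_nonneg_left (hinv t ht).1 (sub_nonneg.2 h.le)
    have hκ : 0 < p₁ ^ t := pow_pos (h₂.trans h) t
    nlinarith

end lines

/-! ### Delay relations for the scheduled mass of class 1 -/

section delay

/-- The sum of the last `L` values before time `t`. -/
def delaySum (x : ℕ → ℝ) (t L : ℕ) : ℝ := ∑ j ∈ Finset.range L, x (t - 1 - j)

lemma delaySum_succ (x : ℕ → ℝ) (t L : ℕ) :
    delaySum x (t + 1) L + x (t - L) = x t + delaySum x t L := by
  have h1 : delaySum x (t + 1) L + x (t - L) = ∑ j ∈ Finset.range (L + 1), x (t - j) := by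
    rw [Finset.sum_range_succ]
    rfl
  rw [h1, Finset.sum_range_succ', add_comm]
  unfold delaySum
  simp only [Nat.sub_zero, Nat.sub_sub, Nat.add_comm 1]

/-- The relations satisfied by the scheduled mass `x` of class `1` when no user of age one is
scheduled; `g - x` is the idle mass of the class, and `Q` the total idle mass. -/
structure IsDelaySystem (p₁ p₂ g Q α : ℝ) (m t₁ T : ℕ) (x : ℕ → ℝ) : Prop where
  mem : ∀ t < T, 0 ≤ x t ∧ x t ≤ 1
  lower : ∀ t, t₁ ≤ t → t < T → ∀ L ≤ t, p₁ * delaySum x t L ≤ g - x t ∨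
    Q - p₂ * (L * α - delaySum x t L) ≤ g - x t
  upper : ∀ t, t₁ ≤ t → t < T → ∃ L ≤ m, g - x t ≤ p₁ * delaySum x t L ∧
    g - x t ≤ Q - p₂ * (L * α - delaySum x t L)

variable {p₁ p₂ g Q α : ℝ} {m t₁ T : ℕ} {x : ℕ → ℝ}

namespace IsDelaySystem

/-- The relations make `g - x t` the maximum over `L` of the minimum of two affine functions of the
delay sum, with slopes `p₁` and `p₂`. Using the `L` that is optimal in one slot as a competitor in
the other, the change of `x` is at most a slope times the difference between `x t` and the value `L`
slots earlier; the slope `p₁` is the worst. -/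
lemma step (h : IsDelaySystem p₁ p₂ g Q α m t₁ T x) (h₂ : 0 < p₂) (hp : p₂ < p₁) (hm : m ≤ t₁)
    {t : ℕ} (ht : t₁ ≤ t) (htT : t + 1 < T) {lo hi : ℝ}
    (hw : ∀ s, t - m ≤ s → s ≤ t → lo ≤ x s ∧ x s ≤ hi) :
    (1 - p₁) * x t + p₁ * lo ≤ x (t + 1) ∧ x (t + 1) ≤ (1 - p₁) * x t + p₁ * hi := by
  have hxt := hw t (Nat.sub_le _ _) le_rfl
  constructor
  · obtain ⟨L, hL, hu1, hu2⟩ := h.upper (t + 1) (by omega) htT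
    have hid := delaySum_succ x t L
    have hwL := (hw (t - L) (by omega) (Nat.sub_le _ _)).1
    rcases h.lower t ht (by omega) L (by omega) with h1 | h1
    · have := mul_le_mul_of_nonneg_left hwL (h₂.trans hp).le
      have e : p₁ * delaySum x (t + 1) L = p₁ * (x t + delaySum x t L - x (t - L)) := by
        rw [← hid]; ring
      linarith
    · have := mul_le_mul_of_nonneg_left hwL h₂.le
      have e : p₂ * delaySum x (t + 1) L = p₂ * (x t + delaySum x t L - x (t - L)) := by
        rw [← hid]; ring
      nlinarith [mul_nonneg (sub_nonneg.2 hp.le) (sub_nonneg.2 hxt.1)]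
  · obtain ⟨L, hL, hu1, hu2⟩ := h.upper t ht (by omega)
    have hid := delaySum_succ x t L
    have hwL := (hw (t - L) (by omega) (Nat.sub_le _ _)).2
    rcases h.lower (t + 1) (by omega) htT L (by omega) with h1 | h1
    · have := mul_le_mul_of_nonneg_left hwL (h₂.trans hp).le
      have e : p₁ * delaySum x (t + 1) L = p₁ * (x t + delaySum x t L - x (t - L)) := by
        rw [← hid]; ring
      linarith
    · have := mul_le_mul_of_nonneg_left hwL h₂.le
      have e : p₂ * delaySum x (t + 1) L = p₂ * (x t + delaySum x t L - x (t - L)) := by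
        rw [← hid]; ring
      nlinarith [mul_nonneg (sub_nonneg.2 hp.le) (sub_nonneg.2 hxt.2)]

lemma invariant (h : IsDelaySystem p₁ p₂ g Q α m t₁ T x) (h₂ : 0 < p₂) (hp : p₂ < p₁)
    (h₁ : p₁ < 1) (hm : m ≤ t₁) {b : ℕ} (hb : t₁ ≤ b) {lo hi : ℝ}
    (hw : ∀ s, b ≤ s → s ≤ b + m → s < T → lo ≤ x s ∧ x s ≤ hi) :
    ∀ s, b ≤ s → s < T → lo ≤ x s ∧ x s ≤ hi := by
  intro s
  induction s using Nat.strong_induction_on with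
  | _ s ih =>
    intro hbs hsT
    rcases le_or_gt s (b + m) with hs | hs
    · exact hw s hbs hs hsT
    · obtain ⟨t, rfl⟩ : ∃ t, s = t + 1 := ⟨s - 1, by omega⟩
      have hwin : ∀ s, t - m ≤ s → s ≤ t → lo ≤ x s ∧ x s ≤ hi := fun s h1 h2 =>
        ih s (by omega) (by omega) (by omega)
      obtain ⟨h1, h3⟩ := h.step h₂ hp hm (by omega) hsT hwin
      have h4 := hwin t (Nat.sub_le _ _) le_rfl
      constructor <;> nlinarith

/-- The oscillation over windows decreases geometrically. -/
lemma oscillation (h : IsDelaySystem p₁ p₂ g Q α m t₁ T x) (h₂ : 0 < p₂) (hp : p₂ < p₁)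
    (h₁ : p₁ < 1) (hm : m ≤ t₁) (n : ℕ) :
    ∃ lo hi : ℝ, hi - lo ≤ (1 - (1 - p₁) ^ (m + 1)) ^ n ∧ lo ≤ hi ∧
      ∀ s, t₁ + n * (m + 1) ≤ s → s < T → lo ≤ x s ∧ x s ≤ hi := by
  have hr0 : 0 < 1 - p₁ := by linarith
  have hr1 : 1 - p₁ < 1 := by linarith
  induction n with
  | zero => exact ⟨0, 1, by simp, zero_le_one, fun s _ hs => h.mem s hs⟩
  | succ n ih =>
    obtain ⟨lo, hi, hd, hle, hb⟩ := ih
    set t := t₁ + n * (m + 1) + m with ht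
    have hρ : 0 < (1 - p₁) ^ (m + 1) := pow_pos hr0 _
    have hρ1 : (1 - p₁) ^ (m + 1) ≤ 1 := pow_le_one₀ hr0.le hr1.le
    have hnext : t₁ + (n + 1) * (m + 1) = t + 1 := by rw [ht]; ring
    rw [hnext]
    by_cases htT : t < T
    · have hxt := hb t (by omega) htT
      -- Each step retains the fraction `1 - p₁` of the distance to each end. Over a full window of
      -- `m + 1` slots the two distances from `x t` are both retained up to `(1 - p₁) ^ (m + 1)`,
      -- and together they amount to that fraction of the width.
      have hj : ∀ j, t + j < T → lo + (1 - p₁) ^ j * (x t - lo) ≤ x (t + j) ∧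
          x (t + j) ≤ hi - (1 - p₁) ^ j * (hi - x t) := by
        intro j
        induction j with
        | zero => intro _; simp
        | succ j ihj =>
          intro hjT
          obtain ⟨h3, h4⟩ := ihj (by omega)
          obtain ⟨h5, h6⟩ := h.step h₂ hp hm (t := t + j) (by omega) (by omega) (lo := lo) (hi := hi)
            fun s hs1 hs2 => hb s (by omega) (by omega)
          rw [← add_assoc, pow_succ]
          constructor <;> nlinarith
      refine ⟨lo + (1 - p₁) ^ (m + 1) * (x t - lo), hi - (1 - p₁) ^ (m + 1) * (hi - x t), ?_, ?_,
        h.invariant h₂ hp h₁ hm (by omega) fun s hs1 hs2 hsT => ?_⟩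
      · rw [pow_succ _ n]
        have := mul_le_mul_of_nonneg_right hd (sub_nonneg.2 hρ1)
        linarith
      · nlinarith
      · obtain ⟨j, rfl⟩ : ∃ j, s = t + j := ⟨s - t, by omega⟩
        obtain ⟨h3, h4⟩ := hj j hsT
        have hpow : (1 - p₁) ^ (m + 1) ≤ (1 - p₁) ^ j :=
          pow_le_pow_of_le_one hr0.le hr1.le (by omega)
        constructor
        · nlinarith [mul_le_mul_of_nonneg_right hpow (sub_nonneg.2 hxt.1)]
        · nlinarith [mul_le_mul_of_nonneg_right hpow (sub_nonneg.2 hxt.2)]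
    · refine ⟨lo, lo, ?_, le_rfl, fun s hs1 hs2 => by omega⟩
      rw [sub_self]
      exact pow_nonneg (by linarith) _

end IsDelaySystem

/-- A stationary solution of the delay relations. -/
structure IsDelayEquilibrium (p₁ p₂ g Q α : ℝ) (m K : ℕ) (v : ℝ) : Prop where
  lower : ∀ L ≤ m, p₁ * (L * v) ≤ g - v ∨ Q - p₂ * (L * α - L * v) ≤ g - v
  upper : ∃ L ≤ K, g - v ≤ p₁ * (L * v) ∧ g - v ≤ Q - p₂ * (L * α - L * v)

lemma delaySum_ge {t L : ℕ} {v : ℝ} (hL : L ≤ t) (hx : ∀ s, t - L ≤ s → s < t → v ≤ x s) :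
    L * v ≤ delaySum x t L := by
  have := Finset.card_nsmul_le_sum (Finset.range L) (fun j => x (t - 1 - j)) v fun j hj =>
    hx _ (by have := Finset.mem_range.1 hj; omega) (by have := Finset.mem_range.1 hj; omega)
  simpa [delaySum] using this

lemma delaySum_le {t L : ℕ} {v : ℝ} (hL : L ≤ t) (hx : ∀ s, t - L ≤ s → s < t → x s ≤ v) :
    delaySum x t L ≤ L * v := by
  have := Finset.sum_le_card_nsmul (Finset.range L) (fun j => x (t - 1 - j)) v fun j hj =>
    hx _ (by have := Finset.mem_range.1 hj; omega) (by have := Finset.mem_range.1 hj; omega)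
  simpa [delaySum] using this

/-- Solutions of the delay relations converge to the equilibrium, uniformly. -/
theorem exists_time_near_equilibrium (h₂ : 0 < p₂) (hp : p₂ < p₁) (h₁ : p₁ < 1) (hm : m ≤ t₁)
    {K : ℕ} {v : ℝ} (hv : IsDelayEquilibrium p₁ p₂ g Q α m K v) {ε : ℝ} (hε : 0 < ε) :
    ∃ τ, ∀ (T : ℕ) (x : ℕ → ℝ), IsDelaySystem p₁ p₂ g Q α m t₁ T x →
      ∀ t, τ ≤ t → t < T → |x t - v| ≤ ε := by
  have hr0 : 0 < (1 - p₁) ^ (m + 1) := pow_pos (by linarith) _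
  have hr1 : (1 - p₁) ^ (m + 1) ≤ 1 := pow_le_one₀ (by linarith) (by linarith)
  obtain ⟨n, hn⟩ := exists_pow_lt_of_lt_one hε (by linarith : 1 - (1 - p₁) ^ (m + 1) < 1)
  refine ⟨t₁ + n * (m + 1) + m + K, fun T x h t ht htT => ?_⟩
  obtain ⟨lo, hi, hd, -, hb⟩ := h.oscillation h₂ hp h₁ hm n
  have hwin : ∀ s, t₁ + n * (m + 1) ≤ s → s ≤ t → |x s - x t| ≤ ε := fun s hs1 hs2 => by
    have h3 := hb s hs1 (by omega)
    have h4 := hb t (by omega) htT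
    rw [abs_le]
    constructor <;> linarith
  rw [abs_le]
  constructor
  -- If `x t` were below `v - ε`, the small oscillation would put the whole window below `v`. Both
  -- affine functions increase with the delay sum, so the idle mass would be at most its equilibrium
  -- value `g - v`, forcing `x t ≥ v`. The other side is symmetric.
  · by_contra hlt
    push Not at hlt
    obtain ⟨L, hL, hu1, hu2⟩ := h.upper t (by omega) htT
    have hs : delaySum x t L ≤ L * v := delaySum_le (by omega) fun s hs1 hs2 => by
      have := (abs_le.1 (hwin s (by omega) (by omega))).2
      linarith
    have h3 := mul_le_mul_of_nonneg_left hs (h₂.trans hp).le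
    have h4 := mul_le_mul_of_nonneg_left hs h₂.le
    rcases hv.lower L hL with h5 | h5 <;> linarith
  · by_contra hlt
    push Not at hlt
    obtain ⟨L, hL, hu1, hu2⟩ := hv.upper
    have hs : L * v ≤ delaySum x t L := delaySum_ge (by omega) fun s hs1 hs2 => by
      have := (abs_le.1 (hwin s (by omega) (by omega))).1
      linarith
    have h3 := mul_le_mul_of_nonneg_left hs (h₂.trans hp).le
    have h4 := mul_le_mul_of_nonneg_left hs h₂.le
    rcases h.lower t (by omega) htT L (by omega) with h5 | h5 <;> linarith

end delay

/-! ### Fluid paths become nearly optimal -/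

section nearOptimal

variable {p : Fin 2 → unitInterval} {γ : Fin 2 → ℝ} {α W θ : ℝ} {m S T : ℕ}
  {z a : ℕ → Fin 2 → ℕ → ℝ}

/-- The idle mass of class `k` at ages at which all optimal policies schedule. -/
def lateIdle (p : Fin 2 → unitInterval) (W : ℝ) (S : ℕ) (z a : Fin 2 → ℕ → ℝ) (k : Fin 2) : ℝ :=
  ∑ i ∈ Finset.range S, if i < upperThreshold (p k) W then 0 else z k i - a k i

/-- The scheduled mass of class `k` at ages at which no optimal policy schedules. -/
def earlySched (p : Fin 2 → unitInterval) (W : ℝ) (S : ℕ) (a : Fin 2 → ℕ → ℝ) (k : Fin 2) : ℝ :=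
  ∑ i ∈ Finset.range S, if i < lowerThreshold (p k) W then a k i else 0

lemma sum_ite_lt {w : ℕ → ℝ} (hS : ∀ i, S ≤ i → w i = 0) (n : ℕ) :
    ∑ i ∈ Finset.range S, (if i < n then w i else 0) = ∑ i ∈ Finset.range n, w i := by
  rw [← sum_range_eq_of_vanish (w := fun i => if i < n then w i else 0) (n := n)]
  · exact Finset.sum_congr rfl fun i hi => if_pos (Finset.mem_range.1 hi)
  · exact fun _ hi => if_neg (not_lt.2 hi)
  · intro i hi
    simp [hS i hi]

variable {prec : Fin 2 × ℕ → Fin 2 × ℕ → Prop} {z₁ a₁ : Fin 2 → ℕ → ℝ}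

lemma lateIdle_eq (h : IsAllocation γ α prec S z₁ a₁) (k) :
    lateIdle p W S z₁ a₁ k = idleMass S z₁ a₁ k
      - ∑ i ∈ Finset.range (upperThreshold (p k) W), (z₁ k i - a₁ k i) := by
  rw [← sum_ite_lt (S := S) (w := fun i => z₁ k i - a₁ k i) fun i hi => h.idle_far k hi]
  unfold lateIdle idleMass
  rw [← Finset.sum_sub_distrib]
  refine Finset.sum_congr rfl fun i _ => ?_
  split_ifs <;> ring

lemma earlySched_eq (h : IsAllocation γ α prec S z₁ a₁) (k) :
    earlySched p W S a₁ k = ∑ i ∈ Finset.range (lowerThreshold (p k) W), a₁ k i :=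
  sum_ite_lt (fun _ hi => h.a_far k hi) _

/-- The deviation of `α` from the rate of the policy that schedules everybody older than `1`. -/
def slack (p : Fin 2 → unitInterval) (γ : Fin 2 → ℝ) (α : ℝ) : ℝ :=
  α - γ 0 / (1 + p 0) - γ 1 / (1 + p 1)

/-- The births of the next slot minus the number of places that stay unscheduled. -/
def excess (p : Fin 2 → unitInterval) (α : ℝ) (S : ℕ) (a : ℕ → Fin 2 → ℕ → ℝ) (t : ℕ) : ℝ :=
  p 0 * schedMass S (a t) 0 + p 1 * schedMass S (a t) 1 - (1 - α)

lemma upperThreshold_one {q : ℝ} (hq : 0 ≤ q) : upperThreshold q 1 = 2 := by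
  have h1 : 1 < upperThreshold q 1 := (lt_upperThreshold_iff hq zero_le_one 1).2 (by simp)
  have h2 : ¬ 2 < upperThreshold q 1 := by
    rw [lt_upperThreshold_iff hq zero_le_one, not_le]
    have := whittleIndex_strictMono hq (show 1 < 2 by norm_num)
    simpa using this
  omega

lemma lowerThreshold_one {q : ℝ} (hq : 0 ≤ q) : lowerThreshold q 1 = 1 := by
  have h1 := one_le_lowerThreshold q 1
  have h2 : ¬ 1 < lowerThreshold q 1 := by
    rw [lt_lowerThreshold_iff hq one_pos]
    simp
  omega

lemma upperRate_one (hp : ∀ k, 0 < (p k : ℝ)) :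
    upperRate p γ 1 = γ 0 / (1 + p 0) + γ 1 / (1 + p 1) := by
  unfold upperRate
  rw [scheduledRate_eq hp γ fun k => one_le_upperThreshold _ _, Fin.sum_univ_two,
    upperThreshold_one (hp 0).le, upperThreshold_one (hp 1).le]
  unfold thresholdRate
  have h : ∀ k, ((2 : ℕ) : ℝ) * p k + 1 - p k = 1 + p k := fun k => by push_cast; ring
  rw [h, h]
  ring

/-- The sign of the slack decides whether newborns are ever scheduled in equilibrium: `α` is at
least the rate of scheduling everybody older than one exactly when the price is the smallest index,
`1`. -/
lemma multiplier_eq_one (hp : ∀ k, 0 < (p k : ℝ)) (hγ : ∀ k, 0 < γ k)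
    (h : IsRelaxedSolution p γ α W θ) (hs : 0 ≤ slack p γ α) : W = 1 := by
  rcases h.one_le.eq_or_lt with h1 | h1
  · exact h1.symm
  · have h2 := lowerRate_le_upperRate_of_lt (p := p) hp hγ one_pos h1
    have h3 := (isRelaxedSolution_rates hp hγ h).2
    rw [upperRate_one hp] at h2
    unfold slack at hs
    linarith

lemma one_lt_multiplier (hp : ∀ k, 0 < (p k : ℝ)) (hγ : ∀ k, 0 < γ k)
    (h : IsRelaxedSolution p γ α W θ) (hs : slack p γ α < 0) : 1 < W := by
  refine lt_of_le_of_ne h.one_le fun h1 => ?_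
  have h3 := (isRelaxedSolution_rates hp hγ h).1
  rw [← h1, upperRate_one hp] at h3
  unfold slack at hs
  linarith

namespace IsFluidPath

variable (h : IsFluidPath (fun k => (p k : ℝ)) γ α (indexLess fun k => (p k : ℝ)) S T z a)
  (P : FluidParams (fun k => (p k : ℝ)) γ α m) (hS : 2 ≤ S)

include P in
lemma one_add_p_pos (k : Fin 2) : (0 : ℝ) < 1 + p k := by
  have := P.p_pos k
  linarith

include h P hS in
/-- The deviation of the scheduled mass of class `1` moves between two lines. -/
lemma deviation_step {t : ℕ} (ht : t + 1 < T) :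
    let d := fun t => schedMass S (a t) 0 - γ 0 / (1 + p 0)
    let σ := slack p γ α
    (-((p 0 : ℝ) * d t) ≤ d (t + 1) ∧ d (t + 1) ≤ (1 + p 1) * σ - p 1 * d t) ∨
      (d (t + 1) ≤ -((p 0 : ℝ) * d t) ∧ (1 + p 1) * σ - p 1 * d t ≤ d (t + 1)) := by
  intro d σ
  have e0 : (1 + (p 0 : ℝ)) * (γ 0 / (1 + p 0)) = γ 0 := mul_div_cancel₀ _ (one_add_p_pos P 0).ne'
  have e1 : (1 + (p 1 : ℝ)) * (γ 1 / (1 + p 1)) = γ 1 := mul_div_cancel₀ _ (one_add_p_pos P 1).ne'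
  have s0 := (h.alloc t (by omega)).schedMass_add
  have s1 := (h.alloc (t + 1) ht).schedMass_add
  have y0 : schedMass S (a t) 1 = α - schedMass S (a t) 0 := by linarith
  have y1 : schedMass S (a (t + 1)) 1 = α - schedMass S (a (t + 1)) 0 := by linarith
  simp only [d, σ, slack]
  set A := γ 0 / (1 + (p 0 : ℝ))
  set B := γ 1 / (1 + (p 1 : ℝ))
  rcases h.age_one_alternative P hS ht with h1 | h1
  · right
    have h2 := h1 0
    have h3 := h1 1
    rw [y0, y1] at h3
    constructor <;> nlinarith
  · left
    have h2 := h1 0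
    have h3 := h1 1
    rw [y0, y1] at h3
    constructor <;> nlinarith

include h P in
-- Eliminating class 2 by `x₁ + x₂ = α` writes the excess as the affine expression bounded by
-- `between_lines`.
lemma excess_eq {t : ℕ} (ht : t < T) : excess p α S a t
    = (1 + p 1) * slack p γ α
      + ((p 0 : ℝ) - p 1) * (schedMass S (a t) 0 - γ 0 / (1 + p 0)) := by
  have e0 : (1 + (p 0 : ℝ)) * (γ 0 / (1 + p 0)) = γ 0 := mul_div_cancel₀ _ (one_add_p_pos P 0).ne'
  have e1 : (1 + (p 1 : ℝ)) * (γ 1 / (1 + p 1)) = γ 1 := mul_div_cancel₀ _ (one_add_p_pos P 1).ne'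
  have s0 := (h.alloc t ht).schedMass_add
  have y0 : schedMass S (a t) 1 = α - schedMass S (a t) 0 := by linarith
  have hγ := P.γ_sum
  unfold excess slack
  rw [y0]
  set A := γ 0 / (1 + (p 0 : ℝ))
  set B := γ 1 / (1 + (p 1 : ℝ))
  linear_combination e0 + e1 + hγ

include P in
lemma abs_deviation_le (h0 : IsAllocation γ α prec S z₁ a₁) :
    |schedMass S a₁ 0 - γ 0 / (1 + p 0)| ≤ 1 := by
  have h1 := h0.schedMass_add
  have h2 := h0.schedMass_nonneg 0
  have h3 := h0.schedMass_nonneg 1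
  have h4 : 0 ≤ γ 0 / (1 + (p 0 : ℝ)) := div_nonneg (P.γ_pos 0).le (one_add_p_pos P 0).le
  have h5 : γ 0 / (1 + (p 0 : ℝ)) ≤ 1 := by
    rw [div_le_one (one_add_p_pos P 0)]
    have h6 := P.γ_pos 1
    have h7 := P.γ_sum
    have h8 : 0 < (p 0 : ℝ) := P.p_pos 0
    linarith
  have h9 := P.α_lt
  rw [abs_le]
  constructor <;> linarith

include h P hS in
-- For nonnegative slack the invariant interval of the deviation keeps the excess nonnegative; only
-- the decaying overshoot can make it negative.
lemma neg_pow_le_excess (hs : 0 ≤ slack p γ α) {t : ℕ} (ht : t < T) :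
    -(p 0 : ℝ) ^ t ≤ excess p α S a t := by
  obtain ⟨c, hc, -, hle⟩ := between_lines P.p₂_pos P.p_lt P.p₁_lt hs
    (d := fun t => schedMass S (a t) 0 - γ 0 / (1 + p 0))
    (abs_deviation_le P (h.alloc 0 (by omega))) fun t ht => h.deviation_step P hS ht
  rw [h.excess_eq P ht]
  have := hle t ht
  have := mul_nonneg hc.le hs
  linarith

end IsFluidPath

/-- If not everybody older than one can be scheduled, then eventually the births are fewer than
the unscheduled places. -/
lemma exists_excess_neg (P : FluidParams (fun k => (p k : ℝ)) γ α m) (hs : slack p γ α < 0) :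
    ∃ τ, ∀ (S T : ℕ) (z a : ℕ → Fin 2 → ℕ → ℝ), 2 ≤ S →
      IsFluidPath (fun k => (p k : ℝ)) γ α (indexLess fun k => (p k : ℝ)) S T z a →
      ∀ t, τ ≤ t → t < T → excess p α S a t < 0 := by
  have hp0 : 0 < (p 0 : ℝ) := P.p_pos 0
  have hp1 : 0 < (p 1 : ℝ) := P.p_pos 1
  have hlt : (p 1 : ℝ) < p 0 := P.p_lt
  have hlt1 : (p 0 : ℝ) < 1 := P.p₁_lt
  set c := (1 - (p 0 : ℝ) ^ 2) * (1 + p 1) / (1 - p 0 * p 1) with hc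
  have hc0 : 0 < c := div_pos (mul_pos (by nlinarith) (by linarith)) (by nlinarith)
  obtain ⟨τ, hτ⟩ := exists_pow_lt_of_lt_one (mul_pos hc0 (neg_pos.2 hs)) hlt1
  refine ⟨τ, fun S T z a hS h t ht htT => ?_⟩
  -- Negating the deviation and the slack exchanges the two alternatives and reduces to the case of
  -- nonnegative slack.
  obtain ⟨c', -, hc', hle⟩ := between_lines hp1 hlt hlt1 (neg_pos.2 hs).le
    (d := fun t => -(schedMass S (a t) 0 - γ 0 / (1 + p 0)))
    (by rw [abs_neg]; exact IsFluidPath.abs_deviation_le P (h.alloc 0 (by omega)))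
    fun t ht => by
      have h3 := h.deviation_step P hS ht
      simp only at h3 ⊢
      rcases h3 with ⟨h4, h5⟩ | ⟨h4, h5⟩
      · right
        constructor <;> linarith
      · left
        constructor <;> linarith
  have h5 := hle t htT
  rw [hc', ← hc] at h5
  rw [h.excess_eq P htT]
  have hpow : (p 0 : ℝ) ^ t ≤ (p 0 : ℝ) ^ τ := pow_le_pow_of_le_one hp0.le hlt1.le ht
  nlinarith

namespace IsFluidPath

variable (h : IsFluidPath (fun k => (p k : ℝ)) γ α (indexLess fun k => (p k : ℝ)) S T z a)
  (P : FluidParams (fun k => (p k : ℝ)) γ α m) (hS : 2 ≤ S)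

lemma excess_birth {t : ℕ} (h : IsFluidPath (fun k => (p k : ℝ)) γ α
    (indexLess fun k => (p k : ℝ)) S T z a) (hS : 2 ≤ S) (ht : t < T) :
    z (t + 1) 0 1 + z (t + 1) 1 1 = excess p α S a t + (1 - α) := by
  rw [h.birth hS ht, h.birth hS ht, excess]
  ring

include h P hS in
lemma age_one_idle {t : ℕ} (ht : t + 1 < T) (he : excess p α S a t < 0) (k) :
    a (t + 1) k 1 = 0 := by
  have hA := h.alloc (t + 1) ht
  have hm := P.m_pos
  rcases hA.dichotomy P.p₂_pos P.p_lt (P.cast_lt (by omega : 1 ≤ m + 1)) with h1 | h1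
  · exact h1 k 1 le_rfl
  · exfalso
    have h2 : ∀ k, idleMass S (z (t + 1)) (a (t + 1)) k = z (t + 1) k 1 - a (t + 1) k 1 := fun k => by
      rw [← hA.partial_idle_eq k (n := 2) fun i hi => h1 k i hi]
      simp [Finset.sum_range_succ, hA.zero, hA.a_eq_zero (hA.zero k)]
    have h3 := hA.idleMass_add P.γ_sum
    have h4 := h.excess_birth hS (by omega : t < T)
    rw [h2, h2] at h3
    linarith [hA.nonneg 0 1, hA.nonneg 1 1]

end IsFluidPath

/-- The scheduled masses of the mixture `z*` solve the delay relations. -/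
lemma isDelayEquilibrium_mixedRate (P : FluidParams (fun k => (p k : ℝ)) γ α m)
    (h : IsRelaxedSolution p γ α W θ) (hW : 1 < W) :
    IsDelayEquilibrium (p 0) (p 1) (γ 0) (1 - α) α m (upperThreshold (p 0) W)
      (γ 0 * mixedRate p W θ 0) := by
  have hp : ∀ k, 0 < (p k : ℝ) := P.p_pos
  have hW0 : 0 < W := zero_lt_one.trans hW
  have hsum := h.sum_mixedRate hp
  rw [Fin.sum_univ_two] at hsum
  have hγ := P.γ_sum
  have hlt : (p 1 : ℝ) < p 0 := P.p_lt
  have hb : ∀ k, ((lowerThreshold (p k) W : ℝ) - 1) * (p k * (γ k * mixedRate p W θ k))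
      ≤ γ k - γ k * mixedRate p W θ k ∧ γ k - γ k * mixedRate p W θ k
      ≤ ((upperThreshold (p k) W : ℝ) - 1) * (p k * (γ k * mixedRate p W θ k)) := fun k => by
    obtain ⟨h1, h2⟩ := mixedRate_births hp h.one_le h.2.1.le h.2.2.1 k
    have h3 := mul_le_mul_of_nonneg_left h1 (P.γ_pos k).le
    have h4 := mul_le_mul_of_nonneg_left h2 (P.γ_pos k).le
    constructor <;> linarith
  have hpos : ∀ k, 0 < (p k : ℝ) * (γ k * mixedRate p W θ k) := fun k =>
    mul_pos (hp k) (mul_pos (P.γ_pos k) (mixedRate_pos hp h.one_le h.2.1.le h.2.2.1 k))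
  set v := γ 0 * mixedRate p W θ 0
  set w := γ 1 * mixedRate p W θ 1
  have hα : α = v + w := hsum.symm
  constructor
  · intro L hL
    rcases lt_or_ge L (lowerThreshold (p 0) W) with h1 | h1
    · left
      have h2 : (L : ℝ) ≤ lowerThreshold (p 0) W - 1 := by
        have : (L : ℝ) + 1 ≤ lowerThreshold (p 0) W := by exact_mod_cast h1
        linarith
      have := mul_le_mul_of_nonneg_right h2 (hpos 0).le
      linarith [(hb 0).1]
    · right
      -- From the lower threshold of class 1 on, alternation gives `W ≤ W¹(L) < W²(L + 1)`. So class
      -- 2 idles for at most `L` slots of births.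
      have h3 : W ≤ whittleIndex (p 0) L := by
        by_contra hlt'
        push Not at hlt'
        exact absurd ((lt_lowerThreshold_iff (hp 0).le hW0 L).2 hlt') (not_lt.2 h1)
      have h4 := whittleIndex_lt_succ_of_lt_alternationBound hlt
        (P.cast_lt (hL.trans (Nat.le_succ m)))
      have h5 : ¬ L + 1 < upperThreshold (p 1) W := by
        rw [lt_upperThreshold_iff (hp 1).le hW0.le, not_le]
        exact h3.trans_lt h4
      have h6 : (upperThreshold (p 1) W : ℝ) - 1 ≤ L := by
        have : (upperThreshold (p 1) W : ℝ) ≤ L + 1 := by exact_mod_cast not_lt.1 h5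
        linarith
      have := mul_le_mul_of_nonneg_right h6 (hpos 1).le
      have h7 := (hb 1).2
      have h8 : (p 1 : ℝ) * (L * α - L * v) = L * (p 1 * w) := by rw [hα]; ring
      rw [h8]
      linarith
  -- Class 2 has the smaller index at ages `≥ 2`, so its thresholds are larger; at age `1`, where
  -- the indices agree, `1 < W` is needed. The common cut is then the last age at which class 1 may
  -- idle.
  · have h1 : upperThreshold (p 0) W ≤ lowerThreshold (p 1) W := by
      refine le_of_forall_lt fun i hi => ?_
      rw [lt_upperThreshold_iff (hp 0).le hW0.le] at hi
      rw [lt_lowerThreshold_iff (hp 1).le hW0]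
      rcases lt_or_ge i 2 with h2 | h2
      · interval_cases i
        · simpa using hW0
        · simpa using hW
      · exact (whittleIndex_lt_of_lt hlt h2).trans_le hi
    have h2 := one_le_upperThreshold (p 0) W
    refine ⟨upperThreshold (p 0) W - 1, Nat.sub_le _ _, ?_, ?_⟩
    · rw [Nat.cast_sub h2, Nat.cast_one]
      linarith [(hb 0).2]
    · rw [Nat.cast_sub h2, Nat.cast_one]
      have h3 : (upperThreshold (p 0) W : ℝ) - 1 ≤ lowerThreshold (p 1) W - 1 := by
        have : (upperThreshold (p 0) W : ℝ) ≤ lowerThreshold (p 1) W := by exact_mod_cast h1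
        linarith
      have := mul_le_mul_of_nonneg_right h3 (hpos 1).le
      have h7 := (hb 1).1
      have h8 : (p 1 : ℝ) * (((upperThreshold (p 0) W : ℝ) - 1) * α
          - ((upperThreshold (p 0) W : ℝ) - 1) * v)
          = ((upperThreshold (p 0) W : ℝ) - 1) * (p 1 * w) := by rw [hα]; ring
      rw [h8]
      linarith

namespace IsFluidPath

lemma recent_one_eq (h : IsFluidPath (fun k => (p k : ℝ)) γ α
    (indexLess fun k => (p k : ℝ)) S T z a) {t : ℕ} (ht : t < T) (L : ℕ) :
    recent S a 1 t L = L * α - recent S a 0 t L := by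
  have : ∀ j ∈ Finset.range L, schedMass S (a (t - 1 - j)) 1
      = α - schedMass S (a (t - 1 - j)) 0 := fun j _ => by
    linarith [(h.alloc (t - 1 - j) (by omega)).schedMass_add]
  unfold recent
  rw [Finset.sum_congr rfl this, Finset.sum_sub_distrib]
  simp

/-- Since the two scheduled masses add up to `α`, the recent births of class 2 are a function of
those of class 1, and the cuts of both idle masses become relations for class 1 alone. -/
lemma isDelaySystem (h : IsFluidPath (fun k => (p k : ℝ)) γ α
    (indexLess fun k => (p k : ℝ)) S T z a) (P : FluidParams (fun k => (p k : ℝ)) γ α m)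
    (hS : 2 ≤ S) {τ : ℕ} (hτ : ∀ t, τ ≤ t → t < T → ∀ k, a t k 1 = 0) :
    IsDelaySystem (p 0) (p 1) (γ 0) (1 - α) α m (τ + m) T fun t => schedMass S (a t) 0 where
  mem t ht := by
    have hA := h.alloc t ht
    have := hA.schedMass_add
    have := hA.schedMass_nonneg 1
    have := P.α_lt
    exact ⟨hA.schedMass_nonneg 0, by linarith⟩
  lower t hτt ht L hL := by
    have hA := h.alloc t ht
    have h1 := hA.idleMass_add P.γ_sum
    have h2 := h.recent_one_eq ht L
    change (p 0 : ℝ) * recent S a 0 t L ≤ _ ∨ _ - (p 1 : ℝ) * (L * α - recent S a 0 t L) ≤ _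
    rw [← h2, ← hA.idleMass_eq]
    rcases h.idle_alternative P hS ht (by omega) hL with h3 | h3
    · exact Or.inl h3
    · exact Or.inr (by linarith)
  upper t hτt ht := by
    have hA := h.alloc t ht
    have h1 := hA.idleMass_add P.γ_sum
    obtain ⟨L, hL, h3, h4⟩ := h.exists_idle_cut P hS hτ ht hτt
    have h2 := h.recent_one_eq ht L
    refine ⟨L, hL, ?_, ?_⟩
    · rw [← hA.idleMass_eq]
      exact h3
    · change _ ≤ _ - (p 1 : ℝ) * (L * α - recent S a 0 t L)
      rw [← h2, ← hA.idleMass_eq]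
      linarith

end IsFluidPath

/-- All fluid paths end up using nearly optimal decisions only. -/
theorem exists_time_nearOptimal (P : FluidParams (fun k => (p k : ℝ)) γ α m)
    (hsol : IsRelaxedSolution p γ α W θ) {ε : ℝ} (hε : 0 < ε) :
    ∃ τ, ∀ (S T : ℕ) (z a : ℕ → Fin 2 → ℕ → ℝ), 2 ≤ S →
      IsFluidPath (fun k => (p k : ℝ)) γ α (indexLess fun k => (p k : ℝ)) S T z a →
      ∀ t, τ ≤ t → t < T → ∀ k,
        lateIdle p W S (z t) (a t) k ≤ ε ∧ earlySched p W S (a t) k ≤ ε := by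
  have hp : ∀ k, 0 < (p k : ℝ) := P.p_pos
  have hm := P.m_pos
  -- For nonnegative slack the thresholds are `1` and `2`, and only idle users older than one count.
  -- If such users exist, all newborns are idle too, and their mass misses `1 - α` by at most `p₁ ^
  -- t`. For negative slack newborns are eventually never scheduled and the delay relations apply.
  rcases le_or_gt 0 (slack p γ α) with hs | hs
  · obtain rfl := multiplier_eq_one hp P.γ_pos hsol hs
    obtain ⟨τ, hτ⟩ := exists_pow_lt_of_lt_one hε P.p₁_lt
    refine ⟨τ + 1, fun S T z a hS h t ht htT k => ?_⟩
    obtain ⟨t, rfl⟩ : ∃ s, t = s + 1 := ⟨t - 1, by omega⟩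
    have hA := h.alloc (t + 1) htT
    rw [lateIdle_eq hA, earlySched_eq hA, upperThreshold_one (hp k).le,
      lowerThreshold_one (hp k).le]
    constructor
    · rcases hA.dichotomy P.p₂_pos P.p_lt (P.cast_lt (by omega : 1 ≤ m + 1)) with h1 | h1
      · have h2 : ∀ k, ∑ i ∈ Finset.range 2, (z (t + 1) k i - a (t + 1) k i)
            = z (t + 1) k 1 := fun k => by
          simp [Finset.sum_range_succ, hA.zero, hA.a_eq_zero (hA.zero k), h1 k 1 le_rfl]
        have h3 := hA.idleMass_add P.γ_sum
        have h4 := h.excess_birth hS (by omega : t < T)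
        have h5 := h.neg_pow_le_excess P hS hs (by omega : t < T)
        have h6 : (p 0 : ℝ) ^ t ≤ (p 0 : ℝ) ^ τ :=
          pow_le_pow_of_le_one (hp 0).le P.p₁_lt.le (by omega)
        have h7 : ∀ k, z (t + 1) k 1 ≤ idleMass S (z (t + 1)) (a (t + 1)) k := fun k => by
          rw [← h2 k]
          exact hA.partial_idle_le k 2
        have h8 := h7 0
        have h9 := h7 1
        rw [h2 k]
        have h10 : ∀ k, idleMass S (z (t + 1)) (a (t + 1)) k - z (t + 1) k 1 ≤ ε := by
          intro k
          fin_cases k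
          · change idleMass S (z (t + 1)) (a (t + 1)) 0 - z (t + 1) 0 1 ≤ ε
            linarith
          · change idleMass S (z (t + 1)) (a (t + 1)) 1 - z (t + 1) 1 1 ≤ ε
            linarith
        exact h10 k
      · rw [hA.partial_idle_eq k fun i hi => h1 k i hi, sub_self]
        exact hε.le
    · rw [Finset.sum_range_one, hA.a_eq_zero (hA.zero k)]
      exact hε.le
  · have hW := one_lt_multiplier hp P.γ_pos hsol hs
    obtain ⟨τ₀, hτ₀⟩ := exists_excess_neg P hs
    set U := upperThreshold (p 0) W + upperThreshold (p 1) W with hU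
    have hUk : ∀ k, upperThreshold (p k) W ≤ U := fun k => by
      fin_cases k
      · exact Nat.le_add_right _ _
      · exact Nat.le_add_left _ _
    -- Counting the births of `L ≤ U` slots costs at most `L δ`, and the current scheduled mass
    -- another `δ`; hence the divisor `U + 1`.
    have hδ : 0 < ε / (U + 1) := by positivity
    obtain ⟨τ₁, hτ₁⟩ := exists_time_near_equilibrium (t₁ := τ₀ + 1 + m) P.p₂_pos P.p_lt P.p₁_lt
      (Nat.le_add_left m _) (isDelayEquilibrium_mixedRate P hsol hW) hδ
    refine ⟨τ₁ + m + U, fun S T z a hS h t ht htT k => ?_⟩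
    set δ := ε / (U + 1) with hδ'
    have hA := h.alloc t htT
    have hnear0 := hτ₁ T _ (h.isDelaySystem P hS fun t ht htT k => by
      obtain ⟨s, rfl⟩ : ∃ s, t = s + 1 := ⟨t - 1, by omega⟩
      exact h.age_one_idle P hS htT (hτ₀ S T z a hS h s (by omega) (by omega)) k)
    have hnear : ∀ k s, τ₁ ≤ s → s < T →
        |schedMass S (a s) k - γ k * mixedRate p W θ k| ≤ δ := by
      intro k s hs hsT
      have h1 := hnear0 s hs hsT
      fin_cases k
      · exact h1
      · have h2 := (h.alloc s hsT).schedMass_add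
        have h3 := hsol.sum_mixedRate hp
        rw [Fin.sum_univ_two] at h3
        have h4 : schedMass S (a s) 1 - γ 1 * mixedRate p W θ 1
            = -(schedMass S (a s) 0 - γ 0 * mixedRate p W θ 0) := by linarith
        change |schedMass S (a s) 1 - γ 1 * mixedRate p W θ 1| ≤ δ
        rw [h4, abs_neg]
        exact h1
    have hrec : ∀ L ≤ U, L * (γ k * mixedRate p W θ k - δ) ≤ IsFluidPath.recent S a k t L ∧
        IsFluidPath.recent S a k t L ≤ L * (γ k * mixedRate p W θ k + δ) := fun L hL =>
      ⟨delaySum_ge (x := fun s => schedMass S (a s) k) (by omega) fun s hs1 hs2 => by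
          linarith [(abs_le.1 (hnear k s (by omega) (by omega))).1],
        delaySum_le (x := fun s => schedMass S (a s) k) (by omega) fun s hs1 hs2 => by
          linarith [(abs_le.1 (hnear k s (by omega) (by omega))).2]⟩
    have halt : ∀ L ≤ U, (∀ k i, L < i → z t k i - a t k i = 0) ∨
        ((∀ k i, i ≤ L → a t k i = 0) ∧
          ∀ k, ∑ i ∈ Finset.range (L + 1), (z t k i - a t k i) = p k * IsFluidPath.recent S a k t L) := by
      intro L hL
      rcases le_total L m with hLm | hLm
      · exact h.dichotomy_births P hS htT hLm (by omega)
      · exact Or.inl fun k i hi => h.idle_young P hS htT (by omega) k (by omega)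
    obtain ⟨hb1, hb2⟩ := mixedRate_births hp hsol.one_le hsol.2.1.le hsol.2.2.1 k
    have hb1 := mul_le_mul_of_nonneg_left hb1 (P.γ_pos k).le
    have hb2 := mul_le_mul_of_nonneg_left hb2 (P.γ_pos k).le
    have hnt := abs_le.1 (hnear k t (by omega) htT)
    have hpk1 : (p k : ℝ) ≤ 1 := (p k).2.2
    have hscale : ∀ L ≤ U, ((L : ℝ) + 1) * δ ≤ ε := fun L hL => by
      have h1 : (L : ℝ) + 1 ≤ U + 1 := by
        have : (L : ℝ) ≤ U := by exact_mod_cast hL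
        linarith
      calc ((L : ℝ) + 1) * δ ≤ (U + 1) * δ := mul_le_mul_of_nonneg_right h1 hδ.le
        _ = ε := by rw [hδ']; field_simp
    have hpδ : ∀ L : ℕ, (p k : ℝ) * (L * δ) ≤ L * δ := fun L =>
      mul_le_of_le_one_left (by positivity) hpk1
    rw [lateIdle_eq hA, earlySched_eq hA]
    constructor
    · have h1 := one_le_upperThreshold (p k) W
      obtain ⟨L, hL⟩ : ∃ L, upperThreshold (p k) W = L + 1 := ⟨upperThreshold (p k) W - 1, by omega⟩
      have hLU : L ≤ U := by
        have := hUk k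
        omega
      rw [hL] at hb2 ⊢
      push_cast at hb2
      rcases halt L hLU with h2 | ⟨-, h2⟩
      · rw [hA.partial_idle_eq k fun i hi => h2 k i hi, sub_self]
        exact hε.le
      · rw [h2 k, hA.idleMass_eq]
        have h3 := mul_le_mul_of_nonneg_left (hrec L hLU).1 (hp k).le
        have h4 := hscale L hLU
        have h5 := hpδ L
        nlinarith
    · have h1 := one_le_lowerThreshold (p k) W
      obtain ⟨L, hL⟩ : ∃ L, lowerThreshold (p k) W = L + 1 := ⟨lowerThreshold (p k) W - 1, by omega⟩
      have hLU : L ≤ U := by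
        have := hUk k
        have := lowerThreshold_le_upperThreshold (hp k).le (zero_lt_one.trans hW)
        omega
      rw [hL] at hb1 ⊢
      push_cast at hb1
      rcases halt L hLU with h2 | ⟨h2, -⟩
      · have h3 := hA.partial_idle_eq k (n := L + 1) fun i hi => h2 k i hi
        have h4 := h.young_mass_le P hS htT (by omega : L ≤ t) k
        rw [Finset.sum_sub_distrib, hA.idleMass_eq] at h3
        have h5 := mul_le_mul_of_nonneg_left (hrec L hLU).2 (hp k).le
        have h6 := hscale L hLU
        have h7 := hpδ L
        nlinarith
      · rw [Finset.sum_eq_zero fun i hi => h2 k i (Nat.lt_succ_iff.1 (Finset.mem_range.1 hi))]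
        exact hε.le

end nearOptimal

/-! ### The average cost of fluid paths -/

section cost

variable {p : Fin 2 → unitInterval} {γ : Fin 2 → ℝ} {α W θ : ℝ} {m S T : ℕ}
  {z a : ℕ → Fin 2 → ℕ → ℝ}

/-- The total age of class `k`. -/
def ageMass (S : ℕ) (z : Fin 2 → ℕ → ℝ) (k : Fin 2) : ℝ := ∑ i ∈ Finset.range S, z k i * i

/-- The relative value of the state of class `k`. -/
def valueMass (p : Fin 2 → unitInterval) (W : ℝ) (S : ℕ) (z : Fin 2 → ℕ → ℝ) (k : Fin 2) : ℝ :=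
  ∑ i ∈ Finset.range S, z k i * relValue (p k) (lowerThreshold (p k) W) W i

/-- The loss of the decisions for class `k`. -/
def gapMass (p : Fin 2 → unitInterval) (W : ℝ) (S : ℕ) (z a : Fin 2 → ℕ → ℝ) (k : Fin 2) : ℝ :=
  ∑ i ∈ Finset.range S, ((z k i - a k i) * passiveGap (p k) (lowerThreshold (p k) W) W i
    + a k i * activeGap (p k) (lowerThreshold (p k) W) W i)

namespace IsFluidPath

/-- The Bellman identity for the fluid. Summed over time it reduces the average cost to that of `z*`
plus the average loss. -/
lemma value_step (h : IsFluidPath (fun k => (p k : ℝ)) γ α (indexLess fun k => (p k : ℝ)) S T z a)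
    (hS : 2 ≤ S) {t : ℕ} (ht : t < T) (k) :
    valueMass p W S (z (t + 1)) k + ageMass S (z t) k + W * schedMass S (a t) k
      = γ k * classGain p W k + valueMass p W S (z t) k + gapMass p W S (z t) (a t) k := by
  have hA := h.alloc t ht
  unfold valueMass
  rw [(h.step t ht).sum_mul hA hS k, relValue_one (one_le_lowerThreshold _ _), ← hA.mass k,
    mul_zero, zero_add]
  unfold ageMass schedMass gapMass classGain
  rw [Finset.mul_sum, Finset.sum_mul, ← Finset.sum_add_distrib, ← Finset.sum_add_distrib,
    ← Finset.sum_add_distrib, ← Finset.sum_add_distrib]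
  refine Finset.sum_congr rfl fun i _ => ?_
  unfold passiveGap activeGap
  ring

lemma ageMass_succ (h : IsFluidPath (fun k => (p k : ℝ)) γ α
    (indexLess fun k => (p k : ℝ)) S T z a) (hS : 2 ≤ S) {t : ℕ} (ht : t < T) (k) :
    ageMass S (z (t + 1)) k
      = ageMass S (z t) k + γ k - p k * ∑ i ∈ Finset.range S, a t k i * i := by
  have hA := h.alloc t ht
  unfold ageMass
  rw [(h.step t ht).sum_mul hA hS k, h.birth hS ht, ← hA.mass k]
  have : ∑ i ∈ Finset.range S, (z t k i - p k * a t k i) * ((i + 1 : ℕ) : ℝ)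
      = ∑ i ∈ Finset.range S, z t k i * i + ∑ i ∈ Finset.range S, z t k i
        - p k * ∑ i ∈ Finset.range S, a t k i * i - p k * schedMass S (a t) k := by
    unfold schedMass
    rw [Finset.mul_sum, Finset.mul_sum, ← Finset.sum_add_distrib, ← Finset.sum_sub_distrib,
      ← Finset.sum_sub_distrib]
    refine Finset.sum_congr rfl fun i _ => ?_
    push_cast
    ring
  rw [this]
  push_cast
  ring

lemma γ_le_one (P : FluidParams (fun k => (p k : ℝ)) γ α m) (k) : γ k ≤ 1 := by
  have h0 := P.γ_pos 0
  have h1 := P.γ_pos 1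
  have := P.γ_sum
  fin_cases k
  · change γ 0 ≤ 1
    linarith
  · change γ 1 ≤ 1
    linarith

/-- The mean age stays bounded. -/
lemma ageMass_le (h : IsFluidPath (fun k => (p k : ℝ)) γ α (indexLess fun k => (p k : ℝ)) S T z a)
    (P : FluidParams (fun k => (p k : ℝ)) γ α m) (hS : 2 ≤ S) {A : ℝ} (hA0 : 0 ≤ A) (k)
    (hA : ageMass S (z 0) k ≤ A) :
    ∀ t ≤ T, ageMass S (z t) k ≤ A + (min t m : ℕ) + (m + 1 / p k) := by
  have hpk : 0 < (p k : ℝ) := P.p_pos k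
  have hpk1 : (p k : ℝ) ≤ 1 := (p k).2.2
  have hγ1 := γ_le_one P k
  have hγ0 := P.γ_pos k
  have hm0 : (0 : ℝ) ≤ m := Nat.cast_nonneg m
  intro t
  induction t with
  | zero =>
    intro _
    have h1 : 0 < 1 / (p k : ℝ) := one_div_pos.2 hpk
    rw [Nat.zero_min, Nat.cast_zero]
    linarith
  | succ t ih =>
    intro ht
    have hal := h.alloc t (by omega)
    have ih := ih (by omega)
    rw [h.ageMass_succ hS (by omega) k]
    -- In the first `m` slots only growth by at most `γ k ≤ 1` per slot is known. Afterwards idle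
    -- ages are at most `m`, so nearly all of the age mass is scheduled and contracts by the factor
    -- `1 - p`; the bound `B` satisfies `1 + p m ≤ p B` and is preserved.
    rcases lt_or_ge t m with htm | htm
    · have h1 : 0 ≤ p k * ∑ i ∈ Finset.range S, a t k i * i :=
        mul_nonneg hpk.le (Finset.sum_nonneg fun i _ => mul_nonneg (hal.nonneg k i) (Nat.cast_nonneg i))
      rw [min_eq_left htm.le] at ih
      rw [min_eq_left (Nat.succ_le_of_lt htm)]
      push_cast
      linarith
    · rw [min_eq_right htm] at ih
      rw [min_eq_right (htm.trans (Nat.le_succ t))]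
      have h1 : ageMass S (z t) k - m ≤ ∑ i ∈ Finset.range S, a t k i * i := by
        have h2 : ∑ i ∈ Finset.range S, (z t k i - a t k i) * i
            ≤ ∑ i ∈ Finset.range S, (z t k i - a t k i) * m := by
          refine Finset.sum_le_sum fun i _ => ?_
          rcases le_or_gt i m with him | him
          · exact mul_le_mul_of_nonneg_left (by exact_mod_cast him) (hal.idle_nonneg k i)
          · rw [h.idle_young P hS (by omega) htm k him, zero_mul, zero_mul]
        rw [← Finset.sum_mul] at h2
        have h3 : idleMass S (z t) (a t) k ≤ 1 := by
          rw [hal.idleMass_eq]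
          linarith [hal.schedMass_nonneg k]
        have h4 : ∑ i ∈ Finset.range S, (z t k i - a t k i) * i
            = ageMass S (z t) k - ∑ i ∈ Finset.range S, a t k i * i := by
          unfold ageMass
          rw [← Finset.sum_sub_distrib]
          exact Finset.sum_congr rfl fun i _ => by ring
        rw [h4] at h2
        unfold idleMass at h3
        nlinarith
      have h5 := mul_le_mul_of_nonneg_left h1 hpk.le
      set B := A + (m : ℝ) + (m + 1 / p k) with hB
      have h6 : 1 + (p k : ℝ) * m ≤ p k * B := by
        have h7 : (p k : ℝ) * (1 / p k) = 1 := mul_one_div_cancel hpk.ne'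
        rw [hB]
        nlinarith [mul_nonneg hpk.le hA0, mul_nonneg hpk.le hm0]
      nlinarith [mul_le_mul_of_nonneg_left ih (sub_nonneg.2 hpk1)]

end IsFluidPath

section gap

variable {prec : Fin 2 × ℕ → Fin 2 × ℕ → Prop} {z₁ a₁ : Fin 2 → ℕ → ℝ}

lemma gapMass_nonneg (hp : ∀ k, 0 < (p k : ℝ)) (hW : 1 ≤ W)
    (h : IsAllocation γ α prec S z₁ a₁) (k) : 0 ≤ gapMass p W S z₁ a₁ k :=
  Finset.sum_nonneg fun i _ => add_nonneg
    (mul_nonneg (h.idle_nonneg k i) (passiveGap_nonneg (hp k) (one_le_lowerThreshold _ _)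
      (lowerThreshold_index_le (hp k).le (zero_lt_one.trans_le hW)) i))
    (mul_nonneg (h.nonneg k i) (activeGap_nonneg (hp k) (p k).2.2 (one_le_lowerThreshold _ _)
      (lowerThreshold_sub_one_index_le hp hW k) i))

/-- A crude bound, used only in the initial slots, whose number does not depend on the horizon. -/
lemma gapMass_le (hp : ∀ k, 0 < (p k : ℝ)) (hW : 1 ≤ W)
    (h : IsAllocation γ α prec S z₁ a₁) (k) :
    gapMass p W S z₁ a₁ k ≤ ageMass S z₁ k + W * schedMass S a₁ k := by
  unfold gapMass ageMass schedMass
  rw [Finset.mul_sum, ← Finset.sum_add_distrib]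
  refine Finset.sum_le_sum fun i _ => add_le_add ?_ ?_
  · have h1 := passiveGap_le (hp k) (one_le_lowerThreshold (p k) W)
      (lowerThreshold_sub_one_index_le hp hW k) i
    refine (mul_le_mul_of_nonneg_left h1 (h.idle_nonneg k i)).trans
      (mul_le_mul_of_nonneg_right ?_ (Nat.cast_nonneg i))
    linarith [h.nonneg k i]
  · rw [mul_comm]
    exact mul_le_mul_of_nonneg_right (activeGap_le (hp k) (p k).2.2 (one_le_lowerThreshold _ _)
      (lowerThreshold_sub_one_index_le hp hW k) (by linarith) i) (h.nonneg k i)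

/-- Losses arise only from late idle and early scheduled mass. As idle ages are at most `m`, the
passive loss per unit of mass is at most `m`, so the estimate is independent of `S`. -/
lemma gapMass_le_of_young (hp : ∀ k, 0 < (p k : ℝ)) (hW : 1 ≤ W)
    (h : IsAllocation γ α prec S z₁ a₁) (k) (hy : ∀ i, m < i → z₁ k i - a₁ k i = 0) :
    gapMass p W S z₁ a₁ k ≤ m * lateIdle p W S z₁ a₁ k + W * earlySched p W S a₁ k := by
  unfold gapMass lateIdle earlySched
  rw [Finset.mul_sum, Finset.mul_sum, ← Finset.sum_add_distrib]
  refine Finset.sum_le_sum fun i _ => add_le_add ?_ ?_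
  · split_ifs with hi
    · rw [passiveGap_eq_zero hp hW k hi, mul_zero, mul_zero]
    · rcases le_or_gt i m with him | him
      · have h1 := passiveGap_le (hp k) (one_le_lowerThreshold (p k) W)
          (lowerThreshold_sub_one_index_le hp hW k) i
        have h2 : (i : ℝ) ≤ m := by exact_mod_cast him
        rw [mul_comm]
        exact mul_le_mul_of_nonneg_right (h1.trans h2) (h.idle_nonneg k i)
      · rw [hy i him, zero_mul, mul_zero]
  · split_ifs with hi
    · rw [mul_comm]
      exact mul_le_mul_of_nonneg_right (activeGap_le (hp k) (p k).2.2 (one_le_lowerThreshold _ _)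
        (lowerThreshold_sub_one_index_le hp hW k) (by linarith) i) (h.nonneg k i)
    · rw [activeGap_of_ge (hp k) (one_le_lowerThreshold _ _) (not_lt.1 hi), mul_zero, mul_zero]

end gap

/-- The time averages of the cost of all fluid paths converge to `C^RP`, uniformly. -/
theorem exists_time_average_near (P : FluidParams (fun k => (p k : ℝ)) γ α m)
    (hsol : IsRelaxedSolution p γ α W θ) {A : ℝ} (hA0 : 0 ≤ A) {ε : ℝ} (hε : 0 < ε) :
    ∃ T₀ : ℕ, ∀ T ≥ T₀, ∀ (S : ℕ) (z a : ℕ → Fin 2 → ℕ → ℝ), 2 ≤ S →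
      IsFluidPath (fun k => (p k : ℝ)) γ α (indexLess fun k => (p k : ℝ)) S T z a →
      (∀ k, ageMass S (z 0) k ≤ A) →
      |(T : ℝ)⁻¹ * ∑ t ∈ Finset.range T, ∑ k, ageMass S (z t) k - zStarCost p γ W θ| ≤ ε := by
  have hp : ∀ k, 0 < (p k : ℝ) := P.p_pos
  have hW := hsol.one_le
  choose c hc0 hc using fun k => exists_relValue_le (p k) (lowerThreshold (p k) W) W
  -- Each class then loses at most `(m + W) η = ε / 4` per slot, and the two together `ε / 2`.
  set η := ε / (4 * (m + W)) with hη
  have hmW : 0 < (m : ℝ) + W := by positivity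
  have hη0 : 0 < η := by positivity
  obtain ⟨τ, hτ⟩ := exists_time_nearOptimal P hsol hη0
  let B : Fin 2 → ℝ := fun k => A + m + (m + 1 / p k)
  have hB0 : ∀ k, 0 ≤ B k := fun k => by
    have := (one_div_pos.2 (hp k)).le
    have : (0 : ℝ) ≤ m := Nat.cast_nonneg m
    simp only [B]
    linarith
  set H := ∑ k, c k * B k with hH
  have hH0 : 0 ≤ H := Finset.sum_nonneg fun k _ => mul_nonneg (hc0 k) (hB0 k)
  set Γ := ∑ k, (B k + W) with hΓ
  have hΓ0 : 0 ≤ Γ := Finset.sum_nonneg fun k _ => by linarith [hB0 k]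
  -- The term `2 H` covers the relative values at both ends and `(τ + m) Γ` the losses before the
  -- path is nearly optimal; dividing by `T` must leave at most `ε / 2`.
  obtain ⟨T₀, hT₀⟩ := exists_nat_ge ((2 * H + (τ + m : ℕ) * Γ) / (ε / 2))
  refine ⟨T₀ + 1, fun T hT S z a hS h hinit => ?_⟩
  have hTpos : (0 : ℝ) < T := by
    have : 0 < T := by omega
    exact_mod_cast this
  have hage : ∀ t ≤ T, ∀ k, ageMass S (z t) k ≤ B k := fun t ht k => by
    refine (h.ageMass_le P hS hA0 k (hinit k) t ht).trans ?_
    have : ((min t m : ℕ) : ℝ) ≤ m := by exact_mod_cast min_le_right t m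
    simp only [B]
    linarith
  have htel : ∀ n ≤ T, ∑ t ∈ Finset.range n, ∑ k, ageMass S (z t) k
      = n * zStarCost p γ W θ + ∑ k, valueMass p W S (z 0) k - ∑ k, valueMass p W S (z n) k
        + ∑ t ∈ Finset.range n, ∑ k, gapMass p W S (z t) (a t) k := by
    intro n
    induction n with
    | zero => intro _; simp
    | succ n ih =>
      intro hn
      rw [Finset.sum_range_succ, Finset.sum_range_succ, ih (by omega), hsol.zStarCost_eq hp]
      have h0 := h.value_step (W := W) hS (by omega : n < T) 0
      have h1 := h.value_step (W := W) hS (by omega : n < T) 1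
      have h2 := (h.alloc n (by omega)).schedMass_add
      simp only [Fin.sum_univ_two]
      push_cast
      rw [← h2]
      linarith
  have hzn : ∀ t ≤ T, t = 0 ∨ 0 < t → ∀ k, |valueMass p W S (z t) k| ≤ c k * B k := by
    intro t ht _ k
    -- At the final time `T` no allocation is available, so nonnegativity comes from the last step.
    have hz0 : z t k 0 = 0 ∧ ∀ i, 0 ≤ z t k i := by
      rcases ht.lt_or_eq with ht' | ht'
      · exact ⟨(h.alloc t ht').zero k, (h.alloc t ht').z_nonneg k⟩
      · obtain ⟨s, rfl⟩ : ∃ s, t = s + 1 := ⟨t - 1, by omega⟩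
        have hst := h.step s (by omega)
        have hal := h.alloc s (by omega)
        refine ⟨hst.zero k, fun i => ?_⟩
        rcases i with _ | _ | i
        · exact (hst.zero k).ge
        · rw [zero_add, hst.birth hal hS k]
          exact mul_nonneg (hp k).le (hal.schedMass_nonneg k)
        · exact (hal.idle_nonneg k (i + 1)).trans
            (hst.idle_le_next hal (p k).2.2 (Nat.le_add_left 1 i))
    refine le_trans ?_ (mul_le_mul_of_nonneg_left (hage t ht k) (hc0 k))
    unfold valueMass ageMass
    refine (Finset.abs_sum_le_sum_abs _ _).trans ?_
    rw [Finset.mul_sum]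
    refine Finset.sum_le_sum fun i _ => ?_
    rcases Nat.eq_zero_or_pos i with rfl | hi
    · simp [hz0.1]
    · rw [abs_mul, abs_of_nonneg (hz0.2 i)]
      have := mul_le_mul_of_nonneg_left (hc k i hi) (hz0.2 i)
      linarith
  have hV : ∀ t ≤ T, |∑ k, valueMass p W S (z t) k| ≤ H := fun t ht =>
    (Finset.abs_sum_le_sum_abs _ _).trans
      (Finset.sum_le_sum fun k _ => hzn t ht (Nat.eq_zero_or_pos t) k)
  have hgap0 : ∀ t < T, 0 ≤ ∑ k, gapMass p W S (z t) (a t) k := fun t ht =>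
    Finset.sum_nonneg fun k _ => gapMass_nonneg hp hW (h.alloc t ht) k
  have hgapΓ : ∀ t < T, ∑ k, gapMass p W S (z t) (a t) k ≤ Γ := fun t ht => by
    refine Finset.sum_le_sum fun k _ => (gapMass_le hp hW (h.alloc t ht) k).trans ?_
    have h1 : schedMass S (a t) k ≤ 1 := by
      have h2 := (h.alloc t ht).idleMass_nonneg k
      rw [(h.alloc t ht).idleMass_eq] at h2
      linarith [IsFluidPath.γ_le_one P k]
    have h2 := hage t ht.le k
    nlinarith
  have hgapε : ∀ t < T, τ + m ≤ t → ∑ k, gapMass p W S (z t) (a t) k ≤ ε / 2 := by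
    intro t ht hτt
    have h1 : ∀ k, gapMass p W S (z t) (a t) k ≤ (m + W) * η := fun k => by
      obtain ⟨h2, h3⟩ := hτ S T z a hS h t (by omega) ht k
      refine (gapMass_le_of_young hp hW (h.alloc t ht) k
        fun i hi => h.idle_young P hS ht (by omega) k hi).trans ?_
      have h4 := mul_le_mul_of_nonneg_left h2 (Nat.cast_nonneg m : (0 : ℝ) ≤ m)
      have h5 := mul_le_mul_of_nonneg_left h3 (by linarith : 0 ≤ W)
      linarith
    have h2 : ((m : ℝ) + W) * η = ε / 4 := by rw [hη]; field_simp
    rw [Fin.sum_univ_two]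
    linarith [h1 0, h1 1]
  have hgap : ∑ t ∈ Finset.range T, ∑ k, gapMass p W S (z t) (a t) k
      ≤ (τ + m : ℕ) * Γ + T * (ε / 2) := by
    calc ∑ t ∈ Finset.range T, ∑ k, gapMass p W S (z t) (a t) k
        ≤ ∑ t ∈ Finset.range T, ((if t < τ + m then Γ else 0) + ε / 2) := by
          refine Finset.sum_le_sum fun t ht => ?_
          have ht' := Finset.mem_range.1 ht
          split_ifs with h1
          · linarith [hgapΓ t ht']
          · linarith [hgapε t ht' (by omega)]
      _ = ∑ t ∈ Finset.range T, (if t < τ + m then Γ else 0) + T * (ε / 2) := by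
          rw [Finset.sum_add_distrib, Finset.sum_const, Finset.card_range, nsmul_eq_mul]
      _ ≤ _ := by
          gcongr
          rw [← Finset.sum_filter, Finset.sum_const, nsmul_eq_mul]
          refine mul_le_mul_of_nonneg_right ?_ hΓ0
          have : ((Finset.range T).filter fun t => t < τ + m).card ≤ (Finset.range (τ + m)).card :=
            Finset.card_le_card fun t ht => by
              simp only [Finset.mem_filter, Finset.mem_range] at ht ⊢
              exact ht.2
          rw [Finset.card_range] at this
          exact_mod_cast this
  have hgapn : 0 ≤ ∑ t ∈ Finset.range T, ∑ k, gapMass p W S (z t) (a t) k :=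
    Finset.sum_nonneg fun t ht => hgap0 t (Finset.mem_range.1 ht)
  have h0 := abs_le.1 (hV 0 (Nat.zero_le T))
  have h1 := abs_le.1 (hV T le_rfl)
  have hT' : 2 * H + (τ + m : ℕ) * Γ ≤ T * (ε / 2) := by
    rw [div_le_iff₀ (by positivity)] at hT₀
    refine hT₀.trans (mul_le_mul_of_nonneg_right ?_ (by positivity))
    exact_mod_cast (by omega : T₀ ≤ T)
  have hΓτ : 0 ≤ ((τ + m : ℕ) : ℝ) * Γ := mul_nonneg (Nat.cast_nonneg _) hΓ0
  have hfin : |∑ t ∈ Finset.range T, ∑ k, ageMass S (z t) k - T * zStarCost p γ W θ| ≤ T * ε := by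
    rw [htel T le_rfl, abs_le]
    have : 0 ≤ T * (ε / 2) := by positivity
    constructor <;> linarith
  have hsplit : (T : ℝ)⁻¹ * ∑ t ∈ Finset.range T, ∑ k, ageMass S (z t) k - zStarCost p γ W θ
      = (T : ℝ)⁻¹ * (∑ t ∈ Finset.range T, ∑ k, ageMass S (z t) k - T * zStarCost p γ W θ) := by
    field_simp
  rw [hsplit, abs_mul, abs_of_pos (inv_pos.2 hTpos), inv_mul_le_iff₀ hTpos]
  exact hfin

end cost

/-! ### Additive functionals of the history -/

section functionals

variable {N : ℕ}

/-- The sum of `f` over the past transitions of a history that ends with the ages `s'`. -/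
def histSum (f : Ages N → Finset (Fin N) → Ages N → ℝ) :
    List (Ages N × Finset (Fin N)) → Ages N → ℝ
  | [], _ => 0
  | (s, A) :: l, s' => histSum f l s + f s A s'

variable (q : Fin N → unitInterval) (π : Policy N) (s₀ : Ages N)

/-- The history at time `T` contains the whole trajectory, so expectations of time sums become one
expectation, to which pathwise estimates apply. -/
lemma expect_histSum (f : Ages N → Finset (Fin N) → Ages N → ℝ) (T : ℕ) :
    (expect (historyLaw q π s₀ T) fun h => histSum f h.1 h.2)
      = ∑ t ∈ Finset.range T, expect (historyLaw q π s₀ t) fun h => expect (π h) fun A =>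
          expect (channelLaw q) fun c => f h.2 A (nextAges h.2 A c) := by
  induction T with
  | zero => exact expect_pure (([], s₀) : History N) fun h => histSum f h.1 h.2
  | succ T ih =>
    rw [Finset.sum_range_succ, ← ih, expect_historyLaw_succ,
      ← expect_add (historyLaw_support_finite q π s₀ T)]
    congr 1
    funext h
    have h1 : ∀ A : Finset (Fin N), (expect (channelLaw q) fun c =>
        histSum f ((h.2, A) :: h.1) (nextAges h.2 A c))
        = histSum f h.1 h.2 + expect (channelLaw q) fun c => f h.2 A (nextAges h.2 A c) := by
      intro A
      simp only [histSum]
      rw [expect_add (support_finite_of_fintype _), expect_const (support_finite_of_fintype _)]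
    simp only [h1]
    rw [expect_add (support_finite_of_fintype _), expect_const (support_finite_of_fintype _)]

/-- A trajectory of the ages and of the scheduled sets during the slots `0, …, T - 1`, all of whose
decisions satisfy `Q`. -/
structure IsTrajectory (Q : Ages N → Finset (Fin N) → Prop) (s₀ : Ages N) (T : ℕ)
    (st : ℕ → Ages N) (A : ℕ → Finset (Fin N)) : Prop where
  init : st 0 = s₀
  decision : ∀ t < T, Q (st t) (A t)
  step : ∀ t < T, ∃ c, st (t + 1) = nextAges (st t) (A t) c

/-- Unrolls a possible history into sequences indexed by time, all of whose decisions satisfy `Q`;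
randomisation and dependence on the past then play no role. -/
lemma exists_trajectory {Q : Ages N → Finset (Fin N) → Prop}
    (hQ : ∀ h, ∀ A ∈ (π h).support, Q h.2 A) {T : ℕ} {h : History N}
    (hh : h ∈ (historyLaw q π s₀ T).support) :
    ∃ st A, IsTrajectory Q s₀ T st A ∧ st T = h.2 ∧ ∀ f, histSum f h.1 h.2
      = ∑ t ∈ Finset.range T, f (st t) (A t) (st (t + 1)) := by
  induction T generalizing h with
  | zero =>
    simp only [historyLaw, PMF.support_pure, Set.mem_singleton_iff] at hh
    subst hh
    exact ⟨fun _ => s₀, fun _ => ∅, ⟨rfl, by simp, by simp⟩, rfl, fun f => by simp [histSum]⟩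
  | succ T ih =>
    obtain ⟨h, hh', B, hB, c, rfl⟩ := mem_support_historyLaw_succ q π s₀ hh
    obtain ⟨st, A, htr, hT, hsum⟩ := ih hh'
    set st' : ℕ → Ages N := Function.update st (T + 1) (nextAges h.2 B c) with hst'
    set A' : ℕ → Finset (Fin N) := Function.update A T B with hA'
    have e1 : ∀ t ≤ T, st' t = st t := fun t ht => Function.update_of_ne (by omega) _ _
    have e2 : ∀ t < T, A' t = A t := fun t ht => Function.update_of_ne (by omega) _ _
    have e3 : st' (T + 1) = nextAges h.2 B c := Function.update_self ..
    have e4 : A' T = B := Function.update_self ..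
    refine ⟨st', A', ⟨?_, fun t ht => ?_, fun t ht => ?_⟩, e3, fun f => ?_⟩
    · rw [e1 0 (Nat.zero_le _), htr.init]
    · rcases (Nat.lt_succ_iff.1 ht).lt_or_eq with h1 | rfl
      · rw [e1 t h1.le, e2 t h1]
        exact htr.decision t h1
      · rw [e1 t le_rfl, e4, hT]
        exact hQ h B hB
    · rcases (Nat.lt_succ_iff.1 ht).lt_or_eq with h1 | rfl
      · rw [e1 t h1.le, e2 t h1, e1 (t + 1) h1]
        exact htr.step t h1
      · rw [e1 t le_rfl, e4, hT, e3]
        exact ⟨c, rfl⟩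
    · rw [Finset.sum_range_succ, e1 T le_rfl, e4, e3, hT]
      change histSum f h.1 h.2 + _ = _
      rw [hsum f]
      congr 1
      refine Finset.sum_congr rfl fun t ht => ?_
      have ht' := Finset.mem_range.1 ht
      rw [e1 t ht'.le, e2 t ht', e1 (t + 1) ht']

namespace IsTrajectory

variable {Q : Ages N → Finset (Fin N) → Prop} {s₀} {T : ℕ} {st : ℕ → Ages N}
  {A : ℕ → Finset (Fin N)}

lemma one_le (h : IsTrajectory Q s₀ T st A) (hs₀ : ∀ u, 1 ≤ s₀ u) :
    ∀ t ≤ T, ∀ u, 1 ≤ st t u := by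
  intro t ht u
  cases t with
  | zero => exact h.init ▸ hs₀ u
  | succ t =>
    obtain ⟨c, hc⟩ := h.step t ht
    rw [hc]
    unfold nextAges
    split_ifs <;> omega

lemma le_add (h : IsTrajectory Q s₀ T st A) {B : ℕ} (hB : ∀ u, s₀ u ≤ B) :
    ∀ t ≤ T, ∀ u, st t u ≤ B + t := by
  intro t
  induction t with
  | zero => exact fun _ u => h.init ▸ hB u
  | succ t ih =>
    intro ht u
    obtain ⟨c, hc⟩ := h.step t ht
    have := ih (by omega) u
    rw [hc]
    unfold nextAges
    split_ifs <;> omega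

end IsTrajectory

end functionals

/-! ### Empirical proportions -/

section proportions

variable {N : ℕ} (cls : Fin N → Fin 2)

/-- The proportion of the scheduled users of class `k` and age `i`. -/
def schedProportion (s : Ages N) (A : Finset (Fin N)) (k : Fin 2) (i : ℕ) : ℝ :=
  ((A.filter fun u => cls u = k ∧ s u = i).card : ℝ) / N

lemma proportion_nonneg (s : Ages N) (k i) : 0 ≤ proportion cls s k i := by
  unfold proportion; positivity

lemma proportion_le_one (s : Ages N) (k i) : proportion cls s k i ≤ 1 := by
  refine div_le_one_of_le₀ ?_ (Nat.cast_nonneg _)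
  exact_mod_cast (Finset.card_le_univ _).trans (by simp)

lemma schedProportion_nonneg (s : Ages N) (A k i) : 0 ≤ schedProportion cls s A k i := by
  unfold schedProportion; positivity

lemma proportion_sub_schedProportion (s : Ages N) (A : Finset (Fin N)) (k i) :
    proportion cls s k i - schedProportion cls s A k i
      = schedProportion cls s Aᶜ k i := by
  unfold proportion schedProportion
  rw [← sub_div]
  congr 1
  rw [sub_eq_iff_eq_add', ← Nat.cast_add,
    ← Finset.card_union_of_disjoint (Finset.disjoint_filter_filter disjoint_compl_right),
    ← Finset.filter_union, Finset.union_compl]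

lemma exists_of_schedProportion_ne_zero {s : Ages N} {A : Finset (Fin N)} {k i}
    (h : schedProportion cls s A k i ≠ 0) : ∃ u ∈ A, cls u = k ∧ s u = i := by
  by_contra hcon
  push Not at hcon
  refine h ?_
  unfold schedProportion
  rw [Finset.filter_false_of_mem fun u hu hk => hcon u hu hk.1 hk.2]
  simp

lemma proportion_eq_zero {s : Ages N} {k i} (h : ∀ u, s u ≠ i) : proportion cls s k i = 0 := by
  unfold proportion
  rw [Finset.filter_false_of_mem fun u _ hk => h u hk.2]
  simp

lemma exists_of_proportion_ne_zero {s : Ages N} {k i} (h : proportion cls s k i ≠ 0) :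
    ∃ u, s u = i := by
  by_contra hcon
  push Not at hcon
  exact h (proportion_eq_zero cls hcon)

lemma proportion_ne_zero (s : Ages N) (u : Fin N) : proportion cls s (cls u) (s u) ≠ 0 := by
  unfold proportion
  have hN : N ≠ 0 := by rintro rfl; exact u.elim0
  refine div_ne_zero ?_ (Nat.cast_ne_zero.2 hN)
  rw [Nat.cast_ne_zero]
  exact Finset.card_ne_zero_of_mem (Finset.mem_filter.2 ⟨Finset.mem_univ u, rfl, rfl⟩)

lemma sum_proportion {s : Ages N} {S : ℕ} (hS : ∀ u, s u < S) (k : Fin 2) :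
    ∑ i ∈ Finset.range S, proportion cls s k i
      = ((Finset.univ.filter fun u => cls u = k).card : ℝ) / N := by
  unfold proportion
  rw [← Finset.sum_div, ← Nat.cast_sum]
  congr 2
  rw [Finset.card_eq_sum_card_fiberwise (f := s) (t := Finset.range S)
    (fun u _ => by simpa using hS u)]
  exact Finset.sum_congr rfl fun i _ => by rw [Finset.filter_filter]

lemma sum_schedProportion {s : Ages N} {S : ℕ} (hS : ∀ u, s u < S) (A : Finset (Fin N)) :
    ∑ k, ∑ i ∈ Finset.range S, schedProportion cls s A k i = (A.card : ℝ) / N := by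
  unfold schedProportion
  simp only [← Finset.sum_div, ← Nat.cast_sum]
  congr 2
  rw [Finset.card_eq_sum_card_fiberwise (f := cls) (t := Finset.univ) (fun u _ => by simp)]
  refine Finset.sum_congr rfl fun k _ => ?_
  rw [Finset.card_eq_sum_card_fiberwise (f := s) (t := Finset.range S)
    (fun u _ => by simpa using hS u)]
  exact Finset.sum_congr rfl fun i _ => by rw [Finset.filter_filter]

lemma nextAges_eq_succ_iff {s : Ages N} {A : Finset (Fin N)} {c : Fin N → Bool} {i : ℕ}
    (hi : 1 ≤ i) {u : Fin N} :
    nextAges s A c u = i + 1 ↔ s u = i ∧ ¬ (u ∈ A ∧ c u = true) := by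
  unfold nextAges
  split_ifs with h
  · simp only [h, and_true, not_true, and_false, iff_false]
    omega
  · simp only [h, not_false_iff, and_true]
    omega

/-- The deviation of one transition from the fluid dynamics is a sum of channel noises. -/
lemma proportion_nextAges (p : Fin 2 → unitInterval) (s : Ages N) (A : Finset (Fin N))
    (c : Fin N → Bool) (k : Fin 2) {i : ℕ} (hi : 1 ≤ i) :
    proportion cls (nextAges s A c) k (i + 1) - proportion cls s k i
        + p k * schedProportion cls s A k i
      = -((∑ u ∈ A.filter (fun u => cls u = k ∧ s u = i),
          channelNoise (fun u => p (cls u)) c u) / N) := by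
  have h1 : ((Finset.univ.filter fun u => cls u = k ∧ nextAges s A c u = i + 1).card : ℝ)
      = ((Finset.univ.filter fun u => cls u = k ∧ s u = i).card : ℝ)
        - ∑ u ∈ A.filter (fun u => cls u = k ∧ s u = i), (if c u then (1 : ℝ) else 0) := by
    rw [eq_sub_iff_add_eq]
    have hA : ∑ u ∈ A.filter (fun u => cls u = k ∧ s u = i), (if c u then (1 : ℝ) else 0)
        = ((A.filter (fun u => cls u = k ∧ s u = i)).filter fun u => c u = true).card := by
      rw [Finset.sum_boole]
    rw [hA, ← Nat.cast_add, ← Finset.card_union_of_disjoint]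
    · congr 2
      ext u
      simp only [Finset.mem_union, Finset.mem_filter, Finset.mem_univ, true_and,
        nextAges_eq_succ_iff hi]
      tauto
    · rw [Finset.disjoint_left]
      intro u hu hu'
      simp only [Finset.mem_filter, Finset.mem_univ, true_and, nextAges_eq_succ_iff hi] at hu hu'
      tauto
  have h2 : ∑ u ∈ A.filter (fun u => cls u = k ∧ s u = i), channelNoise (fun u => p (cls u)) c u
      = ∑ u ∈ A.filter (fun u => cls u = k ∧ s u = i), (if c u then (1 : ℝ) else 0)
        - p k * ((A.filter fun u => cls u = k ∧ s u = i).card : ℝ) := by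
    unfold channelNoise
    rw [Finset.sum_sub_distrib]
    congr 1
    rw [Finset.sum_congr rfl (g := fun _ => (p k : ℝ)) fun u hu => by
      simp only [(Finset.mem_filter.1 hu).2.1]]
    rw [Finset.sum_const, nsmul_eq_mul, mul_comm]
  unfold proportion schedProportion
  rw [h1, h2]
  ring

/-- The squared deviation of a transition from the fluid dynamics. -/
def transitionNoise (p : Fin 2 → unitInterval) (S : ℕ) (s : Ages N) (A : Finset (Fin N))
    (s' : Ages N) : ℝ :=
  ∑ k, ∑ i ∈ Finset.range S,
    (proportion cls s' k (i + 2) - proportion cls s k (i + 1)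
      + p k * schedProportion cls s A k (i + 1)) ^ 2

lemma transitionNoise_nonneg (p : Fin 2 → unitInterval) (S : ℕ) (s : Ages N) (A s') :
    0 ≤ transitionNoise cls p S s A s' :=
  Finset.sum_nonneg fun _ _ => Finset.sum_nonneg fun _ _ => sq_nonneg _

/-- There are `2 S` deviations, each a centred sum of at most `N` independent successes divided by
`N`, of variance at most `1 / N`. -/
lemma expect_transitionNoise_le (p : Fin 2 → unitInterval) (S : ℕ) (s : Ages N) (A) :
    expect (channelLaw fun u => p (cls u))
      (fun c => transitionNoise cls p S s A (nextAges s A c)) ≤ 2 * S / N := by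
  unfold transitionNoise
  rw [expect_sum (support_finite_of_fintype _)]
  have h : ∀ k : Fin 2, expect (channelLaw fun u => p (cls u))
      (fun c => ∑ i ∈ Finset.range S,
        (proportion cls (nextAges s A c) k (i + 2) - proportion cls s k (i + 1)
          + p k * schedProportion cls s A k (i + 1)) ^ 2) ≤ S / N := by
    intro k
    rw [expect_sum (support_finite_of_fintype _)]
    have h1 : ∀ i ∈ Finset.range S, expect (channelLaw fun u => p (cls u))
        (fun c => (proportion cls (nextAges s A c) k (i + 2) - proportion cls s k (i + 1)
          + p k * schedProportion cls s A k (i + 1)) ^ 2) ≤ 1 / N := by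
      intro i _
      have h2 : ∀ c, (proportion cls (nextAges s A c) k (i + 2) - proportion cls s k (i + 1)
          + p k * schedProportion cls s A k (i + 1)) ^ 2
          = ((N : ℝ) ^ 2)⁻¹ * (∑ u ∈ A.filter (fun u => cls u = k ∧ s u = i + 1),
              channelNoise (fun u => p (cls u)) c u) ^ 2 := fun c => by
        rw [proportion_nextAges cls p s A c k (Nat.le_add_left 1 i)]
        ring
      simp only [h2]
      rw [expect_const_mul]
      refine (mul_le_mul_of_nonneg_left (expect_sq_sum_channelNoise_le _ _)
        (by positivity)).trans ?_
      rcases Nat.eq_zero_or_pos N with rfl | hN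
      · simp
      · have : (N : ℝ) ≠ 0 := by positivity
        apply le_of_eq
        field_simp
    refine (Finset.sum_le_sum h1).trans ?_
    simp [div_eq_mul_inv]
  refine (Finset.sum_le_sum fun k _ => h k).trans ?_
  rw [Fin.sum_univ_two]
  apply le_of_eq
  ring

lemma expect_noise_le (p : Fin 2 → unitInterval) (π : Policy N) (s₀ : Ages N) (S T : ℕ) :
    (expect (historyLaw (fun u => p (cls u)) π s₀ T)
      fun h => histSum (transitionNoise cls p S) h.1 h.2) ≤ T * (2 * S / N) := by
  rw [expect_histSum]
  have h : ∀ t ∈ Finset.range T, (expect (historyLaw (fun u => p (cls u)) π s₀ t) fun h =>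
      expect (π h) fun A => expect (channelLaw fun u => p (cls u)) fun c =>
        transitionNoise cls p S h.2 A (nextAges h.2 A c)) ≤ 2 * S / N := by
    intro t _
    have hfin := historyLaw_support_finite (fun u => p (cls u)) π s₀ t
    rw [← expect_const hfin (2 * S / N : ℝ)]
    refine expect_mono hfin fun h _ => ?_
    rw [← expect_const (support_finite_of_fintype (π h)) (2 * S / N : ℝ)]
    exact expect_mono (support_finite_of_fintype _) fun A _ => expect_transitionNoise_le cls p S _ _
  refine (Finset.sum_le_sum h).trans ?_
  simp

/-- The age per user. -/
def meanAge (s : Ages N) : ℝ := ∑ k, ∑' i : ℕ, proportion cls s k i * i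

lemma meanAge_eq {s : Ages N} {S : ℕ} (hS : ∀ u, s u < S) :
    meanAge cls s = ∑ k, ageMass S (proportion cls s) k := by
  unfold meanAge ageMass
  refine Finset.sum_congr rfl fun k _ => tsum_eq_sum fun i hi => ?_
  have h : ∀ u, s u ≠ i := by
    rintro u rfl
    exact hi (Finset.mem_range.2 (hS u))
  rw [proportion_eq_zero cls h, zero_mul]

lemma averageAge_eq_expect (p : Fin 2 → unitInterval) (π : Policy N) (s₀ : Ages N) (T : ℕ) :
    averageAge p cls π s₀ T = expect (historyLaw (fun u => p (cls u)) π s₀ T)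
      fun h => (T : ℝ)⁻¹ * histSum (fun s _ _ => meanAge cls s) h.1 h.2 := by
  rw [expect_const_mul, expect_histSum]
  unfold averageAge
  congr 1
  refine Finset.sum_congr rfl fun t _ => ?_
  congr 1
  funext h
  simp only [expect_const (support_finite_of_fintype _)]
  rfl

end proportions

/-! ### Approximate fluid paths -/

section approximation

variable {p γ : Fin 2 → ℝ} {α : ℝ} {prec : Fin 2 × ℕ → Fin 2 × ℕ → Prop} {S T : ℕ}

/-- A pair of paths that satisfies the exact constraints of a fluid path from `x`, the balance
equation for the ages at least `2` holding with the error `δ`. -/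
structure IsApproxPath (p γ : Fin 2 → ℝ) (α : ℝ) (prec : Fin 2 × ℕ → Fin 2 × ℕ → Prop) (S T : ℕ)
    (x : Fin 2 → ℕ → ℝ) (δ : ℝ) (z a : ℕ → Fin 2 → ℕ → ℝ) : Prop where
  init : z 0 = x
  alloc : ∀ t < T, IsAllocation γ α prec S (z t) (a t)
  zero : ∀ t < T, ∀ k, z (t + 1) k 0 = 0
  mass : ∀ t < T, ∀ k, ∑ i ∈ Finset.range S, z (t + 1) k i = γ k
  next : ∀ t < T, ∀ k i, 1 ≤ i → |z (t + 1) k (i + 1) - z t k i + p k * a t k i| ≤ δ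
  z_le : ∀ t k i, z t k i ≤ 1
  z_nonneg : ∀ t k i, 0 ≤ z t k i
  a_le : ∀ t k i, a t k i ≤ 1
  a_nonneg : ∀ t k i, 0 ≤ a t k i

lemma IsApproxPath.isFluidPath {x : Fin 2 → ℕ → ℝ} {z a : ℕ → Fin 2 → ℕ → ℝ}
    (h : IsApproxPath p γ α prec S T x 0 z a) : IsFluidPath p γ α prec S T z a where
  alloc := h.alloc
  step t ht := ⟨h.zero t ht, fun k i hi => by
    have := abs_nonpos_iff.1 (h.next t ht k i hi)
    linarith, h.mass t ht⟩

/-- The time average of the mean age of a path. -/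
def pathCost (S T : ℕ) (z : ℕ → Fin 2 → ℕ → ℝ) : ℝ :=
  (T : ℝ)⁻¹ * ∑ t ∈ Finset.range T, ∑ k, ageMass S (z t) k

lemma continuous_pathCost (S T : ℕ) : Continuous (pathCost S T) := by
  unfold pathCost ageMass
  fun_prop

/-- Every condition is a closed one involving finitely many coordinates. The priority rule is stated
as a vanishing product so that it too passes to the limit. -/
lemma isApproxPath_of_tendsto {x : Fin 2 → ℕ → ℝ} {δ : ℕ → ℝ} {δ₀ : ℝ} (hδ : Tendsto δ atTop (𝓝 δ₀))
    {z a : ℕ → ℕ → Fin 2 → ℕ → ℝ} {z₀ a₀ : ℕ → Fin 2 → ℕ → ℝ} (hz : Tendsto z atTop (𝓝 z₀))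
    (ha : Tendsto a atTop (𝓝 a₀)) (h : ∀ n, IsApproxPath p γ α prec S T x (δ n) (z n) (a n)) :
    IsApproxPath p γ α prec S T x δ₀ z₀ a₀ := by
  have hz' : ∀ t k i, Tendsto (fun n => z n t k i) atTop (𝓝 (z₀ t k i)) := fun t k i =>
    tendsto_pi_nhds.1 (tendsto_pi_nhds.1 (tendsto_pi_nhds.1 hz t) k) i
  have ha' : ∀ t k i, Tendsto (fun n => a n t k i) atTop (𝓝 (a₀ t k i)) := fun t k i =>
    tendsto_pi_nhds.1 (tendsto_pi_nhds.1 (tendsto_pi_nhds.1 ha t) k) i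
  have hconst : ∀ {f : ℕ → ℝ} {l c : ℝ}, Tendsto f atTop (𝓝 l) → (∀ n, f n = c) → l = c :=
    fun {f l c} hf hc => tendsto_nhds_unique hf ((tendsto_congr hc).2 tendsto_const_nhds)
  refine ⟨?_, fun t ht => ⟨fun k i => ?_, fun k i => ?_, fun k => ?_, fun k i hi => ?_, fun k => ?_,
    ?_, fun k i l j hp => ?_⟩, fun t ht k => ?_, fun t ht k => ?_, fun t ht k i hi => ?_,
    fun t k i => ?_, fun t k i => ?_, fun t k i => ?_, fun t k i => ?_⟩
  · funext k i
    exact hconst (hz' 0 k i) fun n => by rw [(h n).init]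
  · exact ge_of_tendsto' (ha' t k i) fun n => (h n).a_nonneg t k i
  · exact le_of_tendsto_of_tendsto' (ha' t k i) (hz' t k i) fun n => ((h n).alloc t ht).le k i
  · exact hconst (hz' t k 0) fun n => ((h n).alloc t ht).zero k
  · exact hconst (hz' t k i) fun n => ((h n).alloc t ht).far k i hi
  · exact hconst (tendsto_finsetSum _ fun i _ => hz' t k i) fun n => ((h n).alloc t ht).mass k
  · exact hconst (tendsto_finsetSum _ fun k _ => tendsto_finsetSum _ fun i _ => ha' t k i)
      fun n => ((h n).alloc t ht).sched
  · exact hconst ((ha' t k i).mul ((hz' t l j).sub (ha' t l j)))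
      fun n => ((h n).alloc t ht).prio k i l j hp
  · exact hconst (hz' (t + 1) k 0) fun n => (h n).zero t ht k
  · exact hconst (tendsto_finsetSum _ fun i _ => hz' (t + 1) k i) fun n => (h n).mass t ht k
  · exact le_of_tendsto_of_tendsto' (((hz' (t + 1) k (i + 1)).sub (hz' t k i)).add
      ((ha' t k i).const_mul (p k))).abs hδ fun n => (h n).next t ht k i hi
  · exact le_of_tendsto' (hz' t k i) fun n => (h n).z_le t k i
  · exact ge_of_tendsto' (hz' t k i) fun n => (h n).z_nonneg t k i
  · exact le_of_tendsto' (ha' t k i) fun n => (h n).a_le t k i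
  · exact ge_of_tendsto' (ha' t k i) fun n => (h n).a_nonneg t k i

/-- If all the fluid paths from `x` have almost the cost `c`, so do the approximate ones. -/
lemma exists_approx_pathCost_near {x : Fin 2 → ℕ → ℝ} {c ε ε' : ℝ} (hε : ε < ε')
    (hex : ∀ z a, IsFluidPath p γ α prec S T z a → z 0 = x → |pathCost S T z - c| ≤ ε) :
    ∃ δ > 0, ∀ z a, IsApproxPath p γ α prec S T x δ z a → |pathCost S T z - c| ≤ ε' := by
  by_contra! hcon
  choose z a hza hfar using fun n : ℕ => hcon (1 / ((n : ℝ) + 1)) (by positivity)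
  -- All coordinates lie in `[0, 1]`, including those at times beyond `T`, so the product space is
  -- compact. Counterexamples with errors tending to `0` would converge along a subsequence to an
  -- exact fluid path from `x` of the wrong cost.
  have hK : IsCompact (Set.Icc (0 : ℕ → Fin 2 → ℕ → ℝ) 1) := isCompact_Icc
  obtain ⟨⟨z₀, a₀⟩, -, φ, hφ, hlim⟩ := (hK.prod hK).tendsto_subseq (x := fun n => (z n, a n))
    fun n => ⟨⟨fun t k i => (hza n).z_nonneg t k i, fun t k i => (hza n).z_le t k i⟩,
      ⟨fun t k i => (hza n).a_nonneg t k i, fun t k i => (hza n).a_le t k i⟩⟩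
  have hz : Tendsto (fun n => z (φ n)) atTop (𝓝 z₀) := (continuous_fst.tendsto _).comp hlim
  have ha : Tendsto (fun n => a (φ n)) atTop (𝓝 a₀) := (continuous_snd.tendsto _).comp hlim
  have h0 := isApproxPath_of_tendsto
    ((tendsto_one_div_add_atTop_nhds_zero_nat (𝕜 := ℝ)).comp hφ.tendsto_atTop) hz ha
    fun n => hza (φ n)
  have h1 := hex z₀ a₀ h0.isFluidPath h0.init
  have h2 : Tendsto (fun n => |pathCost S T (z (φ n)) - c|) atTop (𝓝 |pathCost S T z₀ - c|) :=
    ((((continuous_pathCost S T).tendsto z₀).comp hz).sub_const c).abs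
  have h3 := ge_of_tendsto' h2 fun n => (hfar (φ n)).le
  linarith

end approximation

/-! ### Convergence of the average age -/

section convergence

variable {p : Fin 2 → unitInterval} {γ : Fin 2 → ℝ} {α : ℝ}
  {prec : Fin 2 × ℕ → Fin 2 × ℕ → Prop} {N : ℕ} {cls : Fin N → Fin 2} {s₀ : Ages N}

/-- The decision `A` at the ages `s` schedules `M` users and respects the priorities `prec`. -/
def IsPriorityDecision (cls : Fin N → Fin 2) (prec : Fin 2 × ℕ → Fin 2 × ℕ → Prop) (M : ℕ)
    (s : Ages N) (A : Finset (Fin N)) : Prop :=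
  A.card = M ∧ ∀ u ∈ A, ∀ v ∉ A, ¬ prec (cls u, s u) (cls v, s v)

lemma isAllocation_proportion {M : ℕ} (hN : 0 < N) (hM : (M : ℝ) = α * N)
    (hcls : ∀ k, ((Finset.univ.filter fun u => cls u = k).card : ℝ) = γ k * N)
    {s : Ages N} {A : Finset (Fin N)} (hA : IsPriorityDecision cls prec M s A)
    (hs : ∀ u, 1 ≤ s u) {S : ℕ} (hS : ∀ u, s u + 1 < S) :
    IsAllocation γ α prec S (proportion cls s) (schedProportion cls s A) := by
  have hN' : (N : ℝ) ≠ 0 := by positivity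
  refine ⟨schedProportion_nonneg cls s A, fun k i => ?_, fun k => ?_, fun k i hi => ?_, fun k => ?_,
    ?_, fun k i l j hp => ?_⟩
  · have := schedProportion_nonneg cls s Aᶜ k i
    rw [← proportion_sub_schedProportion] at this
    linarith
  · exact proportion_eq_zero cls fun u hu => by have := hs u; omega
  · exact proportion_eq_zero cls fun u hu => by have := hS u; omega
  · rw [sum_proportion cls (fun u => by have := hS u; omega), hcls, mul_div_cancel_right₀ _ hN']
  · rw [sum_schedProportion cls (fun u => by have := hS u; omega), hA.1, hM,
      mul_div_cancel_right₀ _ hN']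
  · by_contra hne
    obtain ⟨h1, h2⟩ := mul_ne_zero_iff.1 hne
    rw [proportion_sub_schedProportion] at h2
    obtain ⟨u, hu, rfl, rfl⟩ := exists_of_schedProportion_ne_zero cls h1
    obtain ⟨v, hv, rfl, rfl⟩ := exists_of_schedProportion_ne_zero cls h2
    exact hA.2 u hu v (Finset.mem_compl.1 hv) hp

lemma schedProportion_le_one (s : Ages N) (A : Finset (Fin N)) (k i) :
    schedProportion cls s A k i ≤ 1 := by
  have h1 := proportion_le_one cls s k i
  have h2 := schedProportion_nonneg cls s Aᶜ k i
  rw [← proportion_sub_schedProportion] at h2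
  linarith

/-- A trajectory of low noise is an approximate fluid path. -/
lemma IsTrajectory.isApproxPath {M : ℕ} (hN : 0 < N) (hM : (M : ℝ) = α * N)
    (hcls : ∀ k, ((Finset.univ.filter fun u => cls u = k).card : ℝ) = γ k * N)
    (hs₀ : ∀ u, 1 ≤ s₀ u) {B : ℕ} (hB : ∀ u, s₀ u ≤ B) {T : ℕ} {st : ℕ → Ages N}
    {A : ℕ → Finset (Fin N)} (h : IsTrajectory (IsPriorityDecision cls prec M) s₀ T st A) {δ : ℝ}
    (hδ : 0 ≤ δ) (hnoise : ∑ t ∈ Finset.range T,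
      transitionNoise cls p (B + T + 2) (st t) (A t) (st (t + 1)) ≤ δ ^ 2) :
    IsApproxPath (fun k => (p k : ℝ)) γ α prec (B + T + 2) T (proportion cls s₀) δ
      (fun t => proportion cls (st t)) (fun t => schedProportion cls (st t) (A t)) := by
  have hN' : (N : ℝ) ≠ 0 := by positivity
  have hlo := h.one_le hs₀
  have hhi := h.le_add hB
  refine ⟨by simp only [h.init], fun t ht => ?_, fun t ht k => ?_, fun t ht k => ?_,
    fun t ht k i hi => ?_, fun t => proportion_le_one cls _, fun t => proportion_nonneg cls _,
    fun t => schedProportion_le_one _ _, fun t => schedProportion_nonneg cls _ _⟩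
  · exact isAllocation_proportion hN hM hcls (h.decision t ht) (hlo t ht.le)
      fun u => by have := hhi t ht.le u; omega
  · exact proportion_eq_zero cls fun u hu => by have := hlo (t + 1) ht u; omega
  · rw [sum_proportion cls (fun u => by have := hhi (t + 1) ht u; omega), hcls,
      mul_div_cancel_right₀ _ hN']
  -- Ages never exceed `B + T`, so the balance equations outside the range of the noise are
  -- trivially exact.
  · rcases lt_or_ge i (B + T + 2) with hiS | hiS
    · obtain ⟨i, rfl⟩ : ∃ j, i = j + 1 := ⟨i - 1, by omega⟩
      refine abs_le_of_sq_le_sq ?_ hδ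
      refine le_trans ?_ hnoise
      refine le_trans ?_ (Finset.single_le_sum (fun t _ => transitionNoise_nonneg cls p _ _ _ _)
        (Finset.mem_range.2 ht))
      unfold transitionNoise
      refine le_trans ?_ (Finset.single_le_sum
        (fun k _ => Finset.sum_nonneg fun i _ => sq_nonneg _) (Finset.mem_univ k))
      exact Finset.single_le_sum (f := fun i => (proportion cls (st (t + 1)) k (i + 2)
        - proportion cls (st t) k (i + 1) + p k * schedProportion cls (st t) (A t) k (i + 1)) ^ 2)
        (fun i _ => sq_nonneg _) (Finset.mem_range.2 (by omega))
    · have h1 : proportion cls (st (t + 1)) k (i + 1) = 0 :=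
        proportion_eq_zero cls fun u hu => by have := hhi (t + 1) ht u; omega
      have h2 : proportion cls (st t) k i = 0 :=
        proportion_eq_zero cls fun u hu => by have := hhi t ht.le u; omega
      have h3 : schedProportion cls (st t) (A t) k i = 0 := by
        have h4 := schedProportion_nonneg cls (st t) (A t)ᶜ k i
        rw [← proportion_sub_schedProportion] at h4
        exact le_antisymm (by linarith) (schedProportion_nonneg cls _ _ _ _)
      simp only [h1, h2, h3]
      simpa using hδ

lemma meanAge_nonneg (s : Ages N) : 0 ≤ meanAge cls s :=
  Finset.sum_nonneg fun k _ => tsum_nonneg fun i =>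
    mul_nonneg (proportion_nonneg cls s k i) (Nat.cast_nonneg i)

lemma meanAge_le (hN : 0 < N) {s : Ages N} {S : ℕ} (hS : ∀ u, s u < S) : meanAge cls s ≤ S := by
  rw [meanAge_eq cls hS]
  have h1 : ∀ k, ageMass S (proportion cls s) k
      ≤ ∑ i ∈ Finset.range S, proportion cls s k i * S := fun k =>
    Finset.sum_le_sum fun i hi => mul_le_mul_of_nonneg_left
      (by exact_mod_cast (Finset.mem_range.1 hi).le) (proportion_nonneg cls s k i)
  refine (Finset.sum_le_sum fun k _ => h1 k).trans ?_
  simp only [← Finset.sum_mul]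
  have h2 : ∑ k, ∑ i ∈ Finset.range S, proportion cls s k i = 1 := by
    have h3 := sum_schedProportion cls hS Finset.univ
    rw [Finset.card_univ, Fintype.card_fin, div_self (by positivity)] at h3
    exact h3
  rw [h2, one_mul]

/-- The average age is near `c` up to the probability of a large noise. -/
lemma abs_averageAge_sub_le {M : ℕ} (hN : 0 < N) (hM : (M : ℝ) = α * N)
    (hcls : ∀ k, ((Finset.univ.filter fun u => cls u = k).card : ℝ) = γ k * N)
    (hs₀ : ∀ u, 1 ≤ s₀ u) {B : ℕ} (hB : ∀ u, s₀ u ≤ B) {π : Policy N}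
    (hπ : ∀ h, ∀ A ∈ (π h).support, IsPriorityDecision cls prec M h.2 A) {T : ℕ} {δ c ε : ℝ}
    (hδ : 0 < δ) (hε : 0 ≤ ε)
    (hnear : ∀ z a, IsApproxPath (fun k => (p k : ℝ)) γ α prec (B + T + 2) T (proportion cls s₀) δ
      z a → |pathCost (B + T + 2) T z - c| ≤ ε) :
    |averageAge p cls π s₀ T - c|
      ≤ ε + ((B + T + 2 : ℕ) + |c|) / δ ^ 2 * (T * (2 * (B + T + 2 : ℕ) / N)) := by
  set S := B + T + 2
  have hfin := historyLaw_support_finite (fun u => p (cls u)) π s₀ T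
  set C : History N → ℝ := fun h => (T : ℝ)⁻¹ * histSum (fun s _ _ => meanAge cls s) h.1 h.2
  set ν : History N → ℝ := fun h => histSum (transitionNoise cls p S) h.1 h.2
  -- Markov's inequality in pathwise form: when the noise exceeds `δ ^ 2`, the term `K * ν`
  -- dominates the trivial bound `S + |c|` of the error.
  set K : ℝ := (S + |c|) / δ ^ 2
  have hK : 0 ≤ K := by positivity
  have hpath : ∀ h ∈ (historyLaw (fun u => p (cls u)) π s₀ T).support, |C h - c| ≤ ε + K * ν h := by
    intro h hh
    obtain ⟨st, A, htr, -, hsum⟩ := exists_trajectory (fun u => p (cls u)) π s₀ hπ hh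
    have hν : ν h = ∑ t ∈ Finset.range T, transitionNoise cls p S (st t) (A t) (st (t + 1)) :=
      hsum _
    have hν0 : 0 ≤ ν h := by
      rw [hν]
      exact Finset.sum_nonneg fun t _ => transitionNoise_nonneg cls p S _ _ _
    have hC : C h = (T : ℝ)⁻¹ * ∑ t ∈ Finset.range T, meanAge cls (st t) := by
      simp only [C, hsum]
    have hage : ∀ t ∈ Finset.range T, ∀ u, st t u < S := fun t ht u => by
      have ht' := Finset.mem_range.1 ht
      have := htr.le_add hB t ht'.le u
      omega
    rcases le_or_gt (ν h) (δ ^ 2) with hle | hlt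
    · have h1 := hnear _ _ (htr.isApproxPath hN hM hcls hs₀ hB hδ.le (hν ▸ hle))
      have h2 : C h = pathCost S T fun t => proportion cls (st t) := by
        rw [hC]
        unfold pathCost
        congr 1
        exact Finset.sum_congr rfl fun t ht => meanAge_eq cls (hage t ht)
      rw [h2]
      exact h1.trans (le_add_of_nonneg_right (mul_nonneg hK hν0))
    · have h0 : 0 ≤ C h := by
        rw [hC]
        exact mul_nonneg (by positivity) (Finset.sum_nonneg fun t _ => meanAge_nonneg _)
      have h1 : C h ≤ S := by
        rw [hC]
        rcases Nat.eq_zero_or_pos T with hT | hT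
        · simp [hT]
        · rw [inv_mul_le_iff₀ (by positivity)]
          refine (Finset.sum_le_sum fun t ht => meanAge_le hN (hage t ht)).trans ?_
          simp
      have h2 : |C h - c| ≤ S + |c| := (abs_sub _ _).trans (by rw [abs_of_nonneg h0]; linarith)
      have h3 : (S : ℝ) + |c| ≤ K * ν h := by
        have h4 : K * δ ^ 2 = S + |c| := div_mul_cancel₀ _ (by positivity)
        rw [← h4]
        exact mul_le_mul_of_nonneg_left hlt.le hK
      linarith
  have hE : expect (historyLaw (fun u => p (cls u)) π s₀ T) (fun h => ε + K * ν h)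
      ≤ ε + K * (T * (2 * S / N)) := by
    rw [expect_add hfin, expect_const hfin, expect_const_mul]
    have := mul_le_mul_of_nonneg_left (expect_noise_le cls p π s₀ S T) hK
    linarith
  rw [averageAge_eq_expect, abs_le]
  have hc := expect_const hfin c
  constructor
  · have h1 := expect_mono hfin (f := fun _ => c) (g := fun h => C h + (ε + K * ν h))
      fun h hh => by linarith [(abs_le.1 (hpath h hh)).1]
    rw [hc, expect_add hfin] at h1
    linarith
  · have h1 := expect_mono hfin (f := C) (g := fun h => c + (ε + K * ν h))
      fun h hh => by linarith [(abs_le.1 (hpath h hh)).2]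
    rw [expect_add hfin, hc] at h1
    linarith

end convergence

/-! ### Sequences of systems with fixed initial proportions -/

section sequence

variable {p : Fin 2 → unitInterval} {γ : Fin 2 → ℝ} {α : ℝ}
  {prec : Fin 2 × ℕ → Fin 2 × ℕ → Prop} {x : Fin 2 → ℕ → ℝ} {N M : ℕ → ℕ}
  {cls : ∀ n, Fin (N n) → Fin 2} {s₀ : ∀ n, Ages (N n)}

/-- The ages of all the initial configurations of proportions `x` are bounded together. -/
lemma exists_initial_bound (hN : Tendsto N atTop atTop)
    (hx : ∀ n k i, proportion (cls n) (s₀ n) k i = x k i) : ∃ B, ∀ n u, s₀ n u ≤ B := by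
  obtain ⟨n₀, -⟩ := (hN.eventually_gt_atTop 0).exists
  refine ⟨Finset.univ.sup (s₀ n₀), fun n u => ?_⟩
  have h1 := proportion_ne_zero (cls n) (s₀ n) u
  rw [hx, ← hx n₀] at h1
  obtain ⟨v, hv⟩ := exists_of_proportion_ne_zero (cls n₀) h1
  rw [← hv]
  exact Finset.le_sup (Finset.mem_univ v)

/-- If all the fluid paths from `x` have almost the cost `c`, so has the average age when the
number of users is large. -/
lemma eventually_averageAge_near (hN : Tendsto N atTop atTop) (hM : ∀ n, (M n : ℝ) = α * N n)
    (hcls : ∀ n k, ((Finset.univ.filter fun u => cls n u = k).card : ℝ) = γ k * N n)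
    (hs₀ : ∀ n u, 1 ≤ s₀ n u) (hx : ∀ n k i, proportion (cls n) (s₀ n) k i = x k i)
    {B : ℕ} (hB : ∀ n u, s₀ n u ≤ B) {π : ∀ n, Policy (N n)}
    (hπ : ∀ n h, ∀ A ∈ (π n h).support, IsPriorityDecision (cls n) prec (M n) h.2 A)
    {T : ℕ} {c ε ε' : ℝ} (hε0 : 0 ≤ ε) (hε : ε < ε')
    (hex : ∀ z a, IsFluidPath (fun k => (p k : ℝ)) γ α prec (B + T + 2) T z a → z 0 = x →
      |pathCost (B + T + 2) T z - c| ≤ ε) :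
    ∀ᶠ n in atTop, |averageAge p (cls n) (π n) (s₀ n) T - c| ≤ ε' := by
  -- Half of `ε' - ε` pays for passing from exact to approximate paths, the other half for large
  -- noise. The tolerance `δ` does not depend on `n`, so the latter vanishes as `N` grows.
  obtain ⟨δ, hδ, hnear⟩ := exists_approx_pathCost_near (ε' := (ε + ε') / 2) (by linarith) hex
  have hlim : Tendsto (fun n => (ε + ε') / 2 + ((B + T + 2 : ℕ) + |c|) / δ ^ 2
      * (T * (2 * (B + T + 2 : ℕ) / (N n : ℝ)))) atTop (𝓝 ((ε + ε') / 2 + ((B + T + 2 : ℕ) + |c|) / δ ^ 2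
      * (T * 0))) := by
    refine (((Tendsto.const_div_atTop ?_ _).const_mul _).const_mul _).const_add _
    exact tendsto_natCast_atTop_atTop.comp hN
  rw [mul_zero, mul_zero, add_zero] at hlim
  filter_upwards [hlim.eventually_le_const (show (ε + ε') / 2 < ε' by linarith),
    hN.eventually_gt_atTop 0] with n hn hNn
  refine (abs_averageAge_sub_le hNn (hM n) (hcls n) (hs₀ n) (hB n) (hπ n) hδ (by linarith)
    fun z a hza => hnear z a ?_).trans hn
  have : proportion (cls n) (s₀ n) = x := funext fun k => funext fun i => hx n k i
  exact this ▸ hza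

end sequence

/-! ### Uniqueness of the fluid path under a total priority order -/

section uniqueness

variable {p γ : Fin 2 → ℝ} {α : ℝ} {prec : Fin 2 × ℕ → Fin 2 × ℕ → Prop} {S T : ℕ}

/-- Allocations of equal total mass that differ have one state receiving more and another receiving
less. Whichever has the higher priority is left partly unscheduled in one allocation while the other
state is served there. -/
lemma IsAllocation.unique {z a a' : Fin 2 → ℕ → ℝ} (h : IsAllocation γ α prec S z a)
    (h' : IsAllocation γ α prec S z a') (htot : ∀ s s', s ≠ s' → prec s s' ∨ prec s' s) :
    a = a' := by
  have key : ∀ {b b' : Fin 2 → ℕ → ℝ}, IsAllocation γ α prec S z b → IsAllocation γ α prec S z b' →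
      ∀ k i, b k i ≤ b' k i := by
    intro b b' hb hb' k i
    by_contra! hlt
    have hiS : i < S := by
      by_contra! hi
      rw [hb.a_far k hi, hb'.a_far k hi] at hlt
      exact lt_irrefl _ hlt
    obtain ⟨l, j, hlj⟩ : ∃ l j, b l j < b' l j := by
      by_contra! hle
      have h1 : ∑ k, ∑ i ∈ Finset.range S, b' k i < ∑ k, ∑ i ∈ Finset.range S, b k i :=
        Finset.sum_lt_sum (fun l _ => Finset.sum_le_sum fun j _ => hle l j)
          ⟨k, Finset.mem_univ k, Finset.sum_lt_sum (fun j _ => hle k j)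
            ⟨i, Finset.mem_range.2 hiS, hlt⟩⟩
      rw [hb.sched, hb'.sched] at h1
      exact lt_irrefl _ h1
    have hne : (k, i) ≠ (l, j) := by
      rintro he
      obtain ⟨rfl, rfl⟩ := Prod.mk.inj he
      exact lt_asymm hlt hlj
    rcases htot _ _ hne with hp | hp
    · have h1 : 0 < b k i := (hb'.nonneg k i).trans_lt hlt
      have h2 : 0 < z l j - b l j := by linarith [hb'.le l j]
      exact (mul_pos h1 h2).ne' (hb.prio k i l j hp)
    · have h1 : 0 < b' l j := (hb.nonneg l j).trans_lt hlj
      have h2 : 0 < z k i - b' k i := by linarith [hb.le k i]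
      exact (mul_pos h1 h2).ne' (hb'.prio l j k i hp)
  funext k i
  exact le_antisymm (key h h' k i) (key h' h k i)

/-- Ages other than one are given by the balance equations, and age one by the conservation of mass.
-/
lemma IsStep.unique {z a z' z'' : Fin 2 → ℕ → ℝ} (hS : 2 ≤ S) (h : IsStep p γ S z a z')
    (h' : IsStep p γ S z a z'') : z' = z'' := by
  have h0 : ∀ k i, i ≠ 1 → z' k i = z'' k i := by
    intro k i hi
    rcases Nat.eq_zero_or_pos i with rfl | hpos
    · rw [h.zero, h'.zero]
    · obtain ⟨j, rfl⟩ : ∃ j, i = j + 1 := ⟨i - 1, by omega⟩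
      rw [h.next k j (by omega), h'.next k j (by omega)]
  funext k i
  by_cases hi : i = 1
  · subst hi
    have h1 := (h.mass k).trans (h'.mass k).symm
    rw [← Finset.add_sum_erase _ _ (Finset.mem_range.2 (show 1 < S by omega)),
      ← Finset.add_sum_erase _ _ (Finset.mem_range.2 (show 1 < S by omega)),
      Finset.sum_congr rfl fun i hi => h0 k i (Finset.ne_of_mem_erase hi)] at h1
    exact add_right_cancel h1
  · exact h0 k i hi

lemma IsFluidPath.unique {z a z' a' : ℕ → Fin 2 → ℕ → ℝ} (hS : 2 ≤ S)
    (h : IsFluidPath p γ α prec S T z a) (h' : IsFluidPath p γ α prec S T z' a')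
    (h0 : z 0 = z' 0) (htot : ∀ s s', s ≠ s' → prec s s' ∨ prec s' s) :
    ∀ t ≤ T, z t = z' t := by
  intro t
  induction t with
  | zero => exact fun _ => h0
  | succ t ih =>
    intro ht
    have hz := ih (by omega)
    have h1 := h'.alloc t ht
    have h2 := h'.step t ht
    rw [← hz] at h1 h2
    rw [← (h.alloc t ht).unique h1 htot] at h2
    exact (h.step t ht).unique hS h2

end uniqueness

/-! ### Whittle index policies -/

section whittle

variable {p : Fin 2 → unitInterval} {γ : Fin 2 → ℝ} {α W θ : ℝ}

/-- The assumption on `α` says exactly that `(1 - α) / (p₂ α) < D - 2`; `m` is this quotient rounded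
up, and rounding adds less than `1`. -/
lemma exists_fluidParams (hp₂ : 0 < (p 1 : ℝ)) (hp : (p 1 : ℝ) < p 0) (hp₁ : (p 0 : ℝ) < 1)
    (hγ : ∀ k, 0 < γ k) (hγ_sum : γ 0 + γ 1 = 1) (hα_lt : α < 1)
    (hα : 1 / (1 + (alternationBound (p 0) (p 1) - 2) * p 1) < α) :
    ∃ m, FluidParams (fun k => (p k : ℝ)) γ α m := by
  have hD := two_lt_alternationBound hp₂ hp hp₁
  have h1 : 0 < (alternationBound (p 0) (p 1) - 2) * p 1 := mul_pos (by linarith) hp₂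
  have hα0 : 0 < α := lt_trans (by positivity) hα
  rw [div_lt_iff₀ (by linarith)] at hα
  have h2 : 0 < (p 1 : ℝ) * α := mul_pos hp₂ hα0
  have h3 : 0 < (1 - α) / (p 1 * α) := div_pos (by linarith) h2
  have h4 : (1 - α) / (p 1 * α) < alternationBound (p 0) (p 1) - 2 := by
    rw [div_lt_iff₀ h2]
    linarith
  refine ⟨⌈(1 - α) / (p 1 * α)⌉₊, ⟨hp₂, hp, hp₁, hγ, hγ_sum, hα0, hα_lt, ?_, ?_, ?_⟩⟩
  · exact Nat.ceil_pos.2 h3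
  · have := Nat.ceil_lt_add_one h3.le
    linarith
  · exact (div_le_iff₀ h2).1 (Nat.le_ceil _)

/-- The index priority, with the ties broken by `r`. -/
def tieLess (p : Fin 2 → ℝ) (r : Fin 2 × ℕ → Fin 2 × ℕ → Prop) (s s' : Fin 2 × ℕ) : Prop :=
  indexLess p s s' ∨ whittleIndex (p s.1) s.2 = whittleIndex (p s'.1) s'.2 ∧ r s s'

lemma tieLess_total (p : Fin 2 → ℝ) {r : Fin 2 × ℕ → Fin 2 × ℕ → Prop}
    (hr : IsStrictTotalOrder (Fin 2 × ℕ) r) (s s' : Fin 2 × ℕ) (hne : s ≠ s') :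
    tieLess p r s s' ∨ tieLess p r s' s := by
  rcases lt_trichotomy (whittleIndex (p s.1) s.2) (whittleIndex (p s'.1) s'.2) with h | h | h
  · exact Or.inl (Or.inl h)
  · rcases trichotomous_of r s s' with h' | h' | h'
    · exact Or.inl (Or.inr ⟨h, h'⟩)
    · exact absurd h' hne
    · exact Or.inr (Or.inr ⟨h.symm, h'⟩)
  · exact Or.inr (Or.inl h)

variable {N : ℕ} {cls : Fin N → Fin 2} {M : ℕ} {π : Policy N}

lemma IsWhittlePolicy.isPriorityDecision (hπ : IsWhittlePolicy p cls M π) (h : History N) :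
    ∀ A ∈ (π h).support, IsPriorityDecision cls (indexLess fun k => (p k : ℝ)) M h.2 A :=
  fun A hA => ⟨(hπ h A hA).1, fun u hu v hv => not_lt.2 ((hπ h A hA).2 u hu v hv)⟩

lemma IsWhittlePolicy.isPriorityDecision_tieLess (hπ : IsWhittlePolicy p cls M π)
    {r : Fin 2 × ℕ → Fin 2 × ℕ → Prop} (hr : BreaksTiesBy p cls r π) (h : History N) :
    ∀ A ∈ (π h).support, IsPriorityDecision cls (tieLess (fun k => (p k : ℝ)) r) M h.2 A :=
  fun A hA => ⟨(hπ h A hA).1, fun u hu v hv hlt => hlt.elim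
    (not_lt.2 ((hπ h A hA).2 u hu v hv)) fun he => hr h A hA u hu v hv he.1.symm he.2⟩

end whittle

section asymptotics

variable {p : Fin 2 → unitInterval} {γ : Fin 2 → ℝ} {α W θ : ℝ} {x : Fin 2 → ℕ → ℝ}
  {N M : ℕ → ℕ} {cls : ∀ n, Fin (N n) → Fin 2} {s₀ : ∀ n, Ages (N n)} {π : ∀ n, Policy (N n)}

/-- Only the strict index order constrains the fluid paths here, so every tie-breaking rule is
covered. The time `T₀` must come from an estimate uniform in `S`, because the truncation `B + T + 2`
grows with `T`. -/
lemma averageAge_near_zStarCost {m : ℕ} (P : FluidParams (fun k => (p k : ℝ)) γ α m)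
    (hsol : IsRelaxedSolution p γ α W θ) (hN : Tendsto N atTop atTop)
    (hM : ∀ n, (M n : ℝ) = α * N n)
    (hcls : ∀ n k, ((Finset.univ.filter fun u => cls n u = k).card : ℝ) = γ k * N n)
    (hs₀ : ∀ n u, 1 ≤ s₀ n u) (hx : ∀ n k i, proportion (cls n) (s₀ n) k i = x k i)
    (hπ : ∀ n, IsWhittlePolicy p (cls n) (M n) (π n)) {ε : ℝ} (hε : 0 < ε) :
    ∃ T₀ : ℕ, ∀ T ≥ T₀, ∀ᶠ n in atTop,
      |averageAge p (cls n) (π n) (s₀ n) T - zStarCost p γ W θ| ≤ ε := by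
  obtain ⟨B, hB⟩ := exists_initial_bound hN hx
  have hx0 : ∀ k i, 0 ≤ x k i := fun k i => hx 0 k i ▸ proportion_nonneg _ _ _ _
  have hx1 : ∀ k i, x k i ≤ 1 := fun k i => hx 0 k i ▸ proportion_le_one _ _ _ _
  have hxB : ∀ k i, B < i → x k i = 0 := fun k i hi => by
    rw [← hx 0]
    exact proportion_eq_zero _ fun u hu => by have := hB 0 u; omega
  have hA : ∀ S k, ageMass S x k ≤ ∑ i ∈ Finset.range (B + 1), (i : ℝ) := by
    intro S k
    calc ageMass S x k ≤ ∑ i ∈ Finset.range (B + 1), x k i * i := by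
          unfold ageMass
          rcases le_total S (B + 1) with h | h
          · exact Finset.sum_le_sum_of_subset_of_nonneg (Finset.range_mono h)
              fun i _ _ => mul_nonneg (hx0 k i) (Nat.cast_nonneg i)
          · refine (Finset.sum_subset (Finset.range_mono h) fun i _ hi => ?_).ge
            rw [hxB k i (by simpa using hi), zero_mul]
      _ ≤ _ := Finset.sum_le_sum fun i _ => mul_le_of_le_one_left (Nat.cast_nonneg i) (hx1 k i)
  obtain ⟨T₀, hT₀⟩ := exists_time_average_near P hsol
    (Finset.sum_nonneg fun i (_ : i ∈ Finset.range (B + 1)) => (Nat.cast_nonneg i : (0 : ℝ) ≤ i))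
    (half_pos hε)
  refine ⟨T₀, fun T hT => ?_⟩
  refine eventually_averageAge_near (prec := indexLess fun k => (p k : ℝ)) hN hM hcls hs₀ hx hB
    (fun n h => (hπ n).isPriorityDecision h) (half_pos hε).le (half_lt_self hε)
    fun z a hza h0 => ?_
  exact hT₀ T hT _ z a (by omega) hza fun k => h0 ▸ hA _ k

/-- With all ties ordered, the priority is total and the fluid path from `x` is unique, so its cost
is the limit for each fixed `T`. -/
lemma exists_tendsto_averageAge (hN : Tendsto N atTop atTop) (hM : ∀ n, (M n : ℝ) = α * N n)
    (hcls : ∀ n k, ((Finset.univ.filter fun u => cls n u = k).card : ℝ) = γ k * N n)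
    (hs₀ : ∀ n u, 1 ≤ s₀ n u) (hx : ∀ n k i, proportion (cls n) (s₀ n) k i = x k i)
    (hπ : ∀ n, IsWhittlePolicy p (cls n) (M n) (π n)) {r : Fin 2 × ℕ → Fin 2 × ℕ → Prop}
    (hr : IsStrictTotalOrder (Fin 2 × ℕ) r) (hties : ∀ n, BreaksTiesBy p (cls n) r (π n)) (T : ℕ) :
    ∃ c, Tendsto (fun n => averageAge p (cls n) (π n) (s₀ n) T) atTop (𝓝 c) := by
  obtain ⟨B, hB⟩ := exists_initial_bound hN hx
  set prec := tieLess (fun k => (p k : ℝ)) r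
  obtain ⟨c, hc⟩ : ∃ c, ∀ z a, IsFluidPath (fun k => (p k : ℝ)) γ α prec (B + T + 2) T z a →
      z 0 = x → pathCost (B + T + 2) T z = c := by
    by_cases hex : ∃ z a, IsFluidPath (fun k => (p k : ℝ)) γ α prec (B + T + 2) T z a ∧ z 0 = x
    · obtain ⟨z, a, hza, h0⟩ := hex
      refine ⟨pathCost (B + T + 2) T z, fun z' a' hza' h0' => ?_⟩
      have h := hza'.unique (by omega) hza (h0'.trans h0.symm) (tieLess_total _ hr)
      unfold pathCost
      congr 1
      exact Finset.sum_congr rfl fun t ht => by rw [h t (Finset.mem_range.1 ht).le]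
    -- If there were no fluid path from `x`, any value would do.
    · exact ⟨0, fun z a hza h0 => absurd ⟨z, a, hza, h0⟩ hex⟩
  refine ⟨c, Metric.tendsto_nhds.2 fun ε hε => ?_⟩
  refine (eventually_averageAge_near hN hM hcls hs₀ hx hB
    (fun n h => (hπ n).isPriorityDecision_tieLess (hties n) h) le_rfl (half_pos hε)
    fun z a hza h0 => by rw [hc z a hza h0, sub_self, abs_zero]).mono fun n hn => ?_
  rw [Real.dist_eq]
  linarith

end asymptotics

end AgeWhittle

end

theorem mainTheorem1
    (p : Fin 2 → unitInterval) (hp₂ : 0 < (p 1 : ℝ)) (hp : (p 1 : ℝ) < p 0) (hp₁ : (p 0 : ℝ) < 1)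
    (γ : Fin 2 → ℝ) (hγ : ∀ k, 0 < γ k) (hγ_sum : γ 0 + γ 1 = 1)
    (α : ℝ) (hα_lt : α < 1)
    (hα : 1 / (1 + (AgeWhittle.alternationBound (p 0) (p 1) - 2) * p 1) < α)
    (x : Fin 2 → ℕ → ℝ)
    (N : ℕ → ℕ) (hN : Filter.Tendsto N Filter.atTop Filter.atTop)
    (M : ℕ → ℕ) (hM : ∀ n, (M n : ℝ) = α * N n)
    (cls : ∀ n, Fin (N n) → Fin 2)
    (hcls : ∀ n k, ((Finset.univ.filter fun u => cls n u = k).card : ℝ) = γ k * N n)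
    (s₀ : ∀ n, AgeWhittle.Ages (N n)) (hs₀ : ∀ n u, 1 ≤ s₀ n u)
    (hx : ∀ n k i, AgeWhittle.proportion (cls n) (s₀ n) k i = x k i) :
    (∃! q : ℝ × ℝ, AgeWhittle.IsRelaxedSolution p γ α q.1 q.2) ∧
    ∀ W θ : ℝ, AgeWhittle.IsRelaxedSolution p γ α W θ →
      (∀ k, Summable fun i : ℕ => (i : ℝ) * AgeWhittle.zStar p γ W θ k i) ∧
        -- the cost of `z*` is the optimal cost per user of the relaxed problem
        (∀ n, IsLeast (AgeWhittle.relaxedCosts (fun u => p (cls n u)) (s₀ n) α)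
          ((N n * AgeWhittle.zStarCost p γ W θ : ℝ) : EReal)) ∧
        -- Whittle index policies, with arbitrary tie-breaking
        (∀ π : ∀ n, AgeWhittle.Policy (N n),
          (∀ n, AgeWhittle.IsWhittlePolicy p (cls n) (M n) (π n)) →
          ∀ ε > 0, ∃ T₀ : ℕ, ∀ T ≥ T₀, ∀ᶠ n in Filter.atTop,
            |AgeWhittle.averageAge p (cls n) (π n) (s₀ n) T
                - AgeWhittle.zStarCost p γ W θ| ≤ ε) ∧
        -- a fixed priority order for the ties makes the limit in `N` exist for every `T`
        (∀ (r : Fin 2 × ℕ → Fin 2 × ℕ → Prop), IsStrictTotalOrder (Fin 2 × ℕ) r →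
          ∀ π : ∀ n, AgeWhittle.Policy (N n),
          (∀ n, AgeWhittle.IsWhittlePolicy p (cls n) (M n) (π n)) →
          (∀ n, AgeWhittle.BreaksTiesBy p (cls n) r (π n)) →
          ∃ L : ℕ → ℝ,
            (∀ T, Filter.Tendsto
              (fun n => AgeWhittle.averageAge p (cls n) (π n) (s₀ n) T)
              Filter.atTop (nhds (L T))) ∧
            Filter.Tendsto L Filter.atTop (nhds (AgeWhittle.zStarCost p γ W θ))) := by
  obtain ⟨m, P⟩ := AgeWhittle.exists_fluidParams hp₂ hp hp₁ hγ hγ_sum hα_lt hα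
  have hp0 : ∀ k, 0 < (p k : ℝ) := P.p_pos
  refine ⟨AgeWhittle.existsUnique_isRelaxedSolution hp0 hγ hγ_sum P.α_pos hα_lt, fun W θ hsol =>
    ⟨fun k => (AgeWhittle.hasSum_age_zStar hp0 hsol.one_le γ θ k).summable,
      fun n => AgeWhittle.isLeast_relaxedCosts (cls n) (s₀ n) hp0 hsol (hcls n) (hs₀ n),
      fun π hπ ε hε => AgeWhittle.averageAge_near_zStarCost P hsol hN hM hcls hs₀ hx hπ hε,
      fun r hr π hπ hties => ?_⟩⟩
  -- For `T ≥ T₀` the estimate valid for all large `n` passes to the limit in `n`, hence to `L T`.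
  choose L hL using AgeWhittle.exists_tendsto_averageAge hN hM hcls hs₀ hx hπ hr hties
  refine ⟨L, hL, Metric.tendsto_atTop.2 fun ε hε => ?_⟩
  obtain ⟨T₀, hT₀⟩ := AgeWhittle.averageAge_near_zStarCost P hsol hN hM hcls hs₀ hx hπ (half_pos hε)
  refine ⟨T₀, fun T hT => ?_⟩
  have h := le_of_tendsto (((hL T).sub_const _).abs) (hT₀ T hT)
  rw [Real.dist_eq]
  linarith
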